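/- For $1\le r\le\infty$ let $B_r^m=\{v\in\mathbb R^m:\|v\|_r\le 1\}$, and for symmetric convex bodies $P,Q\subseteq\mathbb R^m$ let $$\mathrm{vb}_n(P,Q)=\sup\Big\{\min_{x\in\{-1,1\}^n}\Big\|\sum_{i=1}^n x_iv_i\Big\|_Q \;:\; v_1,\dots,v_n\in P\Big\},$$ where $\|\cdot\|_Q$ is the norm with unit ball $Q$. Let $2\le p\le q\le\infty$ with $(p,q)\ne(2,\infty)$, let $1\le n\le m$, and put $\alpha=\tfrac12-\tfrac1p+\tfrac1q>0$ (with $1/\infty=0$). (1) There is a universal constant $C>0$ such that, for all such $m,n,p,q$, $$\mathrm{vb}_n(B_p^m,B_q^m)\;\le\; C\cdot\frac{\sqrt{\min\{p,\log(2m/n)\}}}{\alpha}\cdot n^{\alpha}.$$ (2) The corresponding coloring can be found in expected time $O(1+\log n)\cdot T(m,n)$, where $T(m,n)$ is the time to generate a sample from a Lovett–Meka partial coloring distribution. In detail: call a probability distribution $\mathcal D$ of a vector $x\in[-1,1]^n$ a Lovett–Meka distribution for $A\in\mathbb R^{m\times n}$ and $x_0\in[-1,1]^n$, with constants $C_1,C_2,K>0$,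 if almost surely at least $n/2$ of the coordinates of $x$ are $\pm1$; almost surely $\|A(x-x_0)\|_\infty\le\Delta$, for every $\Delta\ge0$ with $\sum_{i:A_i\neq 0}\exp(-C_1\Delta^2/\|A_i\|_2^2)\le C_2n$, where $A_i$ are the rows of $A$; $\mathbb E[x]=x_0$; and $\|\langle\theta,x-x_0\rangle\|_{\psi_2}\le K\|\theta\|_2$ for every $\theta\in\mathbb R^n$, where $\|X\|_{\psi_2}=\inf\{s>0:\mathbb E[\exp(X^2/s^2)]\le2\}$. For all $C_1,C_2,K>0$ there are a constant $C>0$ and a single real-RAM program with calls to a sampler (unit cost for real arithmetic, $\exp$, $\log$, comparisons, array accesses, and addition and subtraction of integers), both depending only on $C_1,C_2,K$, for which the following holds. Suppose that every call on a matrix $A\in\mathbb R^{m'\times n'}$ and a point $x_0\in[-1,1]^{n'}$ returns a fresh sample of a Lovett–Meka distribution for $A$ and $x_0$ with the constants $C_1,C_2,K$ and costs $T(m',n')$, where $T$ is nondecreasing in both arguments and $T(m',n')\ge m'n'$. Then for all $m,n,p,q$ as above, on input $m,n,1/p,1/q$ and $v_1,\dots,v_n\in B_p^m$, the program almost surely terminates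 and outputs signs $x\in\{-1,1\}^n$ with $$\Big\|\sum_{i=1}^n x_iv_i\Big\|_q\le C\cdot\frac{\sqrt{\min\{p,\log(2m/n)\}}}{\alpha}\cdot n^{\alpha},$$ and its expected running time is at most $C\,(1+\log n)\,T(m,n)$. -/

import Mathlib

open MeasureTheory ProbabilityTheory Set
open scoped NNReal ENNReal

noncomputable section

/-! ### Vector balancing constants -/

/-- The `ℓ_p` norm on `ℝ^m`, for `p ∈ [1, ∞]`. -/
def vecNorm {m : ℕ} (p : ℝ≥0∞) (v : Fin m → ℝ) : ℝ := ‖WithLp.toLp p v‖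

/-- The unit ball `B_p^m`. -/
def lpBall (p : ℝ≥0∞) (m : ℕ) : Set (Fin m → ℝ) := {v | vecNorm p v ≤ 1}

/-- The signed sum `∑ x_i v_i`. -/
def signedSum {m n : ℕ} (x : Fin n → ℤˣ) (v : Fin n → Fin m → ℝ) : Fin m → ℝ :=
  ∑ i, ((x i : ℤ) : ℝ) • v i

/-- The vector balancing constant `vb_n(P, Q)` for exactly `n` vectors; the norm with unit ball `Q`
is the Minkowski gauge of `Q`. The value lies in `[0, ∞]`, so that no junk value of a supremum can
occur. -/
def vb {m : ℕ} (n : ℕ) (P Q : Set (Fin m → ℝ)) : ℝ≥0∞ :=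
  ⨆ (v : Fin n → Fin m → ℝ) (_ : ∀ i, v i ∈ P),
    ⨅ x : Fin n → ℤˣ, ENNReal.ofReal (gauge Q (signedSum x v))

/-- The exponent `1/2 - 1/p + 1/q`, with `1/∞ = 0`. -/
def balExponent (p q : ℝ≥0∞) : ℝ := 1 / 2 - (p⁻¹).toReal + (q⁻¹).toReal

/-- `√(min{p, log(2m/n)}) · n^(1/2 - 1/p + 1/q) / (1/2 - 1/p + 1/q)`. -/
def balBound (m n : ℕ) (p q : ℝ≥0∞) : ℝ :=
  Real.sqrt (min p (ENNReal.ofReal (Real.log (2 * m / n)))).toReal / balExponent p q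
    * (n : ℝ) ^ balExponent p q

/-! ### The partial coloring distribution -/

/-- The subgaussian norm `‖X‖_{ψ₂}`. -/
def psi2Norm {Ω : Type*} [MeasurableSpace Ω] (X : Ω → ℝ) (μ : Measure Ω) : ℝ :=
  sInf {s : ℝ | 0 < s ∧ ∫⁻ ω, ENNReal.ofReal (Real.exp (X ω ^ 2 / s ^ 2)) ∂μ ≤ 2}

/-- `μ` is a Lovett-Meka distribution for the matrix `A` and the starting point `x₀`. In the
condition on `Δ` a zero row counts `exp (-∞) = 0`, so only the nonzero rows are summed. -/
structure IsPartialColoringLaw (C₁ C₂ K : ℝ) {m n : ℕ} (A : Fin m → Fin n → ℝ) (x₀ : Fin n → ℝ)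
    (μ : Measure (Fin n → ℝ)) : Prop where
  mem_cube : ∀ᵐ x ∂μ, ∀ j, x j ∈ Icc (-1 : ℝ) 1
  half_colored : ∀ᵐ x ∂μ, (n : ℝ) / 2 ≤ (({j | x j = 1 ∨ x j = -1} : Set (Fin n)).ncard : ℝ)
  discrepancy : ∀ Δ : ℝ, 0 ≤ Δ →
    (∑ i, (open Classical in
      if A i = 0 then 0 else Real.exp (-C₁ * (Δ ^ 2 / ∑ j, A i j ^ 2)))) ≤ C₂ * n →
    ∀ᵐ x ∂μ, ∀ i, |∑ j, A i j * (x j - x₀ j)| ≤ Δ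
  mean : ∀ j, ∫ x, x j ∂μ = x₀ j
  subgaussian : ∀ θ : Fin n → ℝ,
    psi2Norm (fun x => ∑ j, θ j * (x j - x₀ j)) μ ≤ K * Real.sqrt (∑ j, θ j ^ 2)

/-- A randomized procedure that is given a matrix with `m` rows and `n` columns and a point of
`ℝ^n` and returns a random point of `ℝ^n`, for all `m` and `n`. -/
abbrev Sampler :=
  ∀ m n : ℕ, Kernel ((Fin m → Fin n → ℝ) × (Fin n → ℝ)) (Fin n → ℝ)

/-- The procedure samples from Lovett-Meka distributions with the constants `C₁, C₂, K`. -/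
structure Sampler.IsLovettMeka (D : Sampler) (C₁ C₂ K : ℝ) : Prop where
  markov : ∀ m n, IsMarkovKernel (D m n)
  spec : ∀ (m n : ℕ) (A : Fin m → Fin n → ℝ) (x₀ : Fin n → ℝ),
    (∀ j, x₀ j ∈ Icc (-1 : ℝ) 1) → IsPartialColoringLaw C₁ C₂ K A x₀ (D m n (A, x₀))

/-- What is required of a time bound for sampling: it is nondecreasing in both arguments and at
least the input length. -/
structure IsTimeBound (T : ℕ → ℕ → ℝ≥0) : Prop where
  mono : ∀ m m' n n' : ℕ, m ≤ m' → n ≤ n' → T m n ≤ T m' n'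
  input_length : ∀ m n : ℕ, (m : ℝ≥0) * (n : ℝ≥0) ≤ T m n

/-! ### A real RAM with calls to a sampler

Programs are built from integer variables and two-dimensional arrays of real numbers. Arithmetic
on real numbers, `exp`, `log`, comparisons, array accesses, and addition and subtraction of
integers have unit cost. A call of the sampler on a matrix with `m` rows and `n` columns costs
`T m n` in addition. -/

namespace RealRAM

/-- The values of the integer variables, the entries `arr a i j` of the real arrays, and the time
spent so far. -/
abbrev State := (ℕ → ℕ) × (ℕ → ℕ → ℕ → ℝ) × ℝ≥0

/-- Integer expressions. -/
inductive NExpr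
  | const (c : ℕ)
  | var (v : ℕ)
  | add (e f : NExpr)
  | sub (e f : NExpr)

def NExpr.eval (s : State) : NExpr → ℕ
  | const c => c
  | var v => s.1 v
  | add e f => e.eval s + f.eval s
  | sub e f => e.eval s - f.eval s

/-- The number of unit-cost operations. -/
def NExpr.cost : NExpr → ℕ
  | const _ => 1
  | var _ => 1
  | add e f => e.cost + f.cost + 1
  | sub e f => e.cost + f.cost + 1

/-- Real expressions; `get a i j` is the entry of array `a` in row `i` and column `j`. -/
inductive RExpr
  | ofNat (e : NExpr)
  | get (a : ℕ) (i j : NExpr)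
  | add (e f : RExpr)
  | sub (e f : RExpr)
  | mul (e f : RExpr)
  | div (e f : RExpr)
  | exp (e : RExpr)
  | log (e : RExpr)

def RExpr.eval (s : State) : RExpr → ℝ
  | ofNat e => e.eval s
  | get a i j => s.2.1 a (i.eval s) (j.eval s)
  | add e f => e.eval s + f.eval s
  | sub e f => e.eval s - f.eval s
  | mul e f => e.eval s * f.eval s
  | div e f => e.eval s / f.eval s
  | exp e => Real.exp (e.eval s)
  | log e => Real.log (e.eval s)

def RExpr.cost : RExpr → ℕ
  | ofNat e => e.cost + 1
  | get _ i j => i.cost + j.cost + 1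
  | add e f => e.cost + f.cost + 1
  | sub e f => e.cost + f.cost + 1
  | mul e f => e.cost + f.cost + 1
  | div e f => e.cost + f.cost + 1
  | exp e => e.cost + 1
  | log e => e.cost + 1

/-- Tests. -/
inductive Test
  | nle (e f : NExpr)
  | rle (e f : RExpr)
  | not (b : Test)
  | and (b c : Test)

def Test.eval (s : State) : Test → Prop
  | nle e f => e.eval s ≤ f.eval s
  | rle e f => e.eval s ≤ f.eval s
  | not b => ¬ b.eval s
  | and b c => b.eval s ∧ c.eval s

def Test.cost : Test → ℕ
  | nle e f => e.cost + f.cost + 1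
  | rle e f => e.cost + f.cost + 1
  | not b => b.cost + 1
  | and b c => b.cost + c.cost + 1

/-- Programs. `sample m n a x y` calls the sampler on the matrix in rows `< m` and columns `< n` of
array `a` and the point in row `0` of array `x`, and stores the result in row `0` of array `y`. -/
inductive Prog
  | nset (v : ℕ) (e : NExpr)
  | rset (a : ℕ) (i j : NExpr) (e : RExpr)
  | seq (P Q : Prog)
  | ite (b : Test) (P Q : Prog)
  | loop (b : Test) (P : Prog)
  | sample (m n : NExpr) (a x y : ℕ)

/-- Let time pass. -/
def tick (c : ℝ≥0) (s : State) : State := (s.1, s.2.1, s.2.2 + c)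

/-- Assign `k` to the integer variable `v`. -/
def setInt (v k : ℕ) (s : State) : State := (Function.update s.1 v k, s.2)

/-- Assign `r` to the entry `(i, j)` of array `a`. -/
def setReal (a i j : ℕ) (r : ℝ) (s : State) : State :=
  (s.1, fun a' i' j' => if a' = a ∧ i' = i ∧ j' = j then r else s.2.1 a' i' j', s.2.2)

/-- Store the vector `z` in row `0` of array `a`. -/
def setRow {n : ℕ} (a : ℕ) (z : Fin n → ℝ) (s : State) : State :=
  (s.1, fun a' i' j' =>
    if h : a' = a ∧ i' = 0 ∧ j' < n then z ⟨j', h.2.2⟩ else s.2.1 a' i' j', s.2.2)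

/-- The loop `while b do P`, where `P` has the law `run` and `c` is the cost of the test; runs that
need `N` or more iterations are discarded. -/
def runLoop (b : Test) (c : ℝ≥0) (run : State → Measure State) : ℕ → State → Measure State
  | 0, _ => 0
  | N + 1, s => open Classical in
      if b.eval s then (run (tick c s)).bind (runLoop b c run N) else Measure.dirac (tick c s)

/-- The law of the final state of a program that is started in the state `s`, restricted to those
runs in which every execution of a loop ends after fewer than `N` iterations. It increases with
`N`, and its limit is the law of the final state of the terminating runs. -/
def run (D : Sampler) (T : ℕ → ℕ → ℝ≥0) (N : ℕ) : Prog → State → Measure State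
  | .nset v e, s => Measure.dirac (tick (e.cost + 1) (setInt v (e.eval s) s))
  | .rset a i j e, s => Measure.dirac
      (tick (i.cost + j.cost + e.cost + 1) (setReal a (i.eval s) (j.eval s) (e.eval s) s))
  | .seq P Q, s => (run D T N P s).bind (run D T N Q)
  | .ite b P Q, s => open Classical in
      if b.eval s then run D T N P (tick (b.cost + 1) s) else run D T N Q (tick (b.cost + 1) s)
  | .loop b P, s => runLoop b (b.cost + 1) (run D T N P) N s
  | .sample m n a x y, s =>
      (D (m.eval s) (n.eval s) (fun i j => s.2.1 a i j, fun j => s.2.1 x 0 j)).map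
        (fun z => tick (m.cost + n.cost + 1 + T (m.eval s) (n.eval s)) (setRow y z s))

/-- The probability that the program terminates in a state with the property `good`. -/
def prob (D : Sampler) (T : ℕ → ℕ → ℝ≥0) (P : Prog) (s : State) (good : State → Prop) : ℝ≥0∞ :=
  ⨆ N, run D T N P s {t | good t}

/-- The expected running time of a program that is started at time `0` and terminates almost
surely. -/
def expectedTime (D : Sampler) (T : ℕ → ℕ → ℝ≥0) (P : Prog) (s : State) : ℝ≥0∞ :=
  ⨆ N, ∫⁻ t, (t.2.2 : ℝ≥0∞) ∂(run D T N P s)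

/-- The input: the integer variables `0` and `1` hold `m` and `n`, the columns of the matrix in
array `0` are the vectors `v 0, …, v (n - 1)`, and row `0` of array `1` starts with `1/p` and
`1/q`. Everything else is `0`. -/
def input {m n : ℕ} (p q : ℝ≥0∞) (v : Fin n → Fin m → ℝ) : State :=
  (fun k => if k = 0 then m else if k = 1 then n else 0,
   fun a i j =>
     if a = 0 then (if h : i < m ∧ j < n then v ⟨j, h.2⟩ ⟨i, h.1⟩ else 0)
     else if a = 1 ∧ i = 0 ∧ j = 0 then (p⁻¹).toReal
     else if a = 1 ∧ i = 0 ∧ j = 1 then (q⁻¹).toReal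
     else 0,
   0)

/-- The output: row `0` of array `2` starts with the signs `x 0, …, x (n - 1)`. -/
def Outputs {n : ℕ} (s : State) (x : Fin n → ℤˣ) : Prop :=
  ∀ j : Fin n, s.2.1 2 0 j = ((x j : ℤ) : ℝ)

end RealRAM

end

/-! ### `ℓ_p` norms of vectors -/

/-! Let `A` have columns in `B_p^m`, and measure its rows in units of `n^(1/2-1/p)`: `u_i = ‖A_i‖₂ /
n^(1/2-1/p)`. For finite `p`, power means give `∑ u_i^p ≤ n`; for `p = ∞` every `u_i` is at most
`1`. With `L = log (2m/n)` and `M = min{p, L}` it follows that `∑ u_i² exp(-M/u_i²) ≤ 3n/2`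
(`sum_rowRatio_sq_mul_exp_le`). This is the budget that a partial coloring needs for an error of
order `D = √M · n^(1/2-1/p)` in every coordinate.

To pass to `ℓ_q` (`vecNorm_le_of_abs_le`), note that for `p ≥ L` there are at most `e^q n`
coordinates, so the bound `D` on each costs only a factor `O(n^(1/q))`. For `p < L` one also asks
that `∑ |y_i|^p ≤ n D^p`, which subgaussian moments and Markov's inequality provide, and
interpolates with the sup bound. One partial coloring therefore costs `O(√M · n^α)`.

Iterating, a fixed fraction of the vectors is colored each time while `m` stays. The costs form a
geometric series up to the growth of `log (2m/n)`. If `p ≤ 3`, a shifted logarithm makes the minimum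
constant; otherwise `α ≥ 1/6` and half of the power `n^α` absorbs the logarithm
(`smoothBound_le_of_le`). The other half decays at rate `1 - Ω(α)`, whence the factor `1/α`.

For part (1) the partial coloring is half the difference of two sign vectors that are far apart but
lie in one cell of a rounding; a weighted pigeonhole argument finds them (`exists_close_far_pair`).
For part (2) the program draws samples and discards those that violate the `ℓ_p` condition, which
happens with probability at most `1/2` (`IsPartialColoringLaw.rejected_le`). Each accepted sample
halves the number of uncolored coordinates, so the number of its binary digits is a potential that
gives expected time and almost sure termination (`lintegral_time_runLoop_le`, `one_le_runLoop_add`).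
The code around the sampler is verified with a small Hoare logic (`Triple`). -/

theorem vecNorm_of_ne_top {m : ℕ} {p : ℝ≥0∞} (hp : 2 ≤ p) (hp' : p ≠ ⊤) (v : Fin m → ℝ) :
    vecNorm p v = (∑ i, |v i| ^ p.toReal) ^ (1 / p.toReal) := by
  have h0 : 0 < p.toReal := ENNReal.toReal_pos (by rintro rfl; simp at hp) hp'
  unfold vecNorm
  rw [PiLp.norm_eq_sum h0]
  rfl

theorem vecNorm_top_le {m : ℕ} {v : Fin m → ℝ} {D : ℝ} (hD : 0 ≤ D) (h : ∀ i, |v i| ≤ D) :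
    vecNorm ⊤ v ≤ D := by
  unfold vecNorm
  rw [PiLp.norm_eq_ciSup]
  exact Real.iSup_le (fun i => h i) hD

theorem abs_le_vecNorm_top {m : ℕ} (v : Fin m → ℝ) (i : Fin m) : |v i| ≤ vecNorm ⊤ v := by
  unfold vecNorm
  rw [PiLp.norm_eq_ciSup]
  exact le_ciSup (f := fun i => ‖(WithLp.toLp ⊤ v).ofLp i‖) (Set.finite_range _).bddAbove i

theorem two_le_toReal {p : ℝ≥0∞} (hp : 2 ≤ p) (hp' : p ≠ ⊤) : 2 ≤ p.toReal := by
  simpa using ENNReal.toReal_mono hp' hp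

theorem sum_rpow_le_one_of_mem_lpBall {m : ℕ} {p : ℝ≥0∞} (hp : 2 ≤ p) (hp' : p ≠ ⊤)
    {v : Fin m → ℝ} (hv : v ∈ lpBall p m) : ∑ i, |v i| ^ p.toReal ≤ 1 := by
  have h2 := two_le_toReal hp hp'
  have h : vecNorm p v ≤ 1 := hv
  rw [vecNorm_of_ne_top hp hp'] at h
  have h0 : 0 ≤ ∑ i, |v i| ^ p.toReal :=
    Finset.sum_nonneg fun i _ => Real.rpow_nonneg (abs_nonneg _) _
  by_contra hc
  have := Real.one_lt_rpow (not_le.1 hc) (show 0 < 1 / p.toReal by positivity)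
  linarith

theorem vecNorm_add_le {m : ℕ} {p : ℝ≥0∞} (hp : 2 ≤ p) (v w : Fin m → ℝ) :
    vecNorm p (v + w) ≤ vecNorm p v + vecNorm p w := by
  have : Fact (1 ≤ p) := ⟨le_trans (by norm_num) hp⟩
  unfold vecNorm
  rw [WithLp.toLp_add]
  exact norm_add_le _ _

theorem vecNorm_zero {m : ℕ} {p : ℝ≥0∞} (hp : 2 ≤ p) : vecNorm p (0 : Fin m → ℝ) = 0 := by
  have : Fact (1 ≤ p) := ⟨le_trans (by norm_num) hp⟩
  unfold vecNorm
  rw [WithLp.toLp_zero]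
  exact norm_zero

theorem vecNorm_smul {m : ℕ} {p : ℝ≥0∞} (hp : 2 ≤ p) (c : ℝ) (v : Fin m → ℝ) :
    vecNorm p (c • v) = |c| * vecNorm p v := by
  have : Fact (1 ≤ p) := ⟨le_trans (by norm_num) hp⟩
  unfold vecNorm
  rw [WithLp.toLp_smul]
  exact norm_smul _ _

theorem vecNorm_sum_le {m : ℕ} {p : ℝ≥0∞} (hp : 2 ≤ p) {ι : Type*} (s : Finset ι)
    (f : ι → Fin m → ℝ) : vecNorm p (∑ j ∈ s, f j) ≤ ∑ j ∈ s, vecNorm p (f j) := by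
  classical
  induction s using Finset.induction_on with
  | empty => simp [vecNorm_zero hp]
  | insert a s ha ih =>
    rw [Finset.sum_insert ha, Finset.sum_insert ha]
    exact (vecNorm_add_le hp _ _).trans (by gcongr)

/-- The unit balls of the `ℓ_p` norms shrink to those of smaller exponents. -/
theorem vecNorm_le_one_mono {m : ℕ} {p q : ℝ≥0∞} (hp : 2 ≤ p) (hpq : p ≤ q) {v : Fin m → ℝ}
    (hv : vecNorm p v ≤ 1) : vecNorm q v ≤ 1 := by
  rcases eq_or_ne p ⊤ with rfl | hp'
  · rwa [top_le_iff.1 hpq]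
  have h1 := sum_rpow_le_one_of_mem_lpBall hp hp' hv
  have h2 := two_le_toReal hp hp'
  have h3 : ∀ i, |v i| ≤ 1 := by
    intro i
    by_contra hc
    have h4 := Finset.single_le_sum (f := fun i => |v i| ^ p.toReal)
      (fun i _ => Real.rpow_nonneg (abs_nonneg _) _) (Finset.mem_univ i)
    have := Real.one_lt_rpow (not_le.1 hc) (show 0 < p.toReal by linarith)
    linarith
  rcases eq_or_ne q ⊤ with rfl | hq'
  · exact vecNorm_top_le zero_le_one h3
  rw [vecNorm_of_ne_top (hp.trans hpq) hq']
  have h5 : p.toReal ≤ q.toReal := ENNReal.toReal_mono hq' hpq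
  refine Real.rpow_le_one (Finset.sum_nonneg fun i _ => Real.rpow_nonneg (abs_nonneg _) _) ?_
    (by positivity)
  refine le_trans (Finset.sum_le_sum fun i _ => ?_) h1
  exact Real.rpow_le_rpow_of_exponent_ge_of_imp (abs_nonneg _) (h3 i) h5 (by intro _ h; linarith)

/-! ### The truncated logarithm `min{p, x}` -/

/-- The real number `min{p, x}`, for `x ≥ 0`. -/
noncomputable def minReal (p : ℝ≥0∞) (x : ℝ) : ℝ := (min p (ENNReal.ofReal x)).toReal

theorem minReal_top {x : ℝ} (hx : 0 ≤ x) : minReal ⊤ x = x := by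
  simp [minReal, hx]

theorem minReal_of_ne_top {p : ℝ≥0∞} (hp : p ≠ ⊤) {x : ℝ} (hx : 0 ≤ x) :
    minReal p x = min p.toReal x := by
  rw [minReal, ENNReal.toReal_min hp ENNReal.ofReal_ne_top, ENNReal.toReal_ofReal hx]

theorem minReal_mono {p : ℝ≥0∞} {x y : ℝ} (hxy : x ≤ y) : minReal p x ≤ minReal p y := by
  refine ENNReal.toReal_mono ?_ (min_le_min_left p (ENNReal.ofReal_le_ofReal hxy))
  exact ne_top_of_le_ne_top ENNReal.ofReal_ne_top (min_le_right _ _)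

theorem half_le_minReal {p : ℝ≥0∞} (hp : 2 ≤ p) {x : ℝ} (hx : 2 / 3 ≤ x) : 2 / 3 ≤ minReal p x := by
  rcases eq_or_ne p ⊤ with rfl | hp'
  · rwa [minReal_top (by linarith)]
  · rw [minReal_of_ne_top hp' (by linarith)]
    exact le_min (by linarith [two_le_toReal hp hp']) hx

theorem minReal_mul_le {p : ℝ≥0∞} {x c : ℝ} (hx : 0 ≤ x) (hc : 1 ≤ c) :
    minReal p (c * x) ≤ c * minReal p x := by
  rcases eq_or_ne p ⊤ with rfl | hp'
  · rw [minReal_top hx, minReal_top (by positivity)]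
  · rw [minReal_of_ne_top hp' hx, minReal_of_ne_top hp' (by positivity),
      mul_min_of_nonneg _ _ (by linarith)]
    exact min_le_min_right _ (le_mul_of_one_le_left ENNReal.toReal_nonneg hc)

/-- `log (2m/n)`. -/
noncomputable def logRatio (m n : ℕ) : ℝ := Real.log (2 * m / n)

/-- The ratio is at least `2` and `log 2 > 2/3`. Keeping `M` away from `0` is what lets the weight
estimates below absorb their constants. -/
theorem two_thirds_le_logRatio {m n : ℕ} (hn : 1 ≤ n) (hnm : n ≤ m) : 2 / 3 ≤ logRatio m n := by
  have hn' : (0 : ℝ) < n := by exact_mod_cast hn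
  have hnm' : (n : ℝ) ≤ m := by exact_mod_cast hnm
  have h1 : (2 : ℝ) ≤ 2 * m / n := by rw [le_div_iff₀ hn']; linarith
  have h2 := Real.log_le_log (by norm_num) h1
  have := Real.log_two_gt_d9
  unfold logRatio
  linarith

theorem exp_logRatio {m n : ℕ} (hn : 1 ≤ n) (hnm : n ≤ m) :
    Real.exp (logRatio m n) = 2 * m / n := by
  have hn' : (0 : ℝ) < n := by exact_mod_cast hn
  have hm' : (0 : ℝ) < m := by exact_mod_cast hn.trans hnm
  exact Real.exp_log (by positivity)

/-! ### Row norms of a matrix whose columns lie in `B_p^m` -/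

/-- The Euclidean norm of a row, in units of `n^(1/2 - 1/p)`. -/
noncomputable def rowRatio {m n : ℕ} (p : ℝ≥0∞) (A : Fin m → Fin n → ℝ) (i : Fin m) : ℝ :=
  Real.sqrt (∑ j, A i j ^ 2) / (n : ℝ) ^ (1 / 2 - (p⁻¹).toReal)

theorem rowRatio_nonneg {m n : ℕ} (p : ℝ≥0∞) (A : Fin m → Fin n → ℝ) (i : Fin m) :
    0 ≤ rowRatio p A i := by unfold rowRatio; positivity

theorem rowRatio_le_one {m n : ℕ} (hn : 1 ≤ n) {A : Fin m → Fin n → ℝ}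
    (hA : ∀ j, (fun i => A i j) ∈ lpBall ⊤ m) (i : Fin m) : rowRatio ⊤ A i ≤ 1 := by
  have hn' : (0 : ℝ) < n := by exact_mod_cast hn
  unfold rowRatio
  rw [div_le_one (by positivity)]
  simp only [ENNReal.inv_top, ENNReal.toReal_zero, sub_zero, ← Real.sqrt_eq_rpow]
  apply Real.sqrt_le_sqrt
  calc ∑ j, A i j ^ 2 ≤ ∑ _j : Fin n, (1 : ℝ) := Finset.sum_le_sum fun j _ => by
        have h1 := (abs_le_vecNorm_top (fun i => A i j) i).trans (hA j)
        rw [← sq_abs]; nlinarith [abs_nonneg (A i j)]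
    _ = n := by simp

/-- Power means on a row give `‖A_i‖₂^p ≤ n^(p/2-1) ∑_j |A_ij|^p`. The prefactor is the `p`-th power
of the unit `n^(1/2-1/p)`, and exchanging the sums leaves `n` columns of total mass at most `1`
each. -/
theorem sum_rowRatio_rpow_le {m n : ℕ} {p : ℝ≥0∞} (hp : 2 ≤ p) (hp' : p ≠ ⊤) (hn : 1 ≤ n)
    {A : Fin m → Fin n → ℝ} (hA : ∀ j, (fun i => A i j) ∈ lpBall p m) :
    ∑ i, rowRatio p A i ^ p.toReal ≤ n := by
  have hn' : (0 : ℝ) < n := by exact_mod_cast hn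
  have h2 := two_le_toReal hp hp'
  set P := p.toReal with hP
  have hs : ((n : ℝ) ^ (1 / 2 - (p⁻¹).toReal)) ^ P = (n : ℝ) ^ (P / 2 - 1) := by
    rw [← Real.rpow_mul hn'.le, ENNReal.toReal_inv]
    congr 1
    rw [← hP]
    field_simp
  have hrow : ∀ i, rowRatio p A i ^ P ≤ ∑ j, |A i j| ^ P := by
    intro i
    unfold rowRatio
    rw [Real.div_rpow (Real.sqrt_nonneg _) (by positivity), hs, div_le_iff₀ (by positivity)]
    have h := Real.rpow_sum_le_const_mul_sum_rpow (Finset.univ : Finset (Fin n))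
      (fun j => A i j ^ 2) (p := P / 2) (by linarith)
    simp only [abs_pow, sq_abs, Finset.card_univ, Fintype.card_fin] at h
    rw [Real.sqrt_eq_rpow, ← Real.rpow_mul (Finset.sum_nonneg fun _ _ => sq_nonneg _)]
    rw [show 1 / 2 * P = P / 2 by ring]
    refine h.trans (le_of_eq ?_)
    rw [mul_comm]
    congr 1
    refine Finset.sum_congr rfl fun j _ => ?_
    rw [← sq_abs, ← Real.rpow_natCast, ← Real.rpow_mul (abs_nonneg _)]
    congr 1
    push_cast; ring
  calc ∑ i, rowRatio p A i ^ P ≤ ∑ i, ∑ j, |A i j| ^ P := Finset.sum_le_sum fun i _ => hrow i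
    _ = ∑ j, ∑ i, |A i j| ^ P := Finset.sum_comm
    _ ≤ ∑ _j : Fin n, (1 : ℝ) :=
        Finset.sum_le_sum fun j _ => sum_rpow_le_one_of_mem_lpBall hp hp' (hA j)
    _ = n := by simp

/-- Because `log u ≥ 1 - 1/u ≥ -1/u²`. -/
theorem exp_neg_div_sq_le_rpow {P u : ℝ} (hP : 0 ≤ P) (hu : 0 < u) (hu1 : u ≤ 1) :
    Real.exp (-(P / u ^ 2)) ≤ u ^ P := by
  rw [Real.rpow_def_of_pos hu]
  apply Real.exp_le_exp.2
  have h1 := Real.one_sub_inv_le_log_of_pos hu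
  have h2 : u⁻¹ ≤ (u ^ 2)⁻¹ := by
    rw [inv_le_inv₀ hu (by positivity)]; nlinarith
  rw [div_eq_mul_inv]
  nlinarith [mul_nonneg hP (sub_nonneg.2 h1), mul_nonneg hP (sub_nonneg.2 h2)]

/-- A long row (`u ≥ 1`) is charged to `u² ≤ u^p`. For a short row the exponential is at most `u^p`
if `M = p`, and at most `e^(-L) = n/(2m)` if `M = L`; the `m` terms `n/(2m)` add up to `n/2`. The
factor `u²` is there for the long rows, whose share `2/(e^l - 1)` in the pigeonhole count grows like
`u²`. -/
theorem sum_rowRatio_sq_mul_exp_le {m n : ℕ} {p : ℝ≥0∞} (hp : 2 ≤ p) (hn : 1 ≤ n) (hnm : n ≤ m)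
    {A : Fin m → Fin n → ℝ} (hA : ∀ j, (fun i => A i j) ∈ lpBall p m) :
    ∑ i, rowRatio p A i ^ 2 * Real.exp (-(minReal p (logRatio m n) / rowRatio p A i ^ 2))
      ≤ 3 / 2 * n := by
  have hn' : (0 : ℝ) < n := by exact_mod_cast hn
  have hm' : (0 : ℝ) < m := by exact_mod_cast hn.trans hnm
  have hL := two_thirds_le_logRatio hn hnm
  set L := logRatio m n with hLdef
  set u := rowRatio p A with hu
  have hu0 : ∀ i, 0 ≤ u i := rowRatio_nonneg p A
  have hM0 : 0 ≤ minReal p L := ENNReal.toReal_nonneg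
  have hexpL : Real.exp (-L) = n / (2 * m) := by
    rw [Real.exp_neg, hLdef, exp_logRatio hn hnm, inv_div]
  have hsmall : ∀ i, u i ≤ 1 → u i ^ 2 * Real.exp (-(L / u i ^ 2)) ≤ n / (2 * m) := by
    intro i hi
    rcases (hu0 i).eq_or_lt with h0 | h0
    · rw [← h0]; simp; positivity
    have h1 : Real.exp (-(L / u i ^ 2)) ≤ Real.exp (-L) := by
      apply Real.exp_le_exp.2
      apply neg_le_neg
      rw [le_div_iff₀ (by positivity)]
      exact mul_le_of_le_one_right (by linarith) (by nlinarith)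
    rw [← hexpL]
    have h2 : u i ^ 2 ≤ 1 := by nlinarith
    nlinarith [Real.exp_pos (-(L / u i ^ 2))]
  have hsum : ∑ _i : Fin m, (n : ℝ) / (2 * m) = n / 2 := by
    simp; field_simp
  rcases eq_or_ne p ⊤ with rfl | hp'
  · rw [minReal_top (by linarith)]
    calc _ ≤ ∑ _i : Fin m, (n : ℝ) / (2 * m) :=
          Finset.sum_le_sum fun i _ => hsmall i (rowRatio_le_one hn hA i)
      _ ≤ 3 / 2 * n := by rw [hsum]; linarith
  · have h2 := two_le_toReal hp hp'
    rw [minReal_of_ne_top hp' (by linarith)] at hM0 ⊢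
    have hterm : ∀ i, u i ^ 2 * Real.exp (-(min p.toReal L / u i ^ 2))
        ≤ u i ^ p.toReal + n / (2 * m) := by
      intro i
      have hq : (0 : ℝ) ≤ n / (2 * m) := by positivity
      have hr : 0 ≤ u i ^ p.toReal := Real.rpow_nonneg (hu0 i) _
      rcases le_total (u i) 1 with hi | hi
      · rcases le_total p.toReal L with hc | hc
        · rw [min_eq_left hc]
          rcases (hu0 i).eq_or_lt with h0 | h0
          · rw [← h0] at hr ⊢; simp; positivity
          have h3 := exp_neg_div_sq_le_rpow (P := p.toReal) (by linarith) h0 hi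
          have h4 : u i ^ 2 ≤ 1 := by nlinarith
          nlinarith [Real.exp_pos (-(p.toReal / u i ^ 2))]
        · rw [min_eq_right hc]
          linarith [hsmall i hi]
      · have h3 : Real.exp (-(min p.toReal L / u i ^ 2)) ≤ 1 := by
          apply Real.exp_le_one_iff.2
          have : 0 ≤ min p.toReal L / u i ^ 2 := by positivity
          linarith
        have h4 : u i ^ 2 ≤ u i ^ p.toReal := by
          rw [← Real.rpow_natCast]
          exact Real.rpow_le_rpow_of_exponent_le hi (by exact_mod_cast h2)
        nlinarith [sq_nonneg (u i)]
    calc _ ≤ ∑ i, (u i ^ p.toReal + n / (2 * m)) := Finset.sum_le_sum fun i _ => hterm i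
      _ ≤ 3 / 2 * n := by
        rw [Finset.sum_add_distrib, hsum]
        linarith [sum_rowRatio_rpow_le hp hp' hn hA]

/-! ### From bounds in `ℓ_∞` and `ℓ_p` to a bound in `ℓ_q` -/

/-- If `p ≥ L`, then `m/n ≤ e^q ≤ 3^q`, and `m` coordinates of size `D` are affordable. If `p < L`
and `q` is finite, `|y|^q ≤ D^(q-p) |y|^p` reduces the claim to the `p`-th moment. -/
theorem vecNorm_le_of_abs_le {m n : ℕ} {p q : ℝ≥0∞} (hp : 2 ≤ p) (hpq : p ≤ q) (hn : 1 ≤ n)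
    (hnm : n ≤ m) {y : Fin m → ℝ} {D : ℝ} (hD : 0 < D) (hy : ∀ i, |y i| ≤ D)
    (hyp : p ≠ ⊤ → p.toReal < logRatio m n → ∑ i, |y i| ^ p.toReal ≤ n * D ^ p.toReal) :
    vecNorm q y ≤ 3 * D * (n : ℝ) ^ (q⁻¹).toReal := by
  have hn' : (0 : ℝ) < n := by exact_mod_cast hn
  have hm' : (0 : ℝ) < m := by exact_mod_cast hn.trans hnm
  rcases eq_or_ne q ⊤ with rfl | hq'
  · simp only [ENNReal.inv_top, ENNReal.toReal_zero, Real.rpow_zero, mul_one]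
    exact (vecNorm_top_le hD.le hy).trans (by linarith)
  have hp' : p ≠ ⊤ := ne_top_of_le_ne_top hq' hpq
  have h2 := two_le_toReal hp hp'
  have hPQ : p.toReal ≤ q.toReal := ENNReal.toReal_mono hq' hpq
  rw [vecNorm_of_ne_top (hp.trans hpq) hq', ENNReal.toReal_inv]
  set P := p.toReal
  set Q := q.toReal
  have hQ : 0 < Q := by linarith
  have hS0 : 0 ≤ ∑ i, |y i| ^ Q := Finset.sum_nonneg fun i _ => Real.rpow_nonneg (abs_nonneg _) _
  suffices h : ∑ i, |y i| ^ Q ≤ n * (3 * D) ^ Q by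
    calc (∑ i, |y i| ^ Q) ^ (1 / Q) ≤ (n * (3 * D) ^ Q) ^ (1 / Q) :=
          Real.rpow_le_rpow hS0 h (by positivity)
      _ = 3 * D * (n : ℝ) ^ Q⁻¹ := by
        rw [Real.mul_rpow hn'.le (by positivity), ← Real.rpow_mul (by positivity),
          mul_one_div_cancel hQ.ne', Real.rpow_one, one_div, mul_comm]
  rcases lt_or_ge P (logRatio m n) with hc | hc
  · calc ∑ i, |y i| ^ Q ≤ ∑ i, D ^ (Q - P) * |y i| ^ P := by
          refine Finset.sum_le_sum fun i _ => ?_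
          rcases (abs_nonneg (y i)).eq_or_lt with h0 | h0
          · rw [← h0, Real.zero_rpow hQ.ne', Real.zero_rpow (by linarith)]; simp
          · rw [show Q = (Q - P) + P by ring, Real.rpow_add h0]
            rw [show Q - P + P - P = Q - P by ring]
            have := Real.rpow_le_rpow h0.le (hy i) (sub_nonneg.2 hPQ)
            gcongr
      _ = D ^ (Q - P) * ∑ i, |y i| ^ P := by rw [Finset.mul_sum]
      _ ≤ D ^ (Q - P) * (n * D ^ P) := by gcongr; exact hyp hp' hc
      _ = n * D ^ Q := by
          rw [show Q = (Q - P) + P by ring, Real.rpow_add hD]; ring_nf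
      _ ≤ n * (3 * D) ^ Q := by gcongr; linarith
  · have h3 : (m : ℝ) / n ≤ 3 ^ Q := by
      have e1 := exp_logRatio hn hnm
      have e2 : Real.exp (logRatio m n) ≤ Real.exp Q := Real.exp_le_exp.2 (by linarith)
      have e3 : Real.exp Q ≤ 3 ^ Q := by
        rw [← Real.exp_one_rpow]
        exact Real.rpow_le_rpow (Real.exp_pos 1).le (by linarith [Real.exp_one_lt_d9]) hQ.le
      have e4 : (m : ℝ) / n ≤ 2 * m / n := by gcongr; linarith
      linarith
    calc ∑ i, |y i| ^ Q ≤ ∑ _i : Fin m, D ^ Q :=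
          Finset.sum_le_sum fun i _ => Real.rpow_le_rpow (abs_nonneg _) (hy i) hQ.le
      _ = n * ((m / n) * D ^ Q) := by simp; field_simp
      _ ≤ n * (3 ^ Q * D ^ Q) := by gcongr
      _ = n * (3 * D) ^ Q := by rw [Real.mul_rpow (by norm_num) hD.le]

/-! ### The potential of the recoloring process -/

theorem balExponent_pos {p q : ℝ≥0∞} (hp : 2 ≤ p) (hpq : p ≤ q) (h : ¬ (p = 2 ∧ q = ⊤)) :
    0 < balExponent p q := by
  unfold balExponent
  have hq0 : 0 ≤ (q⁻¹).toReal := ENNReal.toReal_nonneg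
  rcases eq_or_ne p ⊤ with rfl | hp'
  · rw [ENNReal.inv_top, ENNReal.toReal_zero]; linarith
  have h2 := two_le_toReal hp hp'
  rw [ENNReal.toReal_inv p]
  rcases h2.eq_or_lt with h3 | h3
  · have hp2 : p = 2 := by
      rw [← ENNReal.ofReal_toReal hp', ← h3]; simp
    have hq' : q ≠ ⊤ := fun hq => h ⟨hp2, hq⟩
    have hq2 := two_le_toReal (hp.trans hpq) hq'
    rw [← h3, ENNReal.toReal_inv]
    have : 0 < q.toReal⁻¹ := by positivity
    linarith
  · have : p.toReal⁻¹ < 2⁻¹ := by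
      rw [inv_lt_inv₀ (by linarith) (by norm_num)]; exact h3
    linarith

theorem balExponent_le {p q : ℝ≥0∞} (hp : 2 ≤ p) (hpq : p ≤ q) : balExponent p q ≤ 1 / 2 := by
  unfold balExponent
  have : (q⁻¹).toReal ≤ (p⁻¹).toReal :=
    ENNReal.toReal_mono (by simp; rintro rfl; simp at hp) (ENNReal.inv_le_inv.2 hpq)
  linarith

/-- The alternative to `p ≤ 3`: either the truncated logarithm is constant or the exponent is
bounded below. -/
theorem one_sixth_le_balExponent {p q : ℝ≥0∞} (hp3 : ¬ (p ≠ ⊤ ∧ p.toReal ≤ 3)) :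
    1 / 6 ≤ balExponent p q := by
  unfold balExponent
  have hq0 : 0 ≤ (q⁻¹).toReal := ENNReal.toReal_nonneg
  rcases eq_or_ne p ⊤ with rfl | hp'
  · rw [ENNReal.inv_top, ENNReal.toReal_zero]; linarith
  · have h3 : 3 < p.toReal := by by_contra hc; exact hp3 ⟨hp', not_lt.1 hc⟩
    rw [ENNReal.toReal_inv]
    have : p.toReal⁻¹ ≤ 3⁻¹ := by
      rw [inv_le_inv₀ (by linarith) (by norm_num)]; exact h3.le
    linarith

/-- The bound for a single partial coloring. -/
noncomputable def stepBound (m n : ℕ) (p q : ℝ≥0∞) : ℝ :=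
  Real.sqrt (minReal p (logRatio m n)) * (n : ℝ) ^ balExponent p q

theorem balBound_eq (m n : ℕ) (p q : ℝ≥0∞) :
    balBound m n p q = stepBound m n p q / balExponent p q := by
  unfold balBound stepBound minReal logRatio
  ring

/-- A substitute for `stepBound` that decays geometrically in `n`. -/
noncomputable def smoothBound (m n : ℕ) (p q : ℝ≥0∞) : ℝ :=
  Real.sqrt (minReal p (6 + logRatio m n)) * (n : ℝ) ^ balExponent p q

theorem stepBound_le_smoothBound (m n : ℕ) (p q : ℝ≥0∞) :
    stepBound m n p q ≤ smoothBound m n p q := by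
  unfold stepBound smoothBound
  gcongr
  exact minReal_mono (by linarith)

/-- As `L ≥ 2/3`, `6 + L ≤ 16 L`, and the square root turns `16` into `4`. -/
theorem smoothBound_le {m n : ℕ} {p : ℝ≥0∞} (q : ℝ≥0∞) (hn : 1 ≤ n) (hnm : n ≤ m) :
    smoothBound m n p q ≤ 4 * stepBound m n p q := by
  have hL := two_thirds_le_logRatio hn hnm
  unfold stepBound smoothBound
  rw [← mul_assoc]
  gcongr
  have h1 : minReal p (6 + logRatio m n) ≤ 16 * minReal p (logRatio m n) :=
    (minReal_mono (by linarith)).trans (minReal_mul_le (by linarith) (by norm_num))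
  calc Real.sqrt (minReal p (6 + logRatio m n)) ≤ Real.sqrt (4 ^ 2 * minReal p (logRatio m n)) :=
        Real.sqrt_le_sqrt (by linarith)
    _ = 4 * Real.sqrt (minReal p (logRatio m n)) := by
        rw [Real.sqrt_mul (by norm_num), Real.sqrt_sq (by norm_num)]

/-- With `t = log (n/n')`, going down to `n'` adds `t` to the logarithm and divides the power by
`e^(ta)`. Since `6a ≥ 1`, `(6 + L) e^(ta) ≥ (6 + L)(1 + ta) ≥ 6 + L + t`; this fixes the shift `6`.
-/
theorem log_mul_rpow_mono {m n n' : ℕ} {a : ℝ} (ha : 1 / 6 ≤ a) (hn' : 1 ≤ n') (h : n' ≤ n)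
    (hnm : n ≤ m) :
    (6 + logRatio m n') * (n' : ℝ) ^ a ≤ (6 + logRatio m n) * (n : ℝ) ^ a := by
  have hL := two_thirds_le_logRatio (hn'.trans h) hnm
  have k1 : (0 : ℝ) < n' := by exact_mod_cast hn'
  have k2 : (0 : ℝ) < n := by exact_mod_cast hn'.trans h
  have k3 : (0 : ℝ) < m := by exact_mod_cast (hn'.trans h).trans hnm
  set t : ℝ := Real.log (n / n') with ht
  have ht0 : 0 ≤ t := Real.log_nonneg (by rw [le_div_iff₀ k1]; simpa using h)
  have e1 : logRatio m n' = logRatio m n + t := by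
    unfold logRatio
    rw [ht, ← Real.log_mul (by positivity) (by positivity)]
    congr 1; field_simp
  have e2 : (n : ℝ) ^ a = Real.exp (t * a) * (n' : ℝ) ^ a := by
    rw [← Real.rpow_def_of_pos (by positivity), ← Real.mul_rpow (by positivity) k1.le]
    congr 1; field_simp
  rw [e1, e2, ← mul_assoc]
  gcongr
  have := Real.add_one_le_exp (t * a)
  nlinarith [mul_nonneg ht0 (sub_nonneg.2 ha)]

/-- The bound factors as `√(min{p, 6 + L} · n^α) · n^(α/2)`. The first factor is monotone in `n`,
and the second decays by `(1 - c)^(α/2) ≤ 1 - cα/2`, which is Bernoulli's inequality. -/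
theorem smoothBound_le_of_le {m n n' : ℕ} {p q : ℝ≥0∞} {c : ℝ} (hp : 2 ≤ p) (hpq : p ≤ q)
    (h : ¬ (p = 2 ∧ q = ⊤)) (hn : 1 ≤ n) (hnm : n ≤ m) (hc0 : 0 ≤ c) (hc1 : c ≤ 1)
    (hn' : (n' : ℝ) ≤ (1 - c) * n) :
    smoothBound m n' p q ≤ (1 - c * balExponent p q / 2) * smoothBound m n p q := by
  have ha := balExponent_pos hp hpq h
  have ha' := balExponent_le hp hpq
  have ha6 := one_sixth_le_balExponent (p := p) (q := q)
  set a := balExponent p q with hadef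
  have hfac : 0 ≤ 1 - c * a / 2 := by nlinarith
  have k2 : (0 : ℝ) < n := by exact_mod_cast hn
  rcases Nat.eq_zero_or_pos n' with rfl | hn1
  -- At `n' = 0` the quotient `2m/0` is a default value; the factor `0^α = 0` removes it.
  · have : smoothBound m 0 p q = 0 := by
      unfold smoothBound; rw [← hadef]; simp [Real.zero_rpow ha.ne']
    rw [this]
    refine mul_nonneg hfac ?_
    unfold smoothBound; positivity
  have k1 : (0 : ℝ) < n' := by exact_mod_cast hn1
  have hle : n' ≤ n := by
    have : (n' : ℝ) ≤ n := by nlinarith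
    exact_mod_cast this
  have hL := two_thirds_le_logRatio hn hnm
  have hL' := two_thirds_le_logRatio hn1 (hle.trans hnm)
  have hpow : (n' : ℝ) ^ a ≤ (n : ℝ) ^ a := by gcongr
  have hmono : minReal p (6 + logRatio m n') * (n' : ℝ) ^ a
      ≤ minReal p (6 + logRatio m n) * (n : ℝ) ^ a := by
    -- For `p ≤ 3` both minima equal `p`, since the shifted logarithms exceed `6`.
    by_cases h3 : p ≠ ⊤ ∧ p.toReal ≤ 3
    · rw [minReal_of_ne_top h3.1 (by linarith), minReal_of_ne_top h3.1 (by linarith),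
        min_eq_left (by linarith [h3.2]), min_eq_left (by linarith [h3.2])]
      gcongr
    · have h4 := log_mul_rpow_mono (ha6 h3) hn1 hle hnm
      rcases eq_or_ne p ⊤ with h5 | h5
      · rw [h5, minReal_top (by linarith), minReal_top (by linarith)]
        exact h4
      · rw [minReal_of_ne_top h5 (by linarith), minReal_of_ne_top h5 (by linarith),
          min_mul_of_nonneg _ _ (by positivity), min_mul_of_nonneg _ _ (by positivity)]
        exact min_le_min (by gcongr) h4
  have hratio : (n' : ℝ) ^ (a / 2) ≤ (1 - c * a / 2) * (n : ℝ) ^ (a / 2) := by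
    have e1 : (n' : ℝ) ^ (a / 2) ≤ ((1 - c) * n) ^ (a / 2) :=
      Real.rpow_le_rpow k1.le hn' (by linarith)
    rw [Real.mul_rpow (by linarith) k2.le] at e1
    refine e1.trans ?_
    gcongr
    have := rpow_one_add_le_one_add_mul_self (s := -c) (p := a / 2) (by linarith)
      (by linarith) (by linarith)
    rw [← sub_eq_add_neg] at this
    linarith
  have hsplit : ∀ k : ℕ, smoothBound m k p q
      = Real.sqrt (minReal p (6 + logRatio m k) * (k : ℝ) ^ a) * (k : ℝ) ^ (a / 2) := by
    intro k
    unfold smoothBound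
    rw [Real.sqrt_mul (show 0 ≤ minReal p (6 + logRatio m k) from ENNReal.toReal_nonneg), Real.sqrt_eq_rpow ((k : ℝ) ^ a),
      ← Real.rpow_mul (Nat.cast_nonneg k), mul_assoc, ← hadef]
    congr 1
    rcases Nat.eq_zero_or_pos k with rfl | hk
    · simp [Real.zero_rpow ha.ne', ha.ne']
    · rw [← Real.rpow_add (by exact_mod_cast hk)]; congr 1; ring
  rw [hsplit, hsplit]
  calc _ ≤ Real.sqrt (minReal p (6 + logRatio m n) * (n : ℝ) ^ a)
          * ((1 - c * a / 2) * (n : ℝ) ^ (a / 2)) := by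
        gcongr
    _ = _ := by ring

/-- The total error of all the partial colorings that remain when `n` vectors are uncolored. -/
noncomputable def totalBound (c : ℝ) (m n : ℕ) (p q : ℝ≥0∞) : ℝ :=
  2 / (c * balExponent p q) * smoothBound m n p q

/-- The geometric series as a potential: the guaranteed drop is `2/(cα) · cα/2 = 1` times
`smoothBound`, which dominates the cost of the step. -/
theorem stepBound_add_totalBound_le {m n n' : ℕ} {p q : ℝ≥0∞} {c : ℝ} (hp : 2 ≤ p) (hpq : p ≤ q)
    (h : ¬ (p = 2 ∧ q = ⊤)) (hn : 1 ≤ n) (hnm : n ≤ m) (hc0 : 0 < c) (hc1 : c ≤ 1)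
    (hn' : (n' : ℝ) ≤ (1 - c) * n) :
    stepBound m n p q + totalBound c m n' p q ≤ totalBound c m n p q := by
  have ha := balExponent_pos hp hpq h
  have h1 := smoothBound_le_of_le hp hpq h hn hnm hc0.le hc1 hn'
  have h2 := stepBound_le_smoothBound m n p q
  unfold totalBound
  have h3 : 2 / (c * balExponent p q) * smoothBound m n' p q ≤
      2 / (c * balExponent p q) * ((1 - c * balExponent p q / 2) * smoothBound m n p q) := by
    gcongr
  have h4 : 2 / (c * balExponent p q) * ((1 - c * balExponent p q / 2) * smoothBound m n p q)
      = 2 / (c * balExponent p q) * smoothBound m n p q - smoothBound m n p q := by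
    field_simp
  linarith

theorem totalBound_le {m n : ℕ} {p q : ℝ≥0∞} {c : ℝ} (hp : 2 ≤ p) (hpq : p ≤ q)
    (h : ¬ (p = 2 ∧ q = ⊤)) (hn : 1 ≤ n) (hnm : n ≤ m) (hc0 : 0 < c) :
    totalBound c m n p q ≤ 8 / c * balBound m n p q := by
  have ha := balExponent_pos hp hpq h
  rw [balBound_eq, totalBound]
  calc _ ≤ 2 / (c * balExponent p q) * (4 * stepBound m n p q) := by
        gcongr; exact smoothBound_le q hn hnm
    _ = _ := by field_simp; ring

theorem totalBound_zero {m : ℕ} {p q : ℝ≥0∞} {c : ℝ} (hp : 2 ≤ p) (hpq : p ≤ q)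
    (h : ¬ (p = 2 ∧ q = ⊤)) : totalBound c m 0 p q = 0 := by
  have ha := balExponent_pos hp hpq h
  simp [totalBound, smoothBound, Real.zero_rpow ha.ne']

theorem one_div_le_stepBound {m n : ℕ} {p q : ℝ≥0∞} (hp : 2 ≤ p) (hpq : p ≤ q)
    (h : ¬ (p = 2 ∧ q = ⊤)) (hn : 1 ≤ n) (hnm : n ≤ m) : 1 / 2 ≤ stepBound m n p q := by
  have ha := balExponent_pos hp hpq h
  have h1 := half_le_minReal hp (two_thirds_le_logRatio hn hnm)
  unfold stepBound
  have h2 : (1 : ℝ) ≤ (n : ℝ) ^ balExponent p q :=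
    Real.one_le_rpow (by exact_mod_cast hn) ha.le
  have h3 : 1 / 2 ≤ Real.sqrt (minReal p (logRatio m n)) := by
    apply Real.le_sqrt_of_sq_le
    linarith
  nlinarith

/-! ### Random signs -/

theorem sum_signs_exp {n : ℕ} (a : Fin n → ℝ) :
    ∑ x : Fin n → ℤˣ, Real.exp (∑ j, a j * ((x j : ℤ) : ℝ)) = 2 ^ n * ∏ j, Real.cosh (a j) := by
  have h := Finset.prod_univ_sum (fun _ : Fin n => (Finset.univ : Finset ℤˣ))
    (fun j e => Real.exp (a j * ((e : ℤ) : ℝ)))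
  rw [Fintype.piFinset_univ] at h
  simp only [← Real.exp_sum] at h
  have h2 : (2 : ℝ) ^ n = ∏ _j : Fin n, (2 : ℝ) := by simp
  rw [← h, h2, ← Finset.prod_mul_distrib]
  refine Finset.prod_congr rfl fun j _ => ?_
  rw [show (Finset.univ : Finset ℤˣ) = {1, -1} from rfl, Finset.sum_pair (by decide), Real.cosh_eq]
  simp
  ring

/-- Hoeffding's bound, from `cosh x ≤ e^(x²/2)` for each sign; the hyperbolic cosine controls both
tails at once. -/
theorem sum_signs_cosh_le {n : ℕ} (a : Fin n → ℝ) (t : ℝ) :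
    ∑ x : Fin n → ℤˣ, Real.cosh (t * ∑ j, a j * ((x j : ℤ) : ℝ))
      ≤ 2 ^ n * Real.exp (t ^ 2 * (∑ j, a j ^ 2) / 2) := by
  have key : ∀ t : ℝ, ∑ x : Fin n → ℤˣ, Real.exp (t * ∑ j, a j * ((x j : ℤ) : ℝ))
      ≤ 2 ^ n * Real.exp (t ^ 2 * (∑ j, a j ^ 2) / 2) := by
    intro t
    have h := sum_signs_exp (fun j => t * a j)
    simp only [mul_assoc, ← Finset.mul_sum] at h
    rw [h]
    gcongr
    calc ∏ j, Real.cosh (t * a j) ≤ ∏ j, Real.exp ((t * a j) ^ 2 / 2) :=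
          Finset.prod_le_prod (fun j _ => (Real.cosh_pos _).le)
            fun j _ => Real.cosh_le_exp_half_sq _
      _ = _ := by
        rw [← Real.exp_sum]
        congr 1
        rw [Finset.mul_sum, Finset.sum_div]
        exact Finset.sum_congr rfl fun j _ => by ring
  have h1 := key t
  have h2 := key (-t)
  simp only [Real.cosh_eq, ← Finset.sum_div, Finset.sum_add_distrib]
  simp only [neg_mul, neg_sq] at h2
  linarith

theorem exp_abs_le_two_mul_cosh (x : ℝ) : Real.exp |x| ≤ 2 * Real.cosh x := by
  rw [← Real.cosh_abs, Real.cosh_eq]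
  linarith [Real.exp_pos (-|x|)]

theorem rpow_le_rpow_mul_exp {P t : ℝ} (hP : 0 < P) (ht : 0 ≤ t) :
    t ^ P ≤ P ^ P * Real.exp t := by
  have h1 : t / P ≤ Real.exp (t / P) := by linarith [Real.add_one_le_exp (t / P)]
  have h2 := Real.rpow_le_rpow (by positivity) h1 hP.le
  rw [Real.div_rpow ht hP.le, ← Real.exp_mul, div_mul_cancel₀ _ hP.ne',
    div_le_iff₀ (by positivity)] at h2
  linarith

/-- Khintchine's inequality with the constant of order `√P`: `rpow_le_rpow_mul_exp` at `t = √P |y| /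
s` bounds the power by an exponential. -/
theorem sum_signs_abs_rpow_le {n : ℕ} (a : Fin n → ℝ) {P : ℝ} (hP : 1 ≤ P) :
    ∑ x : Fin n → ℤˣ, |∑ j, a j * ((x j : ℤ) : ℝ)| ^ P
      ≤ 2 ^ n * (2 * (2 * Real.sqrt P * Real.sqrt (∑ j, a j ^ 2)) ^ P) := by
  have hS : 0 ≤ ∑ j, a j ^ 2 := Finset.sum_nonneg fun _ _ => sq_nonneg _
  have hP0 : 0 < P := by linarith
  set s := Real.sqrt (∑ j, a j ^ 2) with hs
  rcases (Real.sqrt_nonneg (∑ j, a j ^ 2)).eq_or_lt with h0 | h0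
  · have h1 : ∑ j, a j ^ 2 = 0 := (Real.sqrt_eq_zero hS).1 h0.symm
    have h2 : ∀ j, a j = 0 := fun j => by
      have := (Finset.sum_eq_zero_iff_of_nonneg (fun _ _ => sq_nonneg _)).1 h1 j (Finset.mem_univ j)
      exact pow_eq_zero_iff (two_ne_zero) |>.1 this
    simp only [h2, zero_mul, Finset.sum_const_zero, abs_zero, Real.zero_rpow hP0.ne']
    positivity
  · rw [← hs] at h0
    have hq : 0 < Real.sqrt P := Real.sqrt_pos.2 hP0
    have hsq : Real.sqrt P ^ 2 = P := Real.sq_sqrt hP0.le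
    have hs2 : s ^ 2 = ∑ j, a j ^ 2 := Real.sq_sqrt hS
    have hpt : ∀ y : ℝ, |y| ^ P ≤ (Real.sqrt P * s) ^ P * (2 * Real.cosh (Real.sqrt P / s * y)) := by
      intro y
      have h1 := rpow_le_rpow_mul_exp hP0 (abs_nonneg (Real.sqrt P / s * y))
      have h2 := exp_abs_le_two_mul_cosh (Real.sqrt P / s * y)
      have h3 : |y| = s / Real.sqrt P * |Real.sqrt P / s * y| := by
        rw [abs_mul, abs_of_pos (by positivity : 0 < Real.sqrt P / s)]
        field_simp
      rw [h3, Real.mul_rpow (by positivity) (abs_nonneg _)]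
      calc _ ≤ (s / Real.sqrt P) ^ P * (P ^ P * (2 * Real.cosh (Real.sqrt P / s * y))) := by
            gcongr
            exact h1.trans (by gcongr)
        _ = _ := by
            rw [← mul_assoc, ← Real.mul_rpow (by positivity) hP0.le]
            congr 2
            rw [div_mul_eq_mul_div, div_eq_iff hq.ne']
            nlinarith
    calc _ ≤ ∑ x : Fin n → ℤˣ, (Real.sqrt P * s) ^ P *
            (2 * Real.cosh (Real.sqrt P / s * ∑ j, a j * ((x j : ℤ) : ℝ))) :=
          Finset.sum_le_sum fun x _ => hpt _
      _ = (Real.sqrt P * s) ^ P * 2 *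
            ∑ x : Fin n → ℤˣ, Real.cosh (Real.sqrt P / s * ∑ j, a j * ((x j : ℤ) : ℝ)) := by
          rw [Finset.mul_sum]
          exact Finset.sum_congr rfl fun _ _ => by ring
      -- At this scale Hoeffding's exponent is `P/2`, and `√e ≤ 2`.
      _ ≤ (Real.sqrt P * s) ^ P * 2 * (2 ^ n * 2 ^ P) := by
          gcongr
          refine (sum_signs_cosh_le a _).trans ?_
          gcongr
          rw [← hs2, div_pow, hsq, div_mul_cancel₀ _ (by positivity),
            show P / 2 = 1 / 2 * P by ring, Real.exp_mul]
          refine Real.rpow_le_rpow (Real.exp_pos _).le ?_ hP0.le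
          have h5 : Real.exp (1 / 2) ^ 2 = Real.exp 1 := by
            rw [← Real.exp_nat_mul]; norm_num
          have := Real.exp_one_lt_d9
          nlinarith [Real.exp_pos (1 / 2)]
      _ = _ := by
          rw [show 2 * Real.sqrt P * s = 2 * (Real.sqrt P * s) by ring,
            Real.mul_rpow (x := 2) (by norm_num) (by positivity)]
          generalize (Real.sqrt P * s) ^ P = z
          ring

/-- The rounded value vanishes unless `v = |y/D|` is at least `1/2`, and then it is at most `2v`.
With `w = D²/S`, the inequality `v ≥ 1/2` buys a factor `e^(-w/16)`, of which averaging the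
hyperbolic cosine consumes `e^(w/32)`. -/
theorem sum_signs_abs_round_le {n : ℕ} (a : Fin n → ℝ) {D : ℝ} (hD : 0 < D)
    (ha : 0 < ∑ j, a j ^ 2) :
    ∑ x : Fin n → ℤˣ, |(round ((∑ j, a j * ((x j : ℤ) : ℝ)) / D) : ℝ)|
      ≤ 2 ^ n * (32 * (∑ j, a j ^ 2) / D ^ 2 * Real.exp (-(D ^ 2 / (32 * ∑ j, a j ^ 2)))) := by
  set S := ∑ j, a j ^ 2 with hS
  set w := D ^ 2 / S with hw
  have hw0 : 0 < w := by positivity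
  have hpt : ∀ y : ℝ, |(round (y / D) : ℝ)|
      ≤ 32 / w * Real.exp (-(w / 16)) * Real.cosh (D / (4 * S) * y) := by
    intro y
    by_cases h0 : round (y / D) = 0
    · rw [h0]; simp only [Int.cast_zero, abs_zero]
      have := Real.cosh_pos (D / (4 * S) * y)
      positivity
    have h1 : (1 : ℝ) ≤ |(round (y / D) : ℝ)| := by
      exact_mod_cast Int.one_le_abs h0
    have h2 := abs_sub_round (y / D)
    have h3 : |(round (y / D) : ℝ)| ≤ |y / D| + 1 / 2 := by
      have := abs_sub_abs_le_abs_sub (round (y / D) : ℝ) (y / D)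
      rw [abs_sub_comm] at this
      linarith
    set v := |y / D| with hv
    have hv1 : 1 / 2 ≤ v := by linarith
    have h4 : |(round (y / D) : ℝ)| ≤ 2 * v := by linarith
    have h5 : |D / (4 * S) * y| = w * v / 4 := by
      rw [hv, abs_mul, abs_of_pos (by positivity), abs_div, abs_of_pos hD, hw]
      field_simp
    have h6 := exp_abs_le_two_mul_cosh (D / (4 * S) * y)
    rw [h5] at h6
    have h7 : w * v / 8 ≤ Real.exp (w * v / 8) := by
      linarith [Real.add_one_le_exp (w * v / 8)]
    have h8 : Real.exp (w * v / 8) ≤ Real.exp (-(w / 16)) * Real.exp (w * v / 4) := by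
      rw [← Real.exp_add]
      apply Real.exp_le_exp.2
      nlinarith
    have h9 : w * v ≤ 16 * Real.exp (-(w / 16)) * Real.cosh (D / (4 * S) * y) := by
      nlinarith [Real.exp_pos (-(w / 16))]
    have h10 : 2 * v ≤ 2 * (16 * Real.exp (-(w / 16)) * Real.cosh (D / (4 * S) * y)) / w := by
      rw [le_div_iff₀ hw0]; linarith
    refine h4.trans (h10.trans (le_of_eq (by ring)))
  calc _ ≤ ∑ x : Fin n → ℤˣ, 32 / w * Real.exp (-(w / 16)) *
            Real.cosh (D / (4 * S) * ∑ j, a j * ((x j : ℤ) : ℝ)) :=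
          Finset.sum_le_sum fun x _ => hpt _
    _ ≤ 32 / w * Real.exp (-(w / 16)) * (2 ^ n * Real.exp ((D / (4 * S)) ^ 2 * S / 2)) := by
          rw [← Finset.mul_sum]
          gcongr
          exact sum_signs_cosh_le a _
    _ = _ := by
          have e1 : (D / (4 * S)) ^ 2 * S / 2 = w / 32 := by rw [hw]; field_simp; norm_num
          have e2 : D ^ 2 / (32 * S) = w / 32 := by rw [hw]; field_simp
          have e3 : 32 * S / D ^ 2 = 32 / w := by rw [hw]; field_simp
          rw [e1, e2, e3, show -(w / 32) = -(w / 16) + w / 32 by ring, Real.exp_add]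
          ring

/-! ### Pigeonhole with weights -/

theorem sum_Icc_exp_neg_abs_le {l : ℝ} (hl : 0 < l) (R : ℕ) :
    ∑ k ∈ Finset.Icc (-(R : ℤ)) R, Real.exp (-(l * |(k : ℝ)|)) ≤ 1 + 2 / (Real.exp l - 1) := by
  have he : 0 < Real.exp l - 1 := by linarith [Real.add_one_le_exp l]
  have hlt : Real.exp (-l) < 1 := by rw [Real.exp_lt_one_iff]; linarith
  have h1 : ∀ R : ℕ, ∑ k ∈ Finset.Icc (-(R : ℤ)) R, Real.exp (-(l * |(k : ℝ)|))
      = 1 + 2 * ∑ k ∈ Finset.range R, Real.exp (-l) ^ (k + 1) := by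
    intro R
    induction R with
    | zero => simp
    | succ R ih =>
      have hI : Finset.Icc (-((R + 1 : ℕ) : ℤ)) ((R + 1 : ℕ) : ℤ) =
          insert (-((R : ℤ) + 1)) (insert ((R : ℤ) + 1) (Finset.Icc (-(R : ℤ)) R)) := by
        ext k; simp; omega
      rw [hI, Finset.sum_insert (by simp; omega), Finset.sum_insert (by simp), ih,
        Finset.sum_range_succ, ← Real.exp_nat_mul]
      push_cast
      rw [abs_neg, abs_of_nonneg (by positivity : (0 : ℝ) ≤ (R : ℝ) + 1),
        show ((R : ℝ) + 1) * -l = -(l * (R + 1)) by ring]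
      ring
  have h2 : ∑ k ∈ Finset.range R, Real.exp (-l) ^ (k + 1) ≤ 1 / (Real.exp l - 1) := by
    have h3 : ∑ k ∈ Finset.range R, Real.exp (-l) ^ k ≤ 1 / (1 - Real.exp (-l)) := by
      rw [geom_sum_eq hlt.ne, ← neg_div_neg_eq]
      have : 0 < 1 - Real.exp (-l) := by linarith
      rw [neg_sub, neg_sub]
      gcongr
      have := pow_nonneg (Real.exp_pos (-l)).le R
      linarith
    calc ∑ k ∈ Finset.range R, Real.exp (-l) ^ (k + 1)
        = Real.exp (-l) * ∑ k ∈ Finset.range R, Real.exp (-l) ^ k := by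
          rw [Finset.mul_sum]; exact Finset.sum_congr rfl fun k _ => by ring
      _ ≤ Real.exp (-l) * (1 / (1 - Real.exp (-l))) := by gcongr
      _ = 1 / (Real.exp l - 1) := by
          rw [Real.exp_neg]
          have := (Real.exp_pos l).ne'
          field_simp
  rw [h1]
  have h4 : 2 / (Real.exp l - 1) = 2 * (1 / (Real.exp l - 1)) := by ring
  rw [h4]
  linarith

/-- Give an integer vector `β` the weight `exp(-∑ l_i |β_i|)`. Every value of `b` on `G` has weight
at least `e^(-B)`, while the total weight of a box is a product of geometric series, at most `∏ (1 +
2/(e^(l_i) - 1))`. This bounds the number of values, and the most frequent one is taken. -/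
theorem exists_large_fiber {Ω ι : Type*} [Fintype ι] (G : Finset Ω)
    (b : Ω → ι → ℤ) {l : ι → ℝ} (hl : ∀ i, 0 < l i) {B : ℝ}
    (hB : ∀ x ∈ G, ∑ i, l i * |(b x i : ℝ)| ≤ B) :
    ∃ S ⊆ G, (∀ x ∈ S, ∀ y ∈ S, b x = b y) ∧
      (G.card : ℝ) ≤ S.card * Real.exp (B + ∑ i, 2 / (Real.exp (l i) - 1)) := by
  classical
  rcases G.eq_empty_or_nonempty with rfl | hG
  · exact ⟨∅, by simp⟩
  set T := G.image b with hT
  set R : ℕ := ∑ x ∈ G, ∑ i, (b x i).natAbs with hR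
  have hcount : (T.card : ℝ) ≤ Real.exp (B + ∑ i, 2 / (Real.exp (l i) - 1)) := by
    have hsub : T ⊆ Fintype.piFinset fun _ : ι => Finset.Icc (-(R : ℤ)) R := by
      intro β hβ
      obtain ⟨x, hx, rfl⟩ := Finset.mem_image.1 hβ
      rw [Fintype.mem_piFinset]
      intro i
      have h1 : (b x i).natAbs ≤ R :=
        (Finset.single_le_sum (f := fun i => (b x i).natAbs) (fun _ _ => Nat.zero_le _)
          (Finset.mem_univ i)).trans
        (Finset.single_le_sum (f := fun x => ∑ i, (b x i).natAbs) (fun _ _ => Nat.zero_le _) hx)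
      rw [Finset.mem_Icc]
      omega
    have h1 : (T.card : ℝ) * Real.exp (-B) ≤ Real.exp (∑ i, 2 / (Real.exp (l i) - 1)) := by
      calc (T.card : ℝ) * Real.exp (-B) = ∑ _β ∈ T, Real.exp (-B) := by simp
        _ ≤ ∑ β ∈ T, ∏ i, Real.exp (-(l i * |(β i : ℝ)|)) := by
            refine Finset.sum_le_sum fun β hβ => ?_
            obtain ⟨x, hx, rfl⟩ := Finset.mem_image.1 hβ
            rw [← Real.exp_sum, Finset.sum_neg_distrib]
            exact Real.exp_le_exp.2 (neg_le_neg (hB x hx))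
        _ ≤ ∑ β ∈ Fintype.piFinset fun _ : ι => Finset.Icc (-(R : ℤ)) R,
              ∏ i, Real.exp (-(l i * |(β i : ℝ)|)) :=
            Finset.sum_le_sum_of_subset_of_nonneg hsub fun _ _ _ => by positivity
        _ = ∏ i, ∑ k ∈ Finset.Icc (-(R : ℤ)) R, Real.exp (-(l i * |(k : ℝ)|)) := by
            rw [Finset.prod_univ_sum]
        _ ≤ ∏ i, Real.exp (2 / (Real.exp (l i) - 1)) := by
            refine Finset.prod_le_prod (fun i _ => by positivity) fun i _ => ?_
            refine (sum_Icc_exp_neg_abs_le (hl i) R).trans ?_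
            linarith [Real.add_one_le_exp (2 / (Real.exp (l i) - 1))]
        _ = _ := by rw [← Real.exp_sum]
    rw [Real.exp_add]
    calc (T.card : ℝ) = (T.card : ℝ) * Real.exp (-B) * Real.exp B := by
          rw [mul_assoc, ← Real.exp_add]; simp
      _ ≤ _ := by rw [mul_comm (Real.exp B)]; gcongr
  obtain ⟨β, hβ, hmax⟩ := Finset.exists_max_image T (fun β => (G.filter fun x => b x = β).card)
    (hG.image b)
  refine ⟨G.filter fun x => b x = β, Finset.filter_subset _ _, ?_, ?_⟩
  · intro x hx y hy
    rw [(Finset.mem_filter.1 hx).2, (Finset.mem_filter.1 hy).2]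
  · have h2 : G.card ≤ T.card * (G.filter fun x => b x = β).card := by
      rw [Finset.card_eq_sum_card_image b G, ← smul_eq_mul]
      exact Finset.sum_le_card_nsmul _ _ _ hmax
    calc (G.card : ℝ) ≤ T.card * (G.filter fun x => b x = β).card := by exact_mod_cast h2
      _ ≤ _ := by rw [mul_comm]; gcongr

/-- The generating function of the distance at `1/4` is `(5/4)^n`. Inside the ball each term is at
least `(5/6)^n`, because `(5/6)^8 ≤ 1/4`, and `(5/4)/(5/6) = 3/2`. -/
theorem card_hamming_ball_le {n : ℕ} (x₀ : Fin n → ℤˣ) :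
    ((Finset.univ.filter fun x : Fin n → ℤˣ => 8 * hammingDist x x₀ < n).card : ℝ)
      ≤ (3 / 2) ^ n := by
  classical
  have h1 : ∑ x : Fin n → ℤˣ, ((1 / 4 : ℝ)) ^ hammingDist x x₀ = (5 / 4) ^ n := by
    have h := Finset.prod_univ_sum (fun _ : Fin n => (Finset.univ : Finset ℤˣ))
      (fun j e => if e ≠ x₀ j then (1 / 4 : ℝ) else 1)
    rw [Fintype.piFinset_univ] at h
    calc _ = ∑ x : Fin n → ℤˣ, ∏ j, (if x j ≠ x₀ j then (1 / 4 : ℝ) else 1) := by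
          refine Finset.sum_congr rfl fun x _ => ?_
          rw [Finset.prod_ite]; simp [hammingDist]
      _ = (5 / 4) ^ n := by
          rw [← h]
          have : ∀ e₀ : ℤˣ, ∑ e : ℤˣ, (if e ≠ e₀ then (1 / 4 : ℝ) else 1) = 5 / 4 := by
            intro e₀
            rw [show (Finset.univ : Finset ℤˣ) = {1, -1} from rfl, Finset.sum_pair (by decide)]
            rcases Int.units_eq_one_or e₀ with rfl | rfl
            · rw [if_neg (by simp), if_pos (by decide)]; norm_num
            · rw [if_pos (by decide), if_neg (by simp)]; norm_num
          simp only [this, Finset.prod_const, Finset.card_univ, Fintype.card_fin]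
  set F := Finset.univ.filter fun x : Fin n → ℤˣ => 8 * hammingDist x x₀ < n
  have h2 : (F.card : ℝ) * (5 / 6) ^ n ≤ (5 / 4) ^ n := by
    calc (F.card : ℝ) * (5 / 6) ^ n = ∑ _x ∈ F, (5 / 6 : ℝ) ^ n := by simp
      _ ≤ ∑ x ∈ F, ((1 / 4 : ℝ)) ^ hammingDist x x₀ := by
          refine Finset.sum_le_sum fun x hx => ?_
          have hx' : 8 * hammingDist x x₀ ≤ n := (Finset.mem_filter.1 hx).2.le
          calc (5 / 6 : ℝ) ^ n ≤ (5 / 6) ^ (8 * hammingDist x x₀) :=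
                pow_le_pow_of_le_one (by norm_num) (by norm_num) hx'
            _ ≤ _ := by rw [pow_mul]; gcongr; norm_num
      _ ≤ ∑ x : Fin n → ℤˣ, ((1 / 4 : ℝ)) ^ hammingDist x x₀ :=
          Finset.sum_le_sum_of_subset_of_nonneg (Finset.subset_univ _) fun _ _ _ => by positivity
      _ = _ := h1
  have h3 : (3 / 2 : ℝ) ^ n * (5 / 6) ^ n = (5 / 4) ^ n := by rw [← mul_pow]; norm_num
  rw [← h3] at h2
  exact le_of_mul_le_mul_right h2 (by positivity)

theorem exists_far_pair {n : ℕ} {S : Finset (Fin n → ℤˣ)} (hS : (3 / 2 : ℝ) ^ n < S.card) :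
    ∃ x ∈ S, ∃ y ∈ S, n ≤ 8 * hammingDist x y := by
  by_contra! hc
  have hne : S.Nonempty := by
    rw [← Finset.card_pos]
    have : (0 : ℝ) < S.card := lt_trans (by positivity) hS
    exact_mod_cast this
  obtain ⟨y, hy⟩ := hne
  have h1 : S ⊆ Finset.univ.filter fun x : Fin n → ℤˣ => 8 * hammingDist x y < n := fun x hx =>
    Finset.mem_filter.2 ⟨Finset.mem_univ x, hc x hx y hy⟩
  have h2 : (S.card : ℝ) ≤ _ := Nat.cast_le.2 (Finset.card_le_card h1)
  linarith [card_hamming_ball_le y]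

theorem half_le_card_filter_le_one {Ω : Type*} [Fintype Ω] {H : Ω → ℝ} (h0 : ∀ x, 0 ≤ H x)
    (hH : ∑ x, H x ≤ (Fintype.card Ω : ℝ) / 2) :
    (Fintype.card Ω : ℝ) / 2 ≤ ((Finset.univ.filter fun x => H x ≤ 1).card : ℝ) := by
  classical
  have h1 := Finset.card_filter_add_card_filter_not (s := (Finset.univ : Finset Ω)) (fun x => H x ≤ 1)
  have h2 : ((Finset.univ.filter fun x => ¬ H x ≤ 1).card : ℝ) ≤ ∑ x, H x := by
    calc _ = ∑ _x ∈ Finset.univ.filter fun x => ¬ H x ≤ 1, (1 : ℝ) := by simp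
      _ ≤ ∑ x ∈ Finset.univ.filter fun x => ¬ H x ≤ 1, H x :=
          Finset.sum_le_sum fun x hx => (not_le.1 (Finset.mem_filter.1 hx).2).le
      _ ≤ _ := Finset.sum_le_sum_of_subset_of_nonneg (Finset.filter_subset _ _) fun x _ _ => h0 x
  have h3 : ((Finset.univ.filter fun x => H x ≤ 1).card : ℝ)
      + ((Finset.univ.filter fun x => ¬ H x ≤ 1).card : ℝ) = Fintype.card Ω := by
    rw [← Finset.card_univ, ← h1]; push_cast; rfl
  linarith

/-- Two far apart sign vectors in the same cell of the rounding. -/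
theorem exists_close_far_pair {m n : ℕ} (hn : 3 ≤ n) (A : Fin m → Fin n → ℝ) {D : ℝ} (hD : 0 < D)
    {w : Fin m → ℝ} (hw : ∑ i, w i ≤ 3 / 2 * n)
    (h1 : ∀ i, 0 < ∑ j, A i j ^ 2 →
      Real.exp (-(D ^ 2 / (32 * ∑ j, A i j ^ 2))) ≤ w i / 800)
    (h2 : ∀ i, 0 < ∑ j, A i j ^ 2 →
      2 / (Real.exp (D ^ 2 / (64 * ∑ j, A i j ^ 2)) - 1) ≤ w i / 200)
    (hw0 : ∀ i, 0 ≤ w i)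
    {V : (Fin n → ℤˣ) → ℝ} (hV0 : ∀ x, 0 ≤ V x) (hV : ∑ x, V x ≤ 2 ^ n / 4) :
    ∃ x y : Fin n → ℤˣ, n ≤ 8 * hammingDist x y ∧ V x ≤ 1 ∧ V y ≤ 1 ∧
      ∀ i, |(∑ j, A i j * ((x j : ℤ) : ℝ)) - ∑ j, A i j * ((y j : ℤ) : ℝ)| ≤ D := by
  classical
  have hn0 : (0 : ℝ) < n := by exact_mod_cast (by omega : 0 < n)
  set Y : (Fin n → ℤˣ) → Fin m → ℝ := fun x i => ∑ j, A i j * ((x j : ℤ) : ℝ) with hY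
  -- Zero rows are left out because the weights `l` must be positive; they are trivial at the end.
  let ι := {i : Fin m // 0 < ∑ j, A i j ^ 2}
  set b : (Fin n → ℤˣ) → ι → ℤ := fun x i => round (Y x i.1 / D) with hb
  -- This choice cancels the prefactor of `sum_signs_abs_round_le`: `l_i · 32S/D² = 1/2`.
  set l : ι → ℝ := fun i => D ^ 2 / (64 * ∑ j, A i.1 j ^ 2) with hl
  have hl0 : ∀ i, 0 < l i := fun i => by have := i.2; positivity
  set W : (Fin n → ℤˣ) → ℝ := fun x => ∑ i, l i * |(b x i : ℝ)| with hW
  have hW0 : ∀ x, 0 ≤ W x := fun x =>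
    Finset.sum_nonneg fun i _ => mul_nonneg (hl0 i).le (abs_nonneg _)
  have hsub : ∑ i : ι, w i.1 ≤ 3 / 2 * n := by
    refine le_trans ?_ hw
    calc ∑ i : ι, w i.1 = ∑ i ∈ Finset.univ.filter fun i => 0 < ∑ j, A i j ^ 2, w i := by
          rw [Finset.sum_subtype (p := fun i => 0 < ∑ j, A i j ^ 2)]
          simp
      _ ≤ _ := Finset.sum_le_sum_of_subset_of_nonneg (Finset.filter_subset _ _) fun i _ _ => hw0 i
  have hWsum : ∑ x, W x ≤ 2 ^ n * (n / 1000) := by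
    calc ∑ x, W x = ∑ i : ι, l i * ∑ x, |(b x i : ℝ)| := by
          simp only [hW]; rw [Finset.sum_comm]; simp only [Finset.mul_sum]
      _ ≤ ∑ i : ι, 2 ^ n * (w i.1 / 1600) := by
          refine Finset.sum_le_sum fun i _ => ?_
          have hS := i.2
          have e1 := sum_signs_abs_round_le (A i.1) hD hS
          have e2 := h1 i.1 hS
          set S := ∑ j, A i.1 j ^ 2 with hSdef
          calc l i * ∑ x, |(b x i : ℝ)|
              ≤ l i * (2 ^ n * (32 * S / D ^ 2 * Real.exp (-(D ^ 2 / (32 * S))))) :=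
                mul_le_mul_of_nonneg_left e1 (hl0 i).le
            _ = 2 ^ n * (Real.exp (-(D ^ 2 / (32 * S))) / 2) := by
                simp only [hl, ← hSdef]
                field_simp
                norm_num
            _ ≤ 2 ^ n * (w i.1 / 1600) :=
                mul_le_mul_of_nonneg_left (by linarith) (by positivity)
      _ = 2 ^ n * ((∑ i : ι, w i.1) / 1600) := by rw [← Finset.mul_sum, Finset.sum_div]
      _ ≤ _ := mul_le_mul_of_nonneg_left (by linarith) (by positivity)
  have hZ : ∑ i, 2 / (Real.exp (l i) - 1) ≤ n / 100 := by
    calc _ ≤ ∑ i : ι, w i.1 / 200 := Finset.sum_le_sum fun i _ => h2 i.1 i.2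
      _ = (∑ i : ι, w i.1) / 200 := by rw [Finset.sum_div]
      _ ≤ _ := by linarith
  have hcardΩ : (Fintype.card (Fin n → ℤˣ) : ℝ) = 2 ^ n := by simp
  -- The averages of `W / (n/100)` and `V` are at most `1/10` and `1/4`. Their sum is below `1/2`,
  -- so half of the sign vectors satisfy both constraints.
  have hG := half_le_card_filter_le_one (Ω := Fin n → ℤˣ) (H := fun x => W x / (n / 100) + V x)
    (fun x => add_nonneg (div_nonneg (hW0 x) (by positivity)) (hV0 x)) (by
      rw [hcardΩ, Finset.sum_add_distrib, ← Finset.sum_div]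
      have : (∑ x, W x) / (n / 100) ≤ 2 ^ n / 10 := by
        rw [div_le_iff₀ (by positivity)]
        refine hWsum.trans (le_of_eq (by ring))
      have h2n : (0 : ℝ) < 2 ^ n := by positivity
      linarith)
  rw [hcardΩ] at hG
  set G := Finset.univ.filter fun x : Fin n → ℤˣ => W x / (n / 100) + V x ≤ 1 with hGdef
  have hGW : ∀ x ∈ G, W x ≤ n / 100 ∧ V x ≤ 1 := by
    intro x hx
    have e1 := (Finset.mem_filter.1 hx).2
    have e2 : 0 ≤ W x / (n / 100) := div_nonneg (hW0 x) (by positivity)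
    refine ⟨?_, by linarith⟩
    have e3 : W x / (n / 100) ≤ 1 := by linarith [hV0 x]
    rwa [div_le_one (by positivity)] at e3
  obtain ⟨S, hSG, hSb, hScard⟩ := exists_large_fiber G b hl0 (B := n / 100) (fun x hx => (hGW x hx).1)
  -- The cell has at least `2^(n-1) e^(-n/50) ≥ (3/2)^n (98/75)^n / 2` elements; `(98/75)³ > 2` is
  -- where `n ≥ 3` enters.
  have hbig : (3 / 2 : ℝ) ^ n < S.card := by
    have e1 : (G.card : ℝ) ≤ S.card * Real.exp (n / 50) := by
      refine hScard.trans ?_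
      gcongr
      linarith
    have e2 : Real.exp (n / 50) * (49 / 50) ^ n ≤ 1 := by
      have : (49 / 50 : ℝ) ≤ Real.exp (-(1 / 50)) := by
        linarith [Real.add_one_le_exp (-(1 / 50) : ℝ)]
      calc Real.exp (n / 50) * (49 / 50) ^ n ≤ Real.exp (n / 50) * Real.exp (-(1 / 50)) ^ n := by
            gcongr
        _ = 1 := by rw [← Real.exp_nat_mul, ← Real.exp_add]; ring_nf; exact Real.exp_zero
    have e3 : (2 : ℝ) ^ n / 2 * (49 / 50) ^ n ≤ S.card := by
      calc (2 : ℝ) ^ n / 2 * (49 / 50) ^ n ≤ S.card * Real.exp (n / 50) * (49 / 50) ^ n := by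
            gcongr; exact hG.trans e1
        _ = S.card * (Real.exp (n / 50) * (49 / 50) ^ n) := by ring
        _ ≤ S.card * 1 := by gcongr
        _ = S.card := mul_one _
    have e4 : (2 : ℝ) ^ n / 2 * (49 / 50) ^ n = (3 / 2) ^ n * ((98 / 75) ^ n / 2) := by
      rw [div_mul_eq_mul_div, ← mul_pow, ← mul_div_assoc ((3 / 2 : ℝ) ^ n), ← mul_pow]; norm_num
    have e5 : (2 : ℝ) < (98 / 75) ^ n := by
      calc (2 : ℝ) < (98 / 75) ^ 3 := by norm_num
        _ ≤ _ := pow_le_pow_right₀ (by norm_num) hn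
    have e6 : (0 : ℝ) < (3 / 2) ^ n := by positivity
    nlinarith
  obtain ⟨x, hx, y, hy, hxy⟩ := exists_far_pair hbig
  refine ⟨x, y, hxy, (hGW x (hSG hx)).2, (hGW y (hSG hy)).2, fun i => ?_⟩
  rcases (Finset.sum_nonneg fun j (_ : j ∈ Finset.univ) => sq_nonneg (A i j)).eq_or_lt with h0 | h0
  · have h3 : ∀ j, A i j = 0 := fun j => by
      have := (Finset.sum_eq_zero_iff_of_nonneg (fun _ _ => sq_nonneg _)).1 h0.symm j
        (Finset.mem_univ j)
      exact pow_eq_zero_iff (two_ne_zero) |>.1 this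
    simp [h3, hD.le]
  · have e1 : round (Y x i / D) = round (Y y i / D) := congrFun (hSb x hx y hy) ⟨i, h0⟩
    have e2 := abs_le.1 (abs_sub_round (Y x i / D))
    have e3 := abs_le.1 (abs_sub_round (Y y i / D))
    rw [e1] at e2
    have e4 : |(Y x i - Y y i) / D| ≤ 1 := by
      rw [sub_div, abs_le]; constructor <;> linarith [e2.1, e2.2, e3.1, e3.2]
    rw [abs_div, abs_of_pos hD, div_le_one hD] at e4
    exact e4

/-! ### Partial colorings for columns in `B_p^m` -/

theorem exp_neg_le_weight {M u2 : ℝ} (hM : 2 / 3 ≤ M) (hu : 0 < u2) :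
    Real.exp (-(1250 * (M / u2))) ≤ u2 * Real.exp (-(M / u2)) / 800 := by
  set t := M / u2 with ht
  have hM0 : 0 < M := by linarith
  have ht0 : 0 < t := by positivity
  have h1 : u2 * t = M := by rw [ht]; field_simp
  have h2 : 1249 * t ≤ Real.exp (1249 * t) := by linarith [Real.add_one_le_exp (1249 * t)]
  have h3 : Real.exp (-t) = Real.exp (-(1250 * t)) * Real.exp (1249 * t) := by
    rw [← Real.exp_add]; ring_nf
  rw [h3]
  have h4 : 800 ≤ u2 * Real.exp (1249 * t) := by nlinarith
  nlinarith [Real.exp_pos (-(1250 * t))]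

/-- With `t = M/u²`, `e^(625t) - 1 ≥ e^t · 624t`, and `u² t = M` is bounded below. -/
theorem two_div_exp_sub_one_le_weight {M u2 : ℝ} (hM : 2 / 3 ≤ M) (hu : 0 < u2) :
    2 / (Real.exp (625 * (M / u2)) - 1) ≤ u2 * Real.exp (-(M / u2)) / 200 := by
  set t := M / u2 with ht
  have hM0 : 0 < M := by linarith
  have ht0 : 0 < t := by positivity
  have h1 : u2 * t = M := by rw [ht]; field_simp
  have h2 : 624 * t + 1 ≤ Real.exp (624 * t) := Real.add_one_le_exp (624 * t)
  have h3 : Real.exp (625 * t) = Real.exp t * Real.exp (624 * t) := by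
    rw [← Real.exp_add]; ring_nf
  have h4 : 1 ≤ Real.exp t := Real.one_le_exp ht0.le
  have h5 : Real.exp t * (624 * t) ≤ Real.exp (625 * t) - 1 := by rw [h3]; nlinarith
  have h6 : 0 < Real.exp t * (624 * t) := by positivity
  rw [div_le_iff₀ (by linarith)]
  calc (2 : ℝ) ≤ u2 * Real.exp (-t) / 200 * (Real.exp t * (624 * t)) := by
        have : Real.exp (-t) * Real.exp t = 1 := by rw [← Real.exp_add]; simp
        have e : u2 * Real.exp (-t) / 200 * (Real.exp t * (624 * t))
            = 624 / 200 * (u2 * t) * (Real.exp (-t) * Real.exp t) := by ring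
        rw [e, this, h1]; linarith
    _ ≤ _ := by gcongr

/-- The step bound, as the product of a bound for each coordinate and `n^(1/q)`. -/
theorem three_mul_rpow_eq_stepBound {m n : ℕ} (p q : ℝ≥0∞) (hn : 1 ≤ n) (c : ℝ) :
    3 * (c * Real.sqrt (minReal p (logRatio m n)) * (n : ℝ) ^ (1 / 2 - (p⁻¹).toReal))
      * (n : ℝ) ^ (q⁻¹).toReal = 3 * c * stepBound m n p q := by
  have hn' : (0 : ℝ) < n := by exact_mod_cast hn
  unfold stepBound balExponent
  rw [Real.rpow_add hn']
  ring

/-- Half the difference of the two sign vectors has entries `0` and `±1`, with at least `n/8`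
nonzero ones. Being in one cell bounds the image in every coordinate, and membership in the good
half bounds its `p`-th moment. -/
theorem exists_partial_coloring {m n : ℕ} {p q : ℝ≥0∞} (hp : 2 ≤ p) (hpq : p ≤ q)
    (hn : 3 ≤ n) (hnm : n ≤ m) {A : Fin m → Fin n → ℝ}
    (hA : ∀ j, (fun i => A i j) ∈ lpBall p m) :
    ∃ x y : Fin n → ℤˣ, n ≤ 8 * hammingDist x y ∧
      vecNorm q (fun i => ∑ j, A i j * ((((x j : ℤ) : ℝ) - ((y j : ℤ) : ℝ)) / 2))
        ≤ 600 * stepBound m n p q := by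
  have hn1 : 1 ≤ n := by omega
  have hn' : (0 : ℝ) < n := by exact_mod_cast hn1
  have hL := two_thirds_le_logRatio hn1 hnm
  have hM := half_le_minReal hp hL
  set M := minReal p (logRatio m n) with hMdef
  set s : ℝ := (n : ℝ) ^ (1 / 2 - (p⁻¹).toReal) with hs
  have hs0 : 0 < s := by positivity
  have hM0 : 0 < M := by linarith
  have hsM : 0 < Real.sqrt M := Real.sqrt_pos.2 hM0
  -- `200² / 32 = 1250` and `200² / 64 = 625` are the rates in the two weight lemmas.
  set D := 200 * Real.sqrt M * s with hDdef
  have hD : 0 < D := by positivity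
  have hD2 : D ^ 2 = 40000 * M * s ^ 2 := by
    rw [hDdef, mul_pow, mul_pow, Real.sq_sqrt hM0.le]; norm_num
  have hu2 : ∀ i, rowRatio p A i ^ 2 = (∑ j, A i j ^ 2) / s ^ 2 := fun i => by
    unfold rowRatio
    rw [div_pow, Real.sq_sqrt (Finset.sum_nonneg fun _ _ => sq_nonneg _)]
  -- The moment matters only when `p` is the smaller term of the minimum. Normalizing by half of `n
  -- D^p` leaves room for adding the moments of two sign vectors.
  set V : (Fin n → ℤˣ) → ℝ := fun x => if p ≠ ⊤ ∧ p.toReal ≤ logRatio m n then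
    (∑ i, |∑ j, A i j * ((x j : ℤ) : ℝ)| ^ p.toReal) / (n * D ^ p.toReal / 2) else 0 with hVdef
  have hV0 : ∀ x, 0 ≤ V x := by
    intro x
    simp only [hVdef]
    split_ifs
    · exact div_nonneg (Finset.sum_nonneg fun _ _ => Real.rpow_nonneg (abs_nonneg _) _)
        (by positivity)
    · exact le_rfl
  have hV : ∑ x, V x ≤ 2 ^ n / 4 := by
    by_cases hc : p ≠ ⊤ ∧ p.toReal ≤ logRatio m n
    · simp only [hVdef, if_pos hc]
      have h2 := two_le_toReal hp hc.1
      have hMP : M = p.toReal := by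
        rw [hMdef, minReal_of_ne_top hc.1 (by linarith), min_eq_left hc.2]
      have hrow := sum_rowRatio_rpow_le hp hc.1 hn1 hA
      set P := p.toReal
      rw [← Finset.sum_div, div_le_iff₀ (by positivity), Finset.sum_comm]
      calc ∑ i, ∑ x : Fin n → ℤˣ, |∑ j, A i j * ((x j : ℤ) : ℝ)| ^ P
          ≤ ∑ i, 2 ^ n * (2 * ((2 * Real.sqrt P * s) ^ P * rowRatio p A i ^ P)) := by
            refine Finset.sum_le_sum fun i _ => ?_
            rw [← Real.mul_rpow (by positivity) (rowRatio_nonneg p A i)]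
            have e0 : 2 * Real.sqrt P * s * rowRatio p A i
                = 2 * Real.sqrt P * Real.sqrt (∑ j, A i j ^ 2) := by
              unfold rowRatio
              rw [← hs]
              field_simp
            rw [e0]
            exact sum_signs_abs_rpow_le (A i) (by linarith : 1 ≤ P)
        _ = 2 ^ n * (2 * (2 * Real.sqrt P * s) ^ P * ∑ i, rowRatio p A i ^ P) := by
            rw [Finset.mul_sum, Finset.mul_sum]
            exact Finset.sum_congr rfl fun i _ => by ring
        _ ≤ 2 ^ n * (2 * (2 * Real.sqrt P * s) ^ P * n) := by gcongr
        _ ≤ 2 ^ n / 4 * (n * D ^ P / 2) := by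
            -- `D` is `100` times the scale in Khintchine's inequality, so the average of `V` is at
            -- most `4/100^P`, well below `1/4`.
            have e1 : D = 100 * (2 * Real.sqrt P * s) := by rw [hDdef, hMP]; ring
            have e2 : (10000 : ℝ) ≤ 100 ^ P := by
              calc (10000 : ℝ) = 100 ^ (2 : ℝ) := by norm_num
                _ ≤ _ := Real.rpow_le_rpow_of_exponent_le (by norm_num) h2
            have e0 : D ^ P = 100 ^ P * (2 * Real.sqrt P * s) ^ P := by
              rw [e1, Real.mul_rpow (by norm_num) (by positivity)]
            rw [e0]
            generalize hz : (2 * Real.sqrt P * s) ^ P = z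
            have hz0 : 0 ≤ z := by rw [← hz]; positivity
            have e3 : 16 * z ≤ 100 ^ P * z := by nlinarith
            calc 2 ^ n * (2 * z * n) = 2 ^ n / 4 * (n * (16 * z) / 2) := by ring
              _ ≤ 2 ^ n / 4 * (n * (100 ^ P * z) / 2) := by gcongr
    · simp only [hVdef, if_neg hc, Finset.sum_const_zero]
      positivity
  have hS : ∀ i, (0 : ℝ) < ∑ j, A i j ^ 2 → D ^ 2 / (∑ j, A i j ^ 2)
      = 40000 * (M / rowRatio p A i ^ 2) := by
    intro i hi
    rw [hD2, hu2]
    field_simp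
  obtain ⟨x, y, hxy, hVx, hVy, hclose⟩ := exists_close_far_pair hn A hD
    (w := fun i => rowRatio p A i ^ 2 * Real.exp (-(M / rowRatio p A i ^ 2)))
    (sum_rowRatio_sq_mul_exp_le hp hn1 hnm hA)
    (fun i hi => by
      have h0 : 0 < rowRatio p A i ^ 2 := by rw [hu2]; positivity
      convert exp_neg_le_weight hM h0 using 3
      rw [mul_comm 32, ← div_div, hS i hi]; ring)
    (fun i hi => by
      have h0 : 0 < rowRatio p A i ^ 2 := by rw [hu2]; positivity
      convert two_div_exp_sub_one_le_weight hM h0 using 4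
      rw [mul_comm 64, ← div_div, hS i hi]; ring)
    (fun i => by positivity) hV0 hV
  refine ⟨x, y, hxy, ?_⟩
  have hval : ∀ i, ∑ j, A i j * ((((x j : ℤ) : ℝ) - ((y j : ℤ) : ℝ)) / 2)
      = ((∑ j, A i j * ((x j : ℤ) : ℝ)) - ∑ j, A i j * ((y j : ℤ) : ℝ)) / 2 := by
    intro i
    rw [← Finset.sum_sub_distrib, Finset.sum_div]
    exact Finset.sum_congr rfl fun j _ => by ring
  have hfin := vecNorm_le_of_abs_le hp hpq hn1 hnm hD
    (y := fun i => ∑ j, A i j * ((((x j : ℤ) : ℝ) - ((y j : ℤ) : ℝ)) / 2)) (fun i => by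
      rw [hval, abs_div, abs_two]; linarith [hclose i]) (fun hp' hc => by
      have h2 := two_le_toReal hp hp'
      simp only [hVdef, if_pos (And.intro hp' hc.le)] at hVx hVy
      rw [div_le_one (by positivity)] at hVx hVy
      calc _ ≤ ∑ i, (|∑ j, A i j * ((x j : ℤ) : ℝ)| ^ p.toReal
              + |∑ j, A i j * ((y j : ℤ) : ℝ)| ^ p.toReal) := by
            refine Finset.sum_le_sum fun i _ => ?_
            rw [hval]
            set a := ∑ j, A i j * ((x j : ℤ) : ℝ)
            set b := ∑ j, A i j * ((y j : ℤ) : ℝ)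
            have e1 : |(a - b) / 2| ≤ max |a| |b| := by
              rw [abs_div, abs_two, div_le_iff₀ (by norm_num)]
              have := abs_sub a b
              linarith [le_max_left |a| |b|, le_max_right |a| |b|, abs_sub_le a 0 b,
                abs_neg b, abs_add_le a (-b), sub_eq_add_neg a b]
            have e2 : |(a - b) / 2| ^ p.toReal ≤ (max |a| |b|) ^ p.toReal :=
              Real.rpow_le_rpow (abs_nonneg _) e1 (by linarith)
            have ha := Real.rpow_nonneg (abs_nonneg a) p.toReal
            have hb := Real.rpow_nonneg (abs_nonneg b) p.toReal
            rcases max_cases |a| |b| with ⟨e3, _⟩ | ⟨e3, _⟩ <;> rw [e3] at e2 <;> linarith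
        _ ≤ n * D ^ p.toReal := by
            rw [Finset.sum_add_distrib]; linarith)
  refine hfin.trans (le_of_eq ?_)
  rw [hDdef, hs, hMdef, three_mul_rpow_eq_stepBound p q hn1]
  norm_num

/-! ### Iterated partial coloring and the vector balancing constant -/

theorem signedSum_apply {m n : ℕ} (x : Fin n → ℤˣ) (v : Fin n → Fin m → ℝ) (i : Fin m) :
    signedSum x v i = ∑ j, v j i * ((x j : ℤ) : ℝ) := by
  simp [signedSum, Finset.sum_apply, mul_comm]

/-- Strong induction: the coordinates on which the two sign vectors agree form a smaller instance in
the same dimension `m`, and `totalBound` pays for the step. -/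
theorem exists_signs_on {m : ℕ} {p q : ℝ≥0∞} (hp : 2 ≤ p) (hpq : p ≤ q)
    (h : ¬ (p = 2 ∧ q = ⊤)) (n : ℕ) : n ≤ m → ∀ v : Fin n → Fin m → ℝ,
    (∀ j, v j ∈ lpBall p m) →
    ∃ x : Fin n → ℤˣ, vecNorm q (signedSum x v) ≤ 600 * totalBound (1 / 8) m n p q := by
  classical
  induction n using Nat.strong_induction_on with
  | _ n ih =>
  intro hnm v hv
  have hq := hp.trans hpq
  rcases Nat.eq_zero_or_pos n with rfl | hn
  · refine ⟨fun _ => 1, ?_⟩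
    rw [totalBound_zero hp hpq h]
    simp [signedSum, vecNorm_zero hq]
  -- The pigeonhole count needs `n ≥ 3`. One or two vectors have a sum of norm at most `2`, and
  -- `stepBound` is at least `1/2`.
  rcases Nat.lt_or_ge n 3 with hn3 | hn3
  · refine ⟨fun _ => 1, ?_⟩
    have h1 : vecNorm q (signedSum (fun _ => 1) v) ≤ 2 := by
      unfold signedSum
      refine (vecNorm_sum_le hq _ _).trans ?_
      calc _ ≤ ∑ _j : Fin n, (1 : ℝ) := Finset.sum_le_sum fun j _ => by
            simpa using vecNorm_le_one_mono hp hpq (hv j)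
        _ ≤ 2 := by simp; exact_mod_cast (by omega : n ≤ 2)
    have h2 := one_div_le_stepBound hp hpq h hn hnm
    have h3 := stepBound_add_totalBound_le hp hpq h hn hnm (c := 1 / 8) (n' := 0) (by norm_num)
      (by norm_num) (by push_cast; positivity)
    rw [totalBound_zero hp hpq h] at h3
    linarith
  obtain ⟨x, y, hxy, hnorm⟩ := exists_partial_coloring hp hpq hn3 hnm (A := fun i j => v j i) hv
  set U : Finset (Fin n) := Finset.univ.filter fun j => x j = y j with hU
  have hcard : U.card + hammingDist x y = n := by
    have := Finset.card_filter_add_card_filter_not (s := (Finset.univ : Finset (Fin n)))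
      (fun j => x j = y j)
    simpa [hammingDist] using this
  have hcard' : (U.card : ℝ) ≤ (1 - 1 / 8) * n := by
    have : 8 * U.card ≤ 7 * n := by omega
    have : (8 : ℝ) * U.card ≤ 7 * n := by exact_mod_cast this
    linarith
  have hlt : U.card < n := by omega
  obtain ⟨x', hx'⟩ := ih U.card hlt (by omega) (fun k => v (U.equivFin.symm k).1)
    (fun k => hv _)
  set z : Fin n → ℤˣ := fun j => if hj : j ∈ U then x' (U.equivFin ⟨j, hj⟩) else x j with hz
  refine ⟨z, ?_⟩
  have hsum : signedSum z v = (fun i => ∑ j, v j i * ((((x j : ℤ) : ℝ) - ((y j : ℤ) : ℝ)) / 2))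
      + signedSum x' (fun k => v (U.equivFin.symm k).1) := by
    ext i
    rw [Pi.add_apply, signedSum_apply, signedSum_apply]
    have e1 : ∑ k, v (U.equivFin.symm k).1 i * ((x' k : ℤ) : ℝ)
        = ∑ j ∈ U, v j i * ((z j : ℤ) : ℝ) := by
      rw [← Finset.sum_coe_sort U, ← U.equivFin.sum_comp]
      refine Finset.sum_congr rfl fun j _ => ?_
      simp [hz]
    have e2 : ∑ j ∈ U, v j i * ((z j : ℤ) : ℝ)
        = ∑ j, if j ∈ U then v j i * ((z j : ℤ) : ℝ) else 0 := by
      rw [Finset.sum_ite_mem, Finset.univ_inter]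
    rw [e1, e2, ← Finset.sum_add_distrib]
    refine Finset.sum_congr rfl fun j _ => ?_
    by_cases hj : j ∈ U
    · have : x j = y j := (Finset.mem_filter.1 hj).2
      simp [hj, this]
    -- Where the sign vectors differ, the half difference is `x j` itself, a final sign.
    · have hne : x j ≠ y j := fun e => hj (Finset.mem_filter.2 ⟨Finset.mem_univ j, e⟩)
      have hy : y j = - x j := by
        rcases Int.units_eq_one_or (x j) with e | e <;> rcases Int.units_eq_one_or (y j) with e' | e' <;>
          simp_all
      simp only [hz, hj, dif_neg, not_false_eq_true, if_neg, hy]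
      push_cast
      ring
  have hstep := stepBound_add_totalBound_le hp hpq h hn hnm (c := 1 / 8) (by norm_num)
    (by norm_num) hcard'
  rw [hsum]
  refine (vecNorm_add_le hq _ _).trans ?_
  linarith

/-- The vector balancing constant between `ℓ_p` and `ℓ_q` balls. -/
theorem vb_lpBall_le {m n : ℕ} {p q : ℝ≥0∞} (hn : 1 ≤ n) (hnm : n ≤ m) (hp : 2 ≤ p) (hpq : p ≤ q)
    (h : ¬ (p = 2 ∧ q = ⊤)) :
    vb n (lpBall p m) (lpBall q m) ≤ ENNReal.ofReal (38400 * balBound m n p q) := by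
  refine iSup₂_le fun v hv => ?_
  obtain ⟨x, hx⟩ := exists_signs_on hp hpq h n hnm v hv
  have h1 := totalBound_le hp hpq h hn hnm (c := 1 / 8) (by norm_num)
  have hb : 0 < balBound m n p q := by
    rw [balBound_eq]
    have := one_div_le_stepBound hp hpq h hn hnm
    have := balExponent_pos hp hpq h
    positivity
  have h2 : vecNorm q (signedSum x v) ≤ 38400 * balBound m n p q := by linarith
  refine (iInf_le _ x).trans (ENNReal.ofReal_le_ofReal ?_)
  set N := 38400 * balBound m n p q
  have hN : 0 < N := by positivity
  refine gauge_le_of_mem hN.le ?_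
  rw [Set.mem_smul_set_iff_inv_smul_mem₀ hN.ne']
  change vecNorm q _ ≤ 1
  rw [vecNorm_smul (hp.trans hpq), abs_of_pos (by positivity), inv_mul_le_iff₀ hN]
  linarith

namespace RealRAM

/-! ### Measurability of the semantics -/

theorem NExpr.measurable_eval (e : NExpr) : Measurable fun s : State => e.eval s := by
  induction e with
  | const c => exact measurable_const
  | var v => exact (measurable_pi_apply v).comp measurable_fst
  | add e f he hf => exact he.add hf
  | sub e f he hf => exact he.sub hf

/-- The position read depends on the state, but only countably many positions exist. -/
theorem measurable_entry (a : ℕ) {i j : State → ℕ} (hi : Measurable i) (hj : Measurable j) :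
    Measurable fun s : State => s.2.1 a (i s) (j s) := by
  have h : Measurable fun x : State × ℕ × ℕ => x.1.2.1 a x.2.1 x.2.2 :=
    measurable_from_prod_countable_left fun y => by dsimp only; fun_prop
  exact h.comp (measurable_id.prodMk (hi.prodMk hj))

theorem RExpr.measurable_eval (e : RExpr) : Measurable fun s : State => e.eval s := by
  induction e with
  | ofNat e => exact measurable_from_top.comp e.measurable_eval
  | get a i j => exact measurable_entry a i.measurable_eval j.measurable_eval
  | add e f he hf => exact he.add hf
  | sub e f he hf => exact he.sub hf
  | mul e f he hf => exact he.mul hf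
  | div e f he hf => exact he.div hf
  | exp e he => exact Real.measurable_exp.comp he
  | log e he => exact Real.measurable_log.comp he

theorem Test.measurableSet_eval (b : Test) : MeasurableSet {s : State | b.eval s} := by
  induction b with
  | nle e f => exact measurableSet_le e.measurable_eval f.measurable_eval
  | rle e f => exact measurableSet_le e.measurable_eval f.measurable_eval
  | not b hb => exact hb.compl
  | and b c hb hc => exact hb.inter hc

theorem measurable_tick (c : ℝ≥0) : Measurable (tick c) := by
  unfold tick
  fun_prop

theorem measurable_setInt (v : ℕ) {k : State → ℕ} (hk : Measurable k) :
    Measurable fun s => setInt v (k s) s := by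
  refine Measurable.prodMk (measurable_pi_iff.2 fun w => ?_) measurable_snd
  by_cases h : w = v
  · subst h; simpa using hk
  · simp only [Function.update_of_ne h]; fun_prop

theorem measurable_setReal (a : ℕ) {i j : State → ℕ} {r : State → ℝ} (hi : Measurable i)
    (hj : Measurable j) (hr : Measurable r) :
    Measurable fun s => setReal a (i s) (j s) (r s) s := by
  refine measurable_fst.prodMk (Measurable.prodMk ?_ (by fun_prop))
  refine measurable_pi_iff.2 fun a' => measurable_pi_iff.2 fun i' => measurable_pi_iff.2 fun j' => ?_
  refine Measurable.ite ?_ hr (by fun_prop)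
  exact (MeasurableSet.const _).inter
    ((measurableSet_eq_fun measurable_const hi).inter (measurableSet_eq_fun measurable_const hj))

theorem measurable_setRow {n : ℕ} (a : ℕ) :
    Measurable fun x : State × (Fin n → ℝ) => setRow a x.2 x.1 := by
  refine Measurable.prodMk (by fun_prop) (Measurable.prodMk ?_ (by fun_prop))
  refine measurable_pi_iff.2 fun a' => measurable_pi_iff.2 fun i' => measurable_pi_iff.2 fun j' => ?_
  by_cases h : a' = a ∧ i' = 0 ∧ j' < n
  · simp only [dif_pos h]; fun_prop
  · simp only [dif_neg h]; fun_prop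

theorem measurable_runLoop (b : Test) (c : ℝ≥0) {run : State → Measure State}
    (hrun : Measurable run) (N : ℕ) : Measurable (runLoop b c run N) := by
  classical
  induction N with
  | zero => exact measurable_const
  | succ N ih =>
    refine Measurable.ite b.measurableSet_eval ?_ (Measure.measurable_dirac.comp (measurable_tick c))
    exact (Measure.measurable_bind' ih).comp (hrun.comp (measurable_tick c))

theorem measurable_run (D : Sampler) (hD : ∀ m n, IsMarkovKernel (D m n)) (T : ℕ → ℕ → ℝ≥0)
    (N : ℕ) (P : Prog) : Measurable (run D T N P) := by
  classical
  induction P with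
  | nset v e =>
    exact Measure.measurable_dirac.comp ((measurable_tick _).comp
      (measurable_setInt v e.measurable_eval))
  | rset a i j e =>
    exact Measure.measurable_dirac.comp ((measurable_tick _).comp
      (measurable_setReal a i.measurable_eval j.measurable_eval e.measurable_eval))
  | seq P Q hP hQ => exact (Measure.measurable_bind' hQ).comp hP
  | ite b P Q hP hQ =>
    exact Measurable.ite b.measurableSet_eval (hP.comp (measurable_tick _))
      (hQ.comp (measurable_tick _))
  | loop b P hP => exact measurable_runLoop b _ hP N
  | sample m n a x y =>
    -- The dimensions of the call depend on the state. They are made separate arguments, so that for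
    -- each of countably many pairs the law comes from a fixed kernel.
    have h : Measurable fun w : State × ℕ × ℕ =>
        (D w.2.1 w.2.2 (fun i j => w.1.2.1 a i j, fun j => w.1.2.1 x 0 j)).map
          (fun z => tick (m.cost + n.cost + 1 + T w.2.1 w.2.2) (setRow y z w.1)) := by
      refine measurable_from_prod_countable_left fun ⟨k, l⟩ => ?_
      have := hD k l
      have hφ : Measurable fun s : State => ((fun (i : Fin k) (j : Fin l) => s.2.1 a i j,
          fun j : Fin l => s.2.1 x 0 j) : (Fin k → Fin l → ℝ) × (Fin l → ℝ)) := by fun_prop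
      have hG : Measurable fun w : State × (Fin l → ℝ) =>
          tick (m.cost + n.cost + 1 + T k l) (setRow y w.2 w.1) :=
        (measurable_tick _).comp (measurable_setRow y)
      have hK := (((Kernel.id ×ₖ ((D k l).comap _ hφ)) : Kernel State _).map
        (fun w : State × (Fin l → ℝ) =>
          tick (m.cost + n.cost + 1 + T k l) (setRow y w.2 w.1))).measurable
      convert hK using 2 with s
      rw [Kernel.map_apply _ hG, Kernel.prod_apply, Kernel.id_apply, Measure.dirac_prod,
        Measure.map_map hG measurable_prodMk_left, Kernel.comap_apply]
      rfl
    exact h.comp (measurable_id.prodMk (m.measurable_eval.prodMk n.measurable_eval))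

/-! ### Monotonicity in the number of iterations -/

theorem bind_mono {α β : Type*} [MeasurableSpace α] [MeasurableSpace β] {μ ν : Measure α}
    {f g : α → Measure β} (hf : Measurable f) (hg : Measurable g) (hμ : μ ≤ ν)
    (hfg : ∀ x, f x ≤ g x) : μ.bind f ≤ ν.bind g := by
  rw [Measure.le_iff]
  intro s hs
  rw [Measure.bind_apply hs hf.aemeasurable, Measure.bind_apply hs hg.aemeasurable]
  exact lintegral_mono' hμ fun x => hfg x s

theorem runLoop_mono (b : Test) (c : ℝ≥0) {run run' : State → Measure State}
    (hrun : Measurable run) (hrun' : Measurable run') (h : ∀ s, run s ≤ run' s) {N M : ℕ}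
    (hNM : N ≤ M) (s : State) : runLoop b c run N s ≤ runLoop b c run' M s := by
  induction N generalizing M s with
  | zero => exact Measure.zero_le _
  | succ N ih =>
    obtain ⟨M, rfl⟩ : ∃ k, M = k + 1 := ⟨M - 1, by omega⟩
    unfold runLoop
    split_ifs
    · exact bind_mono (measurable_runLoop b c hrun N) (measurable_runLoop b c hrun' M) (h _)
        fun t => ih (by omega) t
    · exact le_rfl

/-- Allowing more iterations only adds runs, so the expected time need only be estimated for `N`
large enough for the inner loops. -/
theorem run_mono (D : Sampler) (hD : ∀ m n, IsMarkovKernel (D m n)) (T : ℕ → ℕ → ℝ≥0)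
    {N M : ℕ} (hNM : N ≤ M) (P : Prog) (s : State) : run D T N P s ≤ run D T M P s := by
  induction P generalizing s with
  | nset v e => exact le_rfl
  | rset a i j e => exact le_rfl
  | seq P Q hP hQ =>
    exact bind_mono (measurable_run D hD T N Q) (measurable_run D hD T M Q) (hP s) hQ
  | ite b P Q hP hQ => unfold run; split_ifs; exacts [hP _, hQ _]
  | loop b P hP =>
    exact runLoop_mono b _ (measurable_run D hD T N P) (measurable_run D hD T M P) hP hNM s
  | sample m n a x y => exact le_rfl

theorem bind_univ_le_one {α β : Type*} [MeasurableSpace α] [MeasurableSpace β] {μ : Measure α}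
    {f : α → Measure β} (hf : Measurable f) (hμ : μ univ ≤ 1) (h : ∀ x, f x univ ≤ 1) :
    μ.bind f univ ≤ 1 := by
  rw [Measure.bind_apply MeasurableSet.univ hf.aemeasurable]
  calc ∫⁻ x, f x univ ∂μ ≤ ∫⁻ _, 1 ∂μ := lintegral_mono h
    _ ≤ 1 := by simpa using hμ

theorem runLoop_univ_le_one (b : Test) (c : ℝ≥0) {run : State → Measure State}
    (hrun : Measurable run) (h : ∀ s, run s univ ≤ 1) (N : ℕ) (s : State) :
    runLoop b c run N s univ ≤ 1 := by
  induction N generalizing s with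
  | zero => simp [runLoop]
  | succ N ih =>
    unfold runLoop
    split_ifs
    · exact bind_univ_le_one (measurable_runLoop b c hrun N) (h _) ih
    · simp

theorem run_univ_le_one (D : Sampler) (hD : ∀ m n, IsMarkovKernel (D m n)) (T : ℕ → ℕ → ℝ≥0)
    (N : ℕ) (P : Prog) (s : State) : run D T N P s univ ≤ 1 := by
  induction P generalizing s with
  | nset v e => simp [run]
  | rset a i j e => simp [run]
  | seq P Q hP hQ => exact bind_univ_le_one (measurable_run D hD T N Q) (hP s) hQ
  | ite b P Q hP hQ => unfold run; split_ifs; exacts [hP _, hQ _]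
  | loop b P hP => exact runLoop_univ_le_one b _ (measurable_run D hD T N P) hP N s
  | sample m n a x y =>
    unfold run
    have := hD (m.eval s) (n.eval s)
    have hG : Measurable fun z : Fin (n.eval s) → ℝ =>
        tick (m.cost + n.cost + 1 + T (m.eval s) (n.eval s)) (setRow y z s) :=
      (measurable_tick _).comp ((measurable_setRow y).comp measurable_prodMk_left)
    rw [Measure.map_apply hG MeasurableSet.univ]
    simp

/-! ### Expected time and failure probability of a loop that halves a counter -/

/-- The number of binary digits is the potential of the main loop. -/
theorem size_half_lt {a b : ℕ} (hb : 1 ≤ b) (h : 2 * a ≤ b) : a.size + 1 ≤ b.size := by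
  rcases Nat.eq_zero_or_pos a with rfl | ha
  · have := Nat.size_pos.2 hb; rw [Nat.size_zero]; omega
  · have h1 : a.size - 1 < a.size := by have := Nat.size_pos.2 ha; omega
    have h2 := Nat.lt_size.1 h1
    rw [Nat.succ_le_iff, Nat.lt_size]
    calc 2 ^ a.size = 2 * 2 ^ (a.size - 1) := by
          rw [← pow_succ', Nat.sub_add_cancel (Nat.size_pos.2 ha)]
      _ ≤ 2 * a := by omega
      _ ≤ b := h

/-- One iteration of a loop with the invariant `Inv`, the counter `R` and the time bound `κ`: with
probability at least `1/2` the counter is halved. -/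
def HalvingStep (Inv : State → Prop) (R : State → ℕ) (κ : ℝ≥0) (s : State) (ν : Measure State) :
    Prop :=
  ∃ (n : ℕ) (μ : Measure (Fin n → ℝ)) (k : (Fin n → ℝ) → Measure State), IsProbabilityMeasure μ ∧
    Measurable k ∧ ν = μ.bind k ∧ ∃ bad, MeasurableSet bad ∧ μ bad ≤ 1 / 2 ∧
      ∀ᵐ z ∂μ, ∃ t, k z = Measure.dirac t ∧ Inv t ∧ t.2.2 ≤ s.2.2 + κ ∧ R t ≤ R s ∧
        (z ∉ bad → 2 * R t ≤ R s)

section Halving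

variable {b : Test} {c κ : ℝ≥0} {run : State → Measure State} {Inv : State → Prop} {R : State → ℕ}

theorem lintegral_bind_bind {α : Type*} [MeasurableSpace α] {μ : Measure α}
    {k : α → Measure State} (hk : Measurable k) {g : State → Measure State} (hg : Measurable g)
    {f : State → ℝ≥0∞} (hf : Measurable f) :
    ∫⁻ t, f t ∂((μ.bind k).bind g) = ∫⁻ z, ∫⁻ t, (∫⁻ u, f u ∂(g t)) ∂(k z) ∂μ := by
  have h1 : Measurable fun t => ∫⁻ u, f u ∂(g t) := (Measure.measurable_lintegral hf).comp hg
  rw [Measure.lintegral_bind hg.aemeasurable hf.aemeasurable,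
    Measure.lintegral_bind hk.aemeasurable h1.aemeasurable]

theorem measurable_time : Measurable fun t : State => (t.2.2 : ℝ≥0∞) := by fun_prop

/-- Each digit of the counter is charged `2κ`. A round costs at most `κ` and removes a digit with
probability at least `1/2`, so it pays for itself on average; the summand `c` is the final test. -/
theorem lintegral_time_runLoop_le (hrun : Measurable run)
    (hb : ∀ s, Inv s → (b.eval s ↔ 1 ≤ R s))
    (hstep : ∀ s, Inv s → 1 ≤ R s → HalvingStep Inv R κ s (run (tick c s))) (N : ℕ) (s : State)
    (hs : Inv s) :
    ∫⁻ t, (t.2.2 : ℝ≥0∞) ∂(runLoop b c run N s) ≤ s.2.2 + c + 2 * κ * (R s).size := by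
  induction N generalizing s with
  | zero => simp [runLoop]
  | succ N ih =>
    unfold runLoop
    have hL := measurable_runLoop b c hrun N
    split_ifs with hbs
    · have hR := (hb s hs).1 hbs
      obtain ⟨n, μ, k, hμ, hk, hν, bad, hbad, hbad2, hae⟩ := hstep s hs hR
      rw [hν, lintegral_bind_bind hk hL measurable_time]
      obtain ⟨S, hS⟩ : ∃ S, (R s).size = S + 1 :=
        ⟨(R s).size - 1, by have := Nat.size_pos.2 hR; omega⟩
      have hpt : ∀ᵐ z ∂μ, ∫⁻ t, (∫⁻ u, (u.2.2 : ℝ≥0∞) ∂(runLoop b c run N t)) ∂(k z)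
          ≤ (s.2.2 + κ + c + 2 * κ * S) + bad.indicator (fun _ => 2 * (κ : ℝ≥0∞)) z := by
        filter_upwards [hae] with z ⟨t, hkt, hIt, htime, hRt, hgood⟩
        have hm : Measurable fun t => ∫⁻ u, (u.2.2 : ℝ≥0∞) ∂(runLoop b c run N t) :=
          (Measure.measurable_lintegral measurable_time).comp hL
        rw [hkt, lintegral_dirac' _ hm]
        refine (ih t hIt).trans ?_
        have htime' : (t.2.2 : ℝ≥0∞) ≤ s.2.2 + κ := by exact_mod_cast htime
        by_cases hz : z ∈ bad
        · rw [Set.indicator_of_mem hz]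
          have h1 : (R t).size ≤ S + 1 := hS ▸ Nat.size_le_size hRt
          have h2 : ((R t).size : ℝ≥0∞) ≤ S + 1 := by exact_mod_cast h1
          calc (t.2.2 : ℝ≥0∞) + c + 2 * κ * (R t).size ≤ s.2.2 + κ + c + 2 * κ * (S + 1) := by
                gcongr
            _ = _ := by ring
        · rw [Set.indicator_of_notMem hz, add_zero]
          have h1 : (R t).size ≤ S := by have := size_half_lt hR (hgood hz); omega
          gcongr
      refine (lintegral_mono_ae hpt).trans ?_
      rw [lintegral_add_left measurable_const, lintegral_const, lintegral_indicator hbad,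
        lintegral_const, Measure.restrict_apply_univ, measure_univ, mul_one, hS]
      calc (s.2.2 : ℝ≥0∞) + κ + c + 2 * κ * S + 2 * κ * μ bad
          ≤ s.2.2 + κ + c + 2 * κ * S + 2 * κ * (1 / 2) := by gcongr
        _ = s.2.2 + κ + c + 2 * κ * S + κ := by
            rw [mul_right_comm 2 (κ : ℝ≥0∞) (1 / 2), one_div,
              ENNReal.mul_inv_cancel (by norm_num) (by norm_num), one_mul]
        _ = _ := by push_cast; ring
    · rw [lintegral_dirac' _ measurable_time]
      simp only [tick]
      push_cast
      exact le_self_add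

/-- The quantity `2^size` never grows and is halved with probability at least `1/2`, so each round
multiplies its mean by at most `1/2 + 1/4 = 3/4`. It dominates `1` while the loop is unfinished,
hence the failure probability. -/
theorem one_le_runLoop_add (hrun : Measurable run)
    (hb : ∀ s, Inv s → (b.eval s ↔ 1 ≤ R s))
    (hstep : ∀ s, Inv s → 1 ≤ R s → HalvingStep Inv R κ s (run (tick c s)))
    {good : Set State} (hgood : MeasurableSet good)
    (hfin : ∀ s, Inv s → R s = 0 → tick c s ∈ good) (N : ℕ) (s : State) (hs : Inv s) :
    1 ≤ runLoop b c run N s good + (3 / 4) ^ N * 2 ^ (R s).size := by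
  induction N generalizing s with
  | zero => simp only [pow_zero, one_mul]; exact le_add_left (one_le_pow₀ (by norm_num))
  | succ N ih =>
    unfold runLoop
    have hL := measurable_runLoop b c hrun N
    split_ifs with hbs
    · have hR := (hb s hs).1 hbs
      obtain ⟨n, μ, k, hμ, hk, hν, bad, hbad, hbad2, hae⟩ := hstep s hs hR
      obtain ⟨S, hS⟩ : ∃ S, (R s).size = S + 1 :=
        ⟨(R s).size - 1, by have := Nat.size_pos.2 hR; omega⟩
      have hm : Measurable fun t => runLoop b c run N t good := (Measure.measurable_coe hgood).comp hL
      have hpt : ∀ᵐ z ∂μ, 1 ≤ (∫⁻ t, runLoop b c run N t good ∂(k z)) +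
          ((3 / 4) ^ N * 2 ^ S + bad.indicator (fun _ => (3 / 4) ^ N * 2 ^ S) z) := by
        filter_upwards [hae] with z ⟨t, hkt, hIt, htime, hRt, hgd⟩
        rw [hkt, lintegral_dirac' _ hm]
        refine (ih t hIt).trans ?_
        gcongr
        by_cases hz : z ∈ bad
        · rw [Set.indicator_of_mem hz]
          have h1 : (R t).size ≤ S + 1 := hS ▸ Nat.size_le_size hRt
          calc (3 / 4 : ℝ≥0∞) ^ N * 2 ^ (R t).size ≤ (3 / 4) ^ N * 2 ^ (S + 1) := by
                gcongr; norm_num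
            _ = _ := by rw [pow_succ]; ring
        · rw [Set.indicator_of_notMem hz, add_zero]
          have h1 : (R t).size ≤ S := by have := size_half_lt hR (hgd hz); omega
          gcongr; norm_num
      have h2 := lintegral_mono_ae hpt
      have hm2 : Measurable fun z => ∫⁻ t, runLoop b c run N t good ∂(k z) :=
        (Measure.measurable_lintegral hm).comp hk
      rw [lintegral_const, measure_univ, mul_one, lintegral_add_left hm2,
        lintegral_add_left measurable_const, lintegral_const, lintegral_indicator hbad,
        lintegral_const, Measure.restrict_apply_univ, measure_univ, mul_one] at h2
      rw [hν, Measure.bind_apply hgood hL.aemeasurable,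
        Measure.lintegral_bind hk.aemeasurable hm.aemeasurable]
      refine h2.trans ?_
      gcongr
      rw [hS]
      calc (3 / 4 : ℝ≥0∞) ^ N * 2 ^ S + (3 / 4) ^ N * 2 ^ S * μ bad
          ≤ (3 / 4) ^ N * 2 ^ S + (3 / 4) ^ N * 2 ^ S * (1 / 2) := by gcongr
        _ = (3 / 4) ^ N * 2 ^ S * (1 + 1 / 2) := by ring
        _ = (3 / 4) ^ N * 2 ^ S * ((3 / 4) * 2) := by
            congr 1
            rw [← ENNReal.toReal_eq_toReal_iff' (by finiteness) (by finiteness)]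
            rw [ENNReal.toReal_add (by finiteness) (by finiteness)]
            norm_num
        _ = _ := by ring
    · have hR : R s = 0 := by
        by_contra h0
        exact hbs ((hb s hs).2 (Nat.one_le_iff_ne_zero.2 h0))
      rw [Measure.dirac_apply' _ hgood, Set.indicator_of_mem (hfin s hs hR)]
      simp

end Halving

/-! ### Total correctness of the deterministic parts of a program -/

/-- Expressions do not read the clock, so assertions can ignore it and evaluate at time `0`. -/
theorem NExpr.eval_time (e : NExpr) (s : State) : e.eval s = e.eval (s.1, s.2.1, 0) := by
  induction e with
  | const c => rfl
  | var v => rfl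
  | add e f he hf => simp only [NExpr.eval, he, hf]
  | sub e f he hf => simp only [NExpr.eval, he, hf]

theorem RExpr.eval_time (e : RExpr) (s : State) : e.eval s = e.eval (s.1, s.2.1, 0) := by
  induction e with
  | ofNat e => simp only [RExpr.eval, e.eval_time s]
  | get a i j => simp only [RExpr.eval, i.eval_time s, j.eval_time s]
  | add e f he hf => simp only [RExpr.eval, he, hf]
  | sub e f he hf => simp only [RExpr.eval, he, hf]
  | mul e f he hf => simp only [RExpr.eval, he, hf]
  | div e f he hf => simp only [RExpr.eval, he, hf]
  | exp e he => simp only [RExpr.eval, he]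
  | log e he => simp only [RExpr.eval, he]

theorem Test.eval_time (b : Test) (s : State) : b.eval s ↔ b.eval (s.1, s.2.1, 0) := by
  induction b with
  | nle e f => simp only [Test.eval, e.eval_time s, f.eval_time s]
  | rle e f => simp only [Test.eval, e.eval_time s, f.eval_time s]
  | not b hb => simp only [Test.eval, hb]
  | and b c hb hc => simp only [Test.eval, hb, hc]

/-- Properties of the memory: of the integer variables and the arrays. -/
abbrev Assertion := (ℕ → ℕ) → (ℕ → ℕ → ℕ → ℝ) → Prop

/-- An array memory with one entry changed. -/
def setEntry (A : ℕ → ℕ → ℕ → ℝ) (a i j : ℕ) (r : ℝ) : ℕ → ℕ → ℕ → ℝ :=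
  fun a' i' j' => if a' = a ∧ i' = i ∧ j' = j then r else A a' i' j'

theorem setEntry_of_ne {A : ℕ → ℕ → ℕ → ℝ} {a a' : ℕ} (h : a' ≠ a) (i j : ℕ) (r : ℝ) :
    setEntry A a i j r a' = A a' := by
  funext i' j'
  simp [setEntry, h]

/-- Started in a memory with the property `Pre`, the program takes time at most `c` and ends in a
memory with the property `Post`, provided that at least `B` iterations of each loop are allowed. -/
def Triple (D : Sampler) (T : ℕ → ℕ → ℝ≥0) (B : ℕ) (Pre : Assertion) (P : Prog) (c : ℝ≥0)
    (Post : Assertion) : Prop :=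
  ∀ s : State, Pre s.1 s.2.1 → ∃ t : State, (∀ N, B ≤ N → run D T N P s = Measure.dirac t) ∧
    t.2.2 ≤ s.2.2 + c ∧ Post t.1 t.2.1

section Hoare

variable {D : Sampler} {T : ℕ → ℕ → ℝ≥0} {B : ℕ} {Pre Mid Post : Assertion} {P Q : Prog}
  {c d : ℝ≥0}

theorem Triple.conseq {Pre' Post' : Assertion} {c' : ℝ≥0} (h : Triple D T B Pre P c Post)
    (hpre : ∀ f A, Pre' f A → Pre f A) (hc : c ≤ c') (hpost : ∀ f A, Post f A → Post' f A) :
    Triple D T B Pre' P c' Post' := fun s hs => by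
  obtain ⟨t, h1, h2, h3⟩ := h s (hpre _ _ hs)
  exact ⟨t, h1, h2.trans (by gcongr), hpost _ _ h3⟩

/-- Stated as a weakest precondition, so that the verification runs backwards from the
postcondition. -/
theorem Triple.nset (v : ℕ) (e : NExpr) :
    Triple D T B (fun f A => Post (Function.update f v (e.eval (f, A, 0))) A) (.nset v e)
      (e.cost + 1) Post := fun s hs => by
  refine ⟨_, fun N _ => rfl, le_rfl, ?_⟩
  simp only [tick, setInt]
  rw [e.eval_time]
  exact hs

theorem Triple.rset (a : ℕ) (i j : NExpr) (e : RExpr) :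
    Triple D T B (fun f A => Post f (setEntry A a (i.eval (f, A, 0)) (j.eval (f, A, 0))
      (e.eval (f, A, 0)))) (.rset a i j e) (i.cost + j.cost + e.cost + 1) Post := fun s hs => by
  refine ⟨_, fun N _ => rfl, le_rfl, ?_⟩
  simp only [tick, setReal]
  rw [e.eval_time, i.eval_time, j.eval_time]
  exact hs

theorem Triple.seq (hD : ∀ m n, IsMarkovKernel (D m n)) (hQ : Triple D T B Mid Q d Post)
    (hP : Triple D T B Pre P c Mid) : Triple D T B Pre (.seq P Q) (c + d) Post := fun s hs => by
  obtain ⟨t, h1, h2, h3⟩ := hP s hs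
  obtain ⟨u, h4, h5, h6⟩ := hQ t h3
  refine ⟨u, fun N hN => ?_, h5.trans (by rw [← add_assoc]; gcongr), h6⟩
  unfold run
  rw [h1 N hN, Measure.dirac_bind (measurable_run D hD T N Q), h4 N hN]

theorem Triple.ite {b : Test}
    (hP : Triple D T B (fun f A => Pre f A ∧ b.eval (f, A, 0)) P c Post)
    (hQ : Triple D T B (fun f A => Pre f A ∧ ¬ b.eval (f, A, 0)) Q c Post) :
    Triple D T B Pre (.ite b P Q) (b.cost + 1 + c) Post := fun s hs => by
  by_cases hb : b.eval s
  · obtain ⟨t, h1, h2, h3⟩ := hP (tick (b.cost + 1) s) ⟨hs, (b.eval_time s).1 hb⟩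
    refine ⟨t, fun N hN => ?_, h2.trans (le_of_eq (by simp only [tick]; ring)), h3⟩
    unfold run
    rw [if_pos hb, h1 N hN]
  · obtain ⟨t, h1, h2, h3⟩ := hQ (tick (b.cost + 1) s) ⟨hs, fun h => hb ((b.eval_time s).2 h)⟩
    refine ⟨t, fun N hN => ?_, h2.trans (le_of_eq (by simp only [tick]; ring)), h3⟩
    unfold run
    rw [if_neg hb, h1 N hN]

/-- `for v in 0, …, w - 1 do P`. -/
def forLoop (v w : ℕ) (P : Prog) : Prog :=
  .seq (.nset v (.const 0)) (.loop (.nle (.add (.var v) (.const 1)) (.var w))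
    (.seq P (.nset v (.add (.var v) (.const 1)))))

/-- `I k` is the invariant after `k` iterations. One iteration beyond `K` must be allowed, because
the failing test also uses up a level of `runLoop`. -/
theorem Triple.while (hD : ∀ m n, IsMarkovKernel (D m n)) {b : Test} (I : ℕ → Assertion) {K : ℕ}
    (hK : K + 1 ≤ B) (hstep : ∀ k < K, Triple D T B (I k) P c (I (k + 1)))
    (hb : ∀ k < K, ∀ f A, I k f A → b.eval (f, A, 0))
    (hend : ∀ f A, I K f A → ¬ b.eval (f, A, 0)) :
    Triple D T B (I 0) (.loop b P) (K * (b.cost + 1 + c) + (b.cost + 1)) (I K) := by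
  -- Induction on the number `d` of iterations left. The budget `N` of the loops inside `P` stays
  -- fixed while the budget `M` of this loop shrinks.
  have key : ∀ d k, k + d = K → ∀ s : State, I k s.1 s.2.1 → ∃ t : State,
      (∀ N M, B ≤ N → d + 1 ≤ M → runLoop b (b.cost + 1) (run D T N P) M s = Measure.dirac t) ∧
      t.2.2 ≤ s.2.2 + (d * (b.cost + 1 + c) + (b.cost + 1)) ∧ I K t.1 t.2.1 := by
    intro d
    induction d with
    | zero =>
      intro k hk s hs
      obtain rfl : k = K := by omega
      refine ⟨tick (b.cost + 1) s, fun N M _ hM => ?_, by simp [tick], hs⟩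
      obtain ⟨M, rfl⟩ : ∃ M', M = M' + 1 := ⟨M - 1, by omega⟩
      unfold runLoop
      rw [if_neg fun h => hend _ _ hs ((b.eval_time s).1 h)]
    | succ d ih =>
      intro k hk s hs
      obtain ⟨t, h1, h2, h3⟩ := hstep k (by omega) (tick (b.cost + 1) s) hs
      obtain ⟨u, h4, h5, h6⟩ := ih (k + 1) (by omega) t h3
      refine ⟨u, fun N M hN hM => ?_, ?_, h6⟩
      · obtain ⟨M, rfl⟩ : ∃ M', M = M' + 1 := ⟨M - 1, by omega⟩
        unfold runLoop
        rw [if_pos ((b.eval_time s).2 (hb k (by omega) _ _ hs)), h1 N hN,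
          Measure.dirac_bind (measurable_runLoop b _ (measurable_run D hD T N P) M),
          h4 N M hN (by omega)]
      · calc u.2.2 ≤ t.2.2 + (d * (b.cost + 1 + c) + (b.cost + 1)) := h5
          _ ≤ (s.2.2 + (b.cost + 1) + c) + (d * (b.cost + 1 + c) + (b.cost + 1)) := by
              gcongr; exact h2
          _ = _ := by push_cast; ring
  intro s hs
  obtain ⟨t, h1, h2, h3⟩ := key K 0 (by omega) s hs
  exact ⟨t, fun N hN => h1 N N hN (hK.trans hN), h2, h3⟩

/-- The `10` pays for test and increment, the `8` for initialization and the last test. The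
invariant may not mention the loop variable, as the increment would break it. -/
theorem Triple.for (hD : ∀ m n, IsMarkovKernel (D m n)) {v w : ℕ} (hvw : v ≠ w)
    (I : ℕ → Assertion) {K : ℕ} (hK : K + 1 ≤ B)
    (hpre : ∀ f A, Pre f A → f w = K ∧ I 0 f A)
    (hI : ∀ k f A x, I k f A → I k (Function.update f v x) A)
    (hstep : ∀ k < K, Triple D T B (fun f A => f v = k ∧ f w = K ∧ I k f A) P c
      (fun f A => f v = k ∧ f w = K ∧ I (k + 1) f A)) :
    Triple D T B Pre (forLoop v w P) (K * (c + 10) + 8) (I K) := by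
  have hbody : ∀ k < K, Triple D T B (fun f A => f v = k ∧ f w = K ∧ I k f A)
      (.seq P (.nset v (.add (.var v) (.const 1)))) (c + 4)
      (fun f A => f v = k + 1 ∧ f w = K ∧ I (k + 1) f A) := fun k hk => by
    refine (Triple.seq hD (Triple.nset v _) ((hstep k hk).conseq (fun _ _ h => h) le_rfl
      fun f A h => ?_)).conseq (fun _ _ h => h) ?_ fun _ _ h => h
    · simp only [NExpr.eval, Function.update_self, Function.update_of_ne hvw.symm]
      exact ⟨by rw [h.1], h.2.1, hI _ _ _ _ h.2.2⟩
    · simp only [NExpr.cost]; norm_num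
  have hloop := Triple.while hD (b := .nle (.add (.var v) (.const 1)) (.var w))
    (fun k f A => f v = k ∧ f w = K ∧ I k f A) hK hbody
    (fun k hk f A h => by simp only [Test.eval, NExpr.eval]; omega)
    (fun f A h => by simp only [Test.eval, NExpr.eval]; omega)
  refine (Triple.seq hD hloop ((Triple.nset v (.const 0)).conseq (Pre' := Pre) (fun f A h => ?_)
    le_rfl fun _ _ h => h)).conseq (fun _ _ h => h) ?_ fun _ _ h => h.2.2
  · simp only [NExpr.eval, Function.update_self, Function.update_of_ne hvw.symm]
    exact ⟨trivial, (hpre f A h).1, hI _ _ _ _ (hpre f A h).2⟩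
  · simp only [NExpr.cost, Test.cost]
    push_cast
    apply le_of_eq
    ring

end Hoare

end RealRAM

/-! ### Partial coloring laws -/

/-- The infimum that defines `psi2Norm` need not be attained, hence the slack `k < s`. Boundedness
of `X` makes the set nonempty; otherwise `sInf` would be the default value `0` and carry no
information. -/
theorem lintegral_exp_sq_le_two {Ω : Type*} [MeasurableSpace Ω] {μ : Measure Ω}
    [IsProbabilityMeasure μ] {X : Ω → ℝ} {b k s : ℝ} (hX : ∀ᵐ ω ∂μ, |X ω| ≤ b)
    (hk : psi2Norm X μ ≤ k) (hks : k < s) :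
    ∫⁻ ω, ENNReal.ofReal (Real.exp (X ω ^ 2 / s ^ 2)) ∂μ ≤ 2 := by
  have hb : 0 ≤ b := by
    obtain ⟨ω, hω⟩ := hX.exists
    exact (abs_nonneg _).trans hω
  have hne : ({s : ℝ | 0 < s ∧ ∫⁻ ω, ENNReal.ofReal (Real.exp (X ω ^ 2 / s ^ 2)) ∂μ ≤ 2}).Nonempty := by
    refine ⟨2 * b + 1, by positivity, ?_⟩
    calc ∫⁻ ω, ENNReal.ofReal (Real.exp (X ω ^ 2 / (2 * b + 1) ^ 2)) ∂μ ≤ ∫⁻ _, 2 ∂μ := by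
          refine lintegral_mono_ae ?_
          filter_upwards [hX] with ω hω
          rw [show (2 : ℝ≥0∞) = ENNReal.ofReal 2 by simp]
          refine ENNReal.ofReal_le_ofReal ?_
          have h1 : X ω ^ 2 / (2 * b + 1) ^ 2 ≤ 1 / 2 := by
            rw [div_le_iff₀ (by positivity), ← sq_abs]
            nlinarith [abs_nonneg (X ω)]
          have h2 : Real.exp (1 / 2) ^ 2 = Real.exp 1 := by rw [← Real.exp_nat_mul]; norm_num
          have h3 := Real.exp_le_exp.2 h1
          have := Real.exp_one_lt_d9
          nlinarith [Real.exp_pos (1 / 2)]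
      _ = 2 := by simp
  obtain ⟨s', ⟨hs', h2⟩, hlt⟩ := exists_lt_of_csInf_lt hne (lt_of_le_of_lt hk hks)
  refine le_trans (lintegral_mono fun ω => ENNReal.ofReal_le_ofReal (Real.exp_le_exp.2 ?_)) h2
  gcongr

/-- Subgaussian moments of order `√P`: `rpow_le_rpow_mul_exp` with exponent `P/2` at `t = x²/s²`. -/
theorem lintegral_abs_rpow_le {Ω : Type*} [MeasurableSpace Ω] {μ : Measure Ω} {X : Ω → ℝ}
    {s P : ℝ} (hs : 0 < s) (hP : 1 ≤ P)
    (h : ∫⁻ ω, ENNReal.ofReal (Real.exp (X ω ^ 2 / s ^ 2)) ∂μ ≤ 2) :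
    ∫⁻ ω, ENNReal.ofReal (|X ω| ^ P) ∂μ ≤ ENNReal.ofReal (2 * (s * Real.sqrt P) ^ P) := by
  have hP0 : 0 < P := by linarith
  have hpt : ∀ x : ℝ, |x| ^ P ≤ (s * Real.sqrt P) ^ P * Real.exp (x ^ 2 / s ^ 2) := by
    intro x
    have h1 := rpow_le_rpow_mul_exp (P := P / 2) (t := x ^ 2 / s ^ 2) (by linarith) (by positivity)
    have h2 : (x ^ 2 / s ^ 2) ^ (P / 2) = |x| ^ P / s ^ P := by
      rw [Real.div_rpow (by positivity) (by positivity), ← sq_abs, ← Real.rpow_natCast,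
        ← Real.rpow_natCast, ← Real.rpow_mul (abs_nonneg _), ← Real.rpow_mul hs.le]
      push_cast
      rw [mul_div_cancel₀ P (by norm_num : (2 : ℝ) ≠ 0)]
    have h3 : (P / 2) ^ (P / 2) ≤ Real.sqrt P ^ P := by
      rw [Real.sqrt_eq_rpow, ← Real.rpow_mul hP0.le, show 1 / 2 * P = P / 2 by ring]
      exact Real.rpow_le_rpow (by positivity) (by linarith) (by positivity)
    rw [h2, div_le_iff₀ (by positivity)] at h1
    rw [Real.mul_rpow hs.le (Real.sqrt_nonneg _)]
    refine h1.trans ?_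
    have : (P / 2) ^ (P / 2) * Real.exp (x ^ 2 / s ^ 2) * s ^ P
        ≤ Real.sqrt P ^ P * Real.exp (x ^ 2 / s ^ 2) * s ^ P := by gcongr
    linarith
  calc _ ≤ ∫⁻ ω, ENNReal.ofReal ((s * Real.sqrt P) ^ P) *
          ENNReal.ofReal (Real.exp (X ω ^ 2 / s ^ 2)) ∂μ := by
        refine lintegral_mono fun ω => ?_
        rw [← ENNReal.ofReal_mul (by positivity)]
        exact ENNReal.ofReal_le_ofReal (hpt _)
    _ = ENNReal.ofReal ((s * Real.sqrt P) ^ P) *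
          ∫⁻ ω, ENNReal.ofReal (Real.exp (X ω ^ 2 / s ^ 2)) ∂μ := by
        rw [lintegral_const_mul' _ _ ENNReal.ofReal_ne_top]
    _ ≤ ENNReal.ofReal ((s * Real.sqrt P) ^ P) * 2 := by gcongr
    _ = _ := by
        rw [mul_comm 2, ENNReal.ofReal_mul (by positivity)]; simp

/-- The score `∑ (|y_i| / (c √(n/π)))^(1/π)`, computed with `exp` and `log`. -/
noncomputable def score (c n : ℕ) (π : ℝ) {m : ℕ} (y : Fin m → ℝ) : ℝ :=
  ∑ i, if y i * y i ≤ 0 then 0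
    else Real.exp (Real.log (y i * y i * π / ((c : ℝ) * c * n)) / (π + π))

/-- The test by which a sample is rejected. -/
def Rejected (c m n : ℕ) (π : ℝ) (y : Fin m → ℝ) : Prop :=
  ¬ π * logRatio m n ≤ 1 ∧ ¬ score c n π y ≤ 1

/-- Since `n (c √P n^(1/2-1/P))^P = (c² n P)^(P/2)`, every summand is a power with exponent `P/2 =
1/(2π)` of `y² π / (c² n)`. This needs no square root and only `π = 1/P`, so the machine can
evaluate it. -/
theorem score_eq {c n m : ℕ} {P : ℝ} (hP : 0 < P) (hc : 1 ≤ c) (hn : 1 ≤ n) (y : Fin m → ℝ) :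
    score c n P⁻¹ y = (∑ i, |y i| ^ P) / (n * (c * Real.sqrt P * (n : ℝ) ^ (1 / 2 - P⁻¹)) ^ P) := by
  have hn' : (0 : ℝ) < n := by exact_mod_cast hn
  have hc' : (0 : ℝ) < c := by exact_mod_cast hc
  unfold score
  rw [Finset.sum_div]
  refine Finset.sum_congr rfl fun i _ => ?_
  have hden : (n : ℝ) * (c * Real.sqrt P * (n : ℝ) ^ (1 / 2 - P⁻¹)) ^ P
      = ((c : ℝ) * c * n * P) ^ (P / 2) := by
    rw [Real.mul_rpow (by positivity) (by positivity), Real.mul_rpow (by positivity) (by positivity),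
      ← Real.rpow_mul hn'.le, Real.mul_rpow (by positivity) (by positivity),
      Real.mul_rpow (by positivity) (by positivity), Real.mul_rpow (by positivity) (by positivity),
      Real.sqrt_eq_rpow, ← Real.rpow_mul hP.le, ← Real.rpow_add hc',
      show (1 / 2 - P⁻¹) * P = P / 2 - 1 by field_simp, Real.rpow_sub hn', Real.rpow_one,
      show P / 2 + P / 2 = P by ring, show 1 / 2 * P = P / 2 by ring]
    field_simp
  rw [hden]
  split_ifs with h0
  · have : y i = 0 := by nlinarith [mul_self_nonneg (y i), mul_self_eq_zero.1 (le_antisymm h0 (mul_self_nonneg (y i)))]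
    rw [this, abs_zero, Real.zero_rpow hP.ne', zero_div]
  · have hy : 0 < |y i| := abs_pos.2 fun h => h0 (by rw [h]; simp)
    have e1 : |y i| ^ P = (y i * y i) ^ (P / 2) := by
      rw [← abs_mul_abs_self, ← pow_two, ← Real.rpow_natCast, ← Real.rpow_mul hy.le]
      push_cast
      rw [mul_div_cancel₀ P (by norm_num : (2 : ℝ) ≠ 0)]
    have e2 : 0 < y i * y i := not_le.1 h0
    rw [e1, ← Real.div_rpow e2.le (by positivity), Real.rpow_def_of_pos (by positivity)]
    congr 1
    rw [show y i * y i * P⁻¹ / ((c : ℝ) * c * n) = y i * y i / ((c : ℝ) * c * n * P) by field_simp]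
    field_simp
    ring

theorem measurable_score (c n : ℕ) (π : ℝ) {m : ℕ} :
    Measurable fun y : Fin m → ℝ => score c n π y := by
  unfold score
  refine Finset.measurable_sum _ fun i _ => ?_
  exact Measurable.ite (measurableSet_le (by fun_prop) measurable_const) measurable_const
    (by fun_prop)

theorem measurableSet_rejected (c m n : ℕ) (π : ℝ) : MeasurableSet {y | Rejected c m n π y} :=
  (MeasurableSet.const _).inter (measurableSet_le (measurable_score c n π) measurable_const).compl

/-- `e^(lt) ≥ lt` and `u² t = M ≥ 2/3`. -/
theorem exp_neg_mul_le_weight {M u2 l : ℝ} (hM : 2 / 3 ≤ M) (hu : 0 < u2) (hl : 0 < l) :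
    Real.exp (-((l + 1) * (M / u2))) ≤ 3 / 2 / l * (u2 * Real.exp (-(M / u2))) := by
  set t := M / u2 with ht
  have hM0 : 0 < M := by linarith
  have ht0 : 0 < t := by positivity
  have h1 : u2 * t = M := by rw [ht]; field_simp
  have h2 : l * t ≤ Real.exp (l * t) := by linarith [Real.add_one_le_exp (l * t)]
  have h3 : Real.exp (-t) = Real.exp (-((l + 1) * t)) * Real.exp (l * t) := by
    rw [← Real.exp_add]; ring_nf
  rw [h3]
  have h4 : 1 ≤ 3 / 2 / l * (u2 * Real.exp (l * t)) := by
    calc (1 : ℝ) ≤ 3 / 2 / l * (u2 * (l * t)) := by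
          rw [show 3 / 2 / l * (u2 * (l * t)) = 3 / 2 * (u2 * t) by field_simp, h1]; linarith
      _ ≤ _ := by gcongr
  nlinarith [Real.exp_pos (-((l + 1) * t))]

section Law

variable {C₁ C₂ K : ℝ} {m n : ℕ} {p : ℝ≥0∞} {A : Fin m → Fin n → ℝ} {x₀ : Fin n → ℝ}
  {μ : Measure (Fin n → ℝ)}

/-- The condition on `c` makes the rate `C₁ c²` at least `l + 1` with `l = 3/C₂`. Each term is then
at most `C₂/2` times its weight, and the weights sum to at most `3n/2`. -/
theorem IsPartialColoringLaw.coord_le (h : IsPartialColoringLaw C₁ C₂ K A x₀ μ)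
    (hC₂ : 0 < C₂) {c : ℕ} (hc : 3 / C₂ + 1 ≤ C₁ * (c : ℝ) ^ 2) (hp : 2 ≤ p) (hn : 1 ≤ n)
    (hnm : n ≤ m) (hA : ∀ j, (fun i => A i j) ∈ lpBall p m) :
    ∀ᵐ z ∂μ, ∀ i, |∑ j, A i j * (z j - x₀ j)|
      ≤ c * Real.sqrt (minReal p (logRatio m n)) * (n : ℝ) ^ (1 / 2 - (p⁻¹).toReal) := by
  have hn' : (0 : ℝ) < n := by exact_mod_cast hn
  have hM := half_le_minReal hp (two_thirds_le_logRatio hn hnm)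
  set M := minReal p (logRatio m n) with hMdef
  refine h.discrepancy _ (by positivity) ?_
  have hl : 0 < 3 / C₂ := by positivity
  calc _ ≤ ∑ i, 3 / 2 / (3 / C₂) * (rowRatio p A i ^ 2 * Real.exp (-(M / rowRatio p A i ^ 2))) := by
        refine Finset.sum_le_sum fun i _ => ?_
        split_ifs with hi
        · positivity
        · have hS : 0 < ∑ j, A i j ^ 2 := by
            obtain ⟨j, hj⟩ := Function.ne_iff.1 hi
            exact Finset.sum_pos' (fun _ _ => sq_nonneg _) ⟨j, Finset.mem_univ j, by
              simp only [Pi.zero_apply] at hj; positivity⟩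
          have hu2 : rowRatio p A i ^ 2
              = (∑ j, A i j ^ 2) / ((n : ℝ) ^ (1 / 2 - (p⁻¹).toReal)) ^ 2 := by
            unfold rowRatio
            rw [div_pow, Real.sq_sqrt hS.le]
          have hu0 : 0 < rowRatio p A i ^ 2 := by rw [hu2]; positivity
          refine le_trans (Real.exp_le_exp.2 ?_) (exp_neg_mul_le_weight hM hu0 hl)
          have e1 : (c * Real.sqrt M * (n : ℝ) ^ (1 / 2 - (p⁻¹).toReal)) ^ 2 / ∑ j, A i j ^ 2
              = (c : ℝ) ^ 2 * (M / rowRatio p A i ^ 2) := by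
            rw [hu2, mul_pow, mul_pow, Real.sq_sqrt (by linarith)]
            field_simp
          rw [e1, neg_mul, ← mul_assoc]
          have : 0 ≤ M / rowRatio p A i ^ 2 := by positivity
          gcongr
    _ = C₂ / 2 * ∑ i, rowRatio p A i ^ 2 * Real.exp (-(M / rowRatio p A i ^ 2)) := by
        rw [← Finset.mul_sum]; congr 1; field_simp
    _ ≤ C₂ / 2 * (3 / 2 * n) := by
        gcongr; exact sum_rowRatio_sq_mul_exp_le hp hn hnm hA
    _ ≤ C₂ * n := by nlinarith [mul_pos hC₂ hn']

theorem IsPartialColoringLaw.lintegral_row_le [IsProbabilityMeasure μ]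
    (h : IsPartialColoringLaw C₁ C₂ K A x₀ μ) (hK : 0 < K) (hx₀ : ∀ j, x₀ j ∈ Icc (-1 : ℝ) 1)
    {P : ℝ} (hP : 1 ≤ P) (i : Fin m) :
    ∫⁻ z, ENNReal.ofReal (|∑ j, A i j * (z j - x₀ j)| ^ P) ∂μ
      ≤ ENNReal.ofReal (2 * (2 * K * Real.sqrt (∑ j, A i j ^ 2) * Real.sqrt P) ^ P) := by
  rcases (Finset.sum_nonneg fun j (_ : j ∈ Finset.univ) => sq_nonneg (A i j)).eq_or_lt with h0 | h0
  · have h3 : ∀ j, A i j = 0 := fun j => by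
      have := (Finset.sum_eq_zero_iff_of_nonneg (fun _ _ => sq_nonneg _)).1 h0.symm j
        (Finset.mem_univ j)
      exact pow_eq_zero_iff (two_ne_zero) |>.1 this
    simp [h3, Real.zero_rpow (by linarith : P ≠ 0)]
  · have hs : 0 < Real.sqrt (∑ j, A i j ^ 2) := Real.sqrt_pos.2 h0
    refine lintegral_abs_rpow_le (by positivity) hP
      (lintegral_exp_sq_le_two (b := ∑ j, |A i j| * 2) ?_ (h.subgaussian (A i)) ?_)
    · filter_upwards [h.mem_cube] with z hz
      refine (Finset.abs_sum_le_sum_abs _ _).trans (Finset.sum_le_sum fun j _ => ?_)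
      rw [abs_mul]
      gcongr
      have h1 := hz j
      have h2 := hx₀ j
      rw [abs_le]
      constructor <;> linarith [h1.1, h1.2, h2.1, h2.2]
    · nlinarith [mul_pos hK hs]

/-- Markov's inequality for the `p`-th moment. As `c ≥ 4K`, the subgaussian scale is at most half of
the threshold scale, so the mean is at most `2 · (1/2)^p ≤ 1/2` of the threshold. -/
theorem IsPartialColoringLaw.rejected_le [IsProbabilityMeasure μ]
    (h : IsPartialColoringLaw C₁ C₂ K A x₀ μ) (hK : 0 < K) {c : ℕ} (hc1 : 1 ≤ c)
    (hc : 4 * K ≤ c) (hp : 2 ≤ p) (hn : 1 ≤ n) (hx₀ : ∀ j, x₀ j ∈ Icc (-1 : ℝ) 1)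
    (hA : ∀ j, (fun i => A i j) ∈ lpBall p m) :
    μ {z | Rejected c m n (p⁻¹).toReal fun i => ∑ j, A i j * (z j - x₀ j)} ≤ 1 / 2 := by
  have hn' : (0 : ℝ) < n := by exact_mod_cast hn
  have hc' : (0 : ℝ) < c := by exact_mod_cast hc1
  rcases eq_or_ne p ⊤ with rfl | hp'
  -- For `p = ∞` the input is `π = 0`, so `π L ≤ 1` and nothing is rejected.
  · simp [Rejected]
  have h2 := two_le_toReal hp hp'
  have hrow := sum_rowRatio_rpow_le hp hp' hn hA
  rw [ENNReal.toReal_inv]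
  unfold rowRatio at hrow
  rw [ENNReal.toReal_inv] at hrow
  set P := p.toReal
  set s : ℝ := (n : ℝ) ^ (1 / 2 - P⁻¹) with hs
  have hs0 : 0 < s := by positivity
  have hP0 : 0 < P := by linarith
  have hq : 0 < Real.sqrt P := Real.sqrt_pos.2 hP0
  set F : (Fin n → ℝ) → ℝ := fun z => ∑ i, |∑ j, A i j * (z j - x₀ j)| ^ P with hF
  set E : ℝ := n * (c * Real.sqrt P * s) ^ P with hE
  have hE0 : 0 < E := by positivity
  have hFm : Measurable F := by
    refine Finset.measurable_sum _ fun i _ => ?_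
    have : Measurable fun z : Fin n → ℝ => ∑ j, A i j * (z j - x₀ j) := by fun_prop
    exact (measurable_norm.comp this).pow_const P
  have hsub : {z | Rejected c m n P⁻¹ fun i => ∑ j, A i j * (z j - x₀ j)}
      ⊆ {z | ENNReal.ofReal E ≤ ENNReal.ofReal (F z)} := by
    intro z hz
    have h1 := hz.2
    rw [score_eq hP0 hc1 hn, div_le_one hE0] at h1
    exact ENNReal.ofReal_le_ofReal (not_le.1 h1).le
  have hint : ∫⁻ z, ENNReal.ofReal (F z) ∂μ ≤ ENNReal.ofReal (E / 2) := by
    calc ∫⁻ z, ENNReal.ofReal (F z) ∂μ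
        = ∑ i, ∫⁻ z, ENNReal.ofReal (|∑ j, A i j * (z j - x₀ j)| ^ P) ∂μ := by
          rw [← lintegral_finsetSum']
          · refine lintegral_congr fun z => ?_
            exact ENNReal.ofReal_sum_of_nonneg fun i _ => Real.rpow_nonneg (abs_nonneg _) _
          · intro i _
            have : Measurable fun z : Fin n → ℝ => ∑ j, A i j * (z j - x₀ j) := by fun_prop
            exact ((measurable_norm.comp this).pow_const P).ennreal_ofReal.aemeasurable
      _ ≤ ∑ i, ENNReal.ofReal (2 * (2 * K * Real.sqrt (∑ j, A i j ^ 2) * Real.sqrt P) ^ P) :=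
          Finset.sum_le_sum fun i _ => h.lintegral_row_le hK hx₀ (by linarith) i
      _ = ENNReal.ofReal (∑ i, 2 * (2 * K * Real.sqrt (∑ j, A i j ^ 2) * Real.sqrt P) ^ P) :=
          (ENNReal.ofReal_sum_of_nonneg fun i _ => by positivity).symm
      _ ≤ ENNReal.ofReal (E / 2) := by
          refine ENNReal.ofReal_le_ofReal ?_
          calc ∑ i, 2 * (2 * K * Real.sqrt (∑ j, A i j ^ 2) * Real.sqrt P) ^ P
              = 2 * (2 * K * Real.sqrt P * s) ^ P
                * ∑ i, (Real.sqrt (∑ j, A i j ^ 2) / s) ^ P := by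
                rw [Finset.mul_sum]
                refine Finset.sum_congr rfl fun i _ => ?_
                rw [mul_assoc 2 ((2 * K * Real.sqrt P * s) ^ P), ← Real.mul_rpow (by positivity) (by positivity)]
                congr 2
                field_simp
            _ ≤ 2 * (2 * K * Real.sqrt P * s) ^ P * n := by gcongr
            _ ≤ 2 * ((1 / 2) ^ P * (c * Real.sqrt P * s) ^ P) * n := by
                rw [← Real.mul_rpow (by norm_num) (by positivity)]
                have h5 : 2 * K * Real.sqrt P * s ≤ 1 / 2 * (c * Real.sqrt P * s) := by
                  have : 0 < Real.sqrt P * s := by positivity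
                  nlinarith
                gcongr
            _ ≤ 2 * (1 / 4 * (c * Real.sqrt P * s) ^ P) * n := by
                gcongr
                calc (1 / 2 : ℝ) ^ P ≤ (1 / 2) ^ (2 : ℝ) :=
                      Real.rpow_le_rpow_of_exponent_ge (by norm_num) (by norm_num) h2
                  _ = 1 / 4 := by norm_num
            _ = E / 2 := by rw [hE]; ring
  refine (measure_mono hsub).trans ?_
  refine (meas_ge_le_lintegral_div hFm.ennreal_ofReal.aemeasurable
    (by simpa using hE0) ENNReal.ofReal_ne_top).trans ?_
  rw [ENNReal.div_le_iff (by simpa using hE0) ENNReal.ofReal_ne_top]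
  refine hint.trans (le_of_eq ?_)
  rw [show (1 / 2 : ℝ≥0∞) = ENNReal.ofReal (1 / 2) by
    rw [ENNReal.ofReal_div_of_pos (by norm_num)]; simp, ← ENNReal.ofReal_mul (by norm_num)]
  congr 1
  ring

/-- Acceptance means `p ≥ L` or the moment bound, just what `vecNorm_le_of_abs_le` asks for. -/
theorem vecNorm_le_of_not_rejected {q : ℝ≥0∞} {c : ℕ} (hc : 1 ≤ c) (hp : 2 ≤ p) (hpq : p ≤ q)
    (hn : 1 ≤ n) (hnm : n ≤ m) {y : Fin m → ℝ}
    (hy : ∀ i, |y i| ≤ c * Real.sqrt (minReal p (logRatio m n))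
      * (n : ℝ) ^ (1 / 2 - (p⁻¹).toReal))
    (hr : ¬ Rejected c m n (p⁻¹).toReal y) : vecNorm q y ≤ 3 * c * stepBound m n p q := by
  have hn' : (0 : ℝ) < n := by exact_mod_cast hn
  have hc' : (0 : ℝ) < c := by exact_mod_cast hc
  have hL := two_thirds_le_logRatio hn hnm
  have hM := half_le_minReal hp hL
  have hM0 : 0 < Real.sqrt (minReal p (logRatio m n)) := Real.sqrt_pos.2 (by linarith)
  rw [← three_mul_rpow_eq_stepBound p q hn]
  refine vecNorm_le_of_abs_le hp hpq hn hnm (by positivity) hy fun hp' hlt => ?_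
  have h2 := two_le_toReal hp hp'
  have hP0 : 0 < p.toReal := by linarith
  rw [minReal_of_ne_top hp' (by linarith), min_eq_left hlt.le]
  unfold Rejected at hr
  rw [ENNReal.toReal_inv] at hr ⊢
  have h1 : ¬ p.toReal⁻¹ * logRatio m n ≤ 1 := by
    rw [inv_mul_le_iff₀ hP0, mul_one]; exact not_le.2 hlt
  have h3 : score c n p.toReal⁻¹ y ≤ 1 := by
    by_contra h4; exact hr ⟨h1, h4⟩
  have hq : 0 < Real.sqrt p.toReal := Real.sqrt_pos.2 hP0
  rwa [score_eq hP0 hc hn, div_le_one (by positivity)] at h3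

end Law

namespace RealRAM

/-! ### Uncolored coordinates -/

/-- The coordinate `j` of a point of the cube is not a sign. -/
def Uncolored (X : ℕ → ℝ) (j : ℕ) : Prop := ¬ 1 ≤ X j * X j

open Classical in
/-- The number of uncolored coordinates before `j`. -/
noncomputable def rank (X : ℕ → ℝ) (j : ℕ) : ℕ := Nat.count (Uncolored X) j

theorem rank_zero (X : ℕ → ℝ) : rank X 0 = 0 := by simp [rank]

theorem rank_succ_of_uncolored {X : ℕ → ℝ} {j : ℕ} (h : Uncolored X j) :
    rank X (j + 1) = rank X j + 1 := by simp [rank, Nat.count_succ, h]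

theorem rank_succ_of_colored {X : ℕ → ℝ} {j : ℕ} (h : ¬ Uncolored X j) :
    rank X (j + 1) = rank X j := by simp [rank, Nat.count_succ, h]

theorem rank_lt_rank {X : ℕ → ℝ} {i j : ℕ} (h : Uncolored X i) (hij : i < j) :
    rank X i < rank X j := by
  classical
  simpa [rank] using Nat.count_strict_mono h hij

theorem rank_le (X : ℕ → ℝ) (n : ℕ) : rank X n ≤ n := by
  classical
  exact Nat.count_le _

-- `rank` enumerates the uncolored coordinates consecutively, so it turns sums over compressed
-- columns into sums over the original ones.
open Classical in
theorem sum_range_rank {M : Type*} [AddCommMonoid M] (X : ℕ → ℝ) (n : ℕ) (g : ℕ → M) :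
    ∑ k ∈ Finset.range (rank X n), g k
      = ∑ j ∈ Finset.range n, if Uncolored X j then g (rank X j) else 0 := by
  induction n with
  | zero => simp [rank_zero]
  | succ n ih =>
    rw [Finset.sum_range_succ, ← ih]
    by_cases h : Uncolored X n
    · rw [rank_succ_of_uncolored h, Finset.sum_range_succ, if_pos h]
    · rw [rank_succ_of_colored h, if_neg h, add_zero]

theorem exists_rank_eq {X : ℕ → ℝ} {n k : ℕ} (hk : k < rank X n) :
    ∃ j < n, Uncolored X j ∧ rank X j = k := by
  induction n with
  | zero => simp [rank_zero] at hk
  | succ n ih =>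
    by_cases h : Uncolored X n
    · rw [rank_succ_of_uncolored h] at hk
      rcases Nat.lt_succ_iff_lt_or_eq.1 hk with h1 | h1
      · obtain ⟨j, hj, h2⟩ := ih h1
        exact ⟨j, by omega, h2⟩
      · exact ⟨n, by omega, h, h1.symm⟩
    · rw [rank_succ_of_colored h] at hk
      obtain ⟨j, hj, h2⟩ := ih hk
      exact ⟨j, by omega, h2⟩

open Classical in
theorem rank_eq_sum (X : ℕ → ℝ) (n : ℕ) :
    rank X n = ∑ j ∈ Finset.range n, if Uncolored X j then 1 else 0 := by
  rw [← sum_range_rank X n (fun _ => 1), Finset.sum_const, Finset.card_range, smul_eq_mul, mul_one]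

/-! ### The program -/

/-- A command without effect. -/
def skip : Prog := .nset 9 (.const 0)

/-- The test whether coordinate `j` (variable `3`) of the current point (array `2`) is uncolored. -/
def uncoloredTest : Test :=
  .not (.rle (.ofNat (.const 1))
    (.mul (.get 2 (.const 0) (.var 3)) (.get 2 (.const 0) (.var 3))))

/-- Copy the uncolored columns and coordinates to the arrays `3` and `4`. -/
def compress : Prog :=
  .seq (.nset 5 (.const 0)) (forLoop 3 1 (.ite uncoloredTest
    (.seq (forLoop 4 0 (.rset 3 (.var 4) (.var 5) (.get 0 (.var 4) (.var 3))))
      (.seq (.rset 4 (.const 0) (.var 5) (.get 2 (.const 0) (.var 3)))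
        (.nset 5 (.add (.var 5) (.const 1)))))
    skip))

/-- The current value of the row sum that is being computed. -/
def rowEntry : RExpr := .get 6 (.const 0) (.const 0)

/-- The expression for a summand of `score`. -/
def scoreExpr (c : ℕ) : RExpr :=
  .exp (.div
    (.log (.div (.mul (.mul rowEntry rowEntry) (.get 1 (.const 0) (.const 0)))
      (.mul (.mul (.ofNat (.const c)) (.ofNat (.const c))) (.ofNat (.var 2)))))
    (.add (.get 1 (.const 0) (.const 0)) (.get 1 (.const 0) (.const 0))))

/-- Compute the score of the sample. -/
def computeScore (c : ℕ) : Prog :=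
  .seq (.rset 6 (.const 0) (.const 1) (.ofNat (.const 0))) (forLoop 4 0
    (.seq (.rset 6 (.const 0) (.const 0) (.ofNat (.const 0)))
      (.seq (forLoop 5 2 (.rset 6 (.const 0) (.const 0) (.add rowEntry
          (.mul (.get 3 (.var 4) (.var 5))
            (.sub (.get 5 (.const 0) (.var 5)) (.get 4 (.const 0) (.var 5)))))))
        (.ite (.rle (.mul rowEntry rowEntry) (.ofNat (.const 0))) skip
          (.rset 6 (.const 0) (.const 1) (.add (.get 6 (.const 0) (.const 1)) (scoreExpr c)))))))

/-- The test whether the sample is rejected. -/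
def rejectTest : Test :=
  .and
    (.not (.rle (.mul (.get 1 (.const 0) (.const 0))
      (.log (.div (.ofNat (.add (.var 0) (.var 0))) (.ofNat (.var 2))))) (.ofNat (.const 1))))
    (.not (.rle (.get 6 (.const 0) (.const 1)) (.ofNat (.const 1))))

/-- Move the uncolored coordinates to the sample. -/
def moveTo : Prog :=
  .seq (.nset 5 (.const 0)) (forLoop 3 1 (.ite uncoloredTest
    (.seq (.rset 2 (.const 0) (.var 3) (.get 5 (.const 0) (.var 5)))
      (.nset 5 (.add (.var 5) (.const 1))))
    skip))

/-- Count the uncolored coordinates. -/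
def recount : Prog :=
  .seq (.nset 2 (.const 0)) (forLoop 3 1 (.ite uncoloredTest
    (.nset 2 (.add (.var 2) (.const 1))) skip))

/-- Process the sample. -/
def process (c : ℕ) : Prog :=
  .seq (computeScore c) (.seq (.ite rejectTest skip moveTo) recount)

/-- One round of the algorithm. -/
def roundProg (c : ℕ) : Prog :=
  .seq compress (.seq (.sample (.var 0) (.var 2) 3 4 5) (process c))

/-- Repeated partial coloring. -/
def coloringProg (c : ℕ) : Prog :=
  .seq (.nset 2 (.var 1)) (.loop (.nle (.const 1) (.var 2)) (roundProg c))

/-! ### Correctness of the deterministic parts -/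

section Verification

variable {D : Sampler} {T : ℕ → ℕ → ℝ≥0} {B m n R : ℕ} {π : ℝ} {V : ℕ → ℕ → ℝ} {X : ℕ → ℝ}

/-- The memory still contains the input. -/
def HasInput (m n : ℕ) (π : ℝ) (V : ℕ → ℕ → ℝ) : Assertion := fun f A =>
  f 0 = m ∧ f 1 = n ∧ A 0 = V ∧ A 1 0 0 = π

theorem HasInput.update {f : ℕ → ℕ} {A : ℕ → ℕ → ℕ → ℝ} (h : HasInput m n π V f A) {v : ℕ}
    (hv : 2 ≤ v) (x : ℕ) : HasInput m n π V (Function.update f v x) A := by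
  unfold HasInput
  rw [Function.update_of_ne (by omega), Function.update_of_ne (by omega)]
  exact h

theorem HasInput.setEntry {f : ℕ → ℕ} {A : ℕ → ℕ → ℕ → ℝ} (h : HasInput m n π V f A) {a : ℕ}
    (ha : 2 ≤ a) (i j : ℕ) (r : ℝ) : HasInput m n π V f (setEntry A a i j r) := by
  unfold HasInput
  rw [setEntry_of_ne (by omega), setEntry_of_ne (by omega)]
  exact h

theorem uncoloredTest_eval {f : ℕ → ℕ} {A : ℕ → ℕ → ℕ → ℝ} (hX : A 2 0 = X) :
    uncoloredTest.eval (f, A, 0) ↔ Uncolored X (f 3) := by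
  simp [uncoloredTest, Test.eval, RExpr.eval, NExpr.eval, Uncolored, hX]

theorem triple_skip {Pre Post : Assertion} {c : ℝ≥0}
    (h : ∀ f A, Pre f A → Post (Function.update f 9 0) A) (hc : 2 ≤ c) :
    Triple D T B Pre skip c Post :=
  (Triple.nset 9 (.const 0)).conseq h (by simp [NExpr.cost]; norm_num; exact hc) fun _ _ h => h

/-- The first `j` columns have been compressed. -/
def Compressed (m : ℕ) (V : ℕ → ℕ → ℝ) (X : ℕ → ℝ) (j : ℕ) (A : ℕ → ℕ → ℕ → ℝ) : Prop :=
  ∀ j' < j, Uncolored X j' → (∀ i < m, A 3 i (rank X j') = V i j') ∧ A 4 0 (rank X j') = X j'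

theorem triple_compress (hD : ∀ m n, IsMarkovKernel (D m n)) (hB : m + n + 2 ≤ B) :
    Triple D T B (fun f A => HasInput m n π V f A ∧ f 2 = R ∧ A 2 0 = X) compress
      (n * (m * 16 + 60) + 10)
      (fun f A => HasInput m n π V f A ∧ f 2 = R ∧ A 2 0 = X ∧ Compressed m V X n A) := by
  -- Variable `5` holds the next free compressed column, which is `rank X j`.
  set I : ℕ → Assertion := fun j f A => HasInput m n π V f A ∧ f 2 = R ∧ A 2 0 = X ∧
    f 5 = rank X j ∧ Compressed m V X j A with hI
  have hcol : ∀ j < n, Triple D T B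
      (fun f A => (f 3 = j ∧ f 1 = n ∧ I j f A) ∧ uncoloredTest.eval (f, A, 0))
      (.seq (forLoop 4 0 (.rset 3 (.var 4) (.var 5) (.get 0 (.var 4) (.var 3))))
      (.seq (.rset 4 (.const 0) (.var 5) (.get 2 (.const 0) (.var 3)))
        (.nset 5 (.add (.var 5) (.const 1))))) (m * 16 + 30)
      (fun f A => f 3 = j ∧ f 1 = n ∧ I (j + 1) f A) := by
    intro j hj
    have hloop := Triple.for (D := D) (T := T) (B := B) (c := 6) hD (v := 4) (w := 0) (by norm_num)
      (Pre := fun f A => (f 3 = j ∧ f 1 = n ∧ I j f A) ∧ uncoloredTest.eval (f, A, 0))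
      (P := .rset 3 (.var 4) (.var 5) (.get 0 (.var 4) (.var 3)))
      (fun i f A => f 3 = j ∧ I j f A ∧ Uncolored X j ∧ ∀ i' < i, A 3 i' (rank X j) = V i' j)
      (K := m) (by omega)
      (fun f A h => ⟨h.1.2.2.1.1, h.1.1, h.1.2.2, by
        have := (uncoloredTest_eval h.1.2.2.2.2.1).1 h.2
        rwa [h.1.1] at this, fun i' hi' => absurd hi' (by omega)⟩)
      (fun i f A x h => by
        obtain ⟨h1, ⟨h2, h3, h4, h5, h6⟩, h7, h8⟩ := h
        refine ⟨?_, ⟨h2.update (by norm_num) x, ?_, h4, ?_, h6⟩, h7, h8⟩ <;>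
          rw [Function.update_of_ne (by norm_num)] <;> assumption)
      (fun i hi => (Triple.rset _ _ _ _).conseq (fun f A h => by
        obtain ⟨h0, h0', h1, ⟨h2, h3, h4, h5, h6⟩, h7, h8⟩ := h
        simp only [NExpr.eval, RExpr.eval]
        refine ⟨h0, h0', h1, ⟨h2.setEntry (by norm_num) _ _ _, h3, ?_, h5, ?_⟩, h7, ?_⟩
        · rw [setEntry_of_ne (by norm_num)]; exact h4
        · intro j' hj' hu
          -- Columns copied earlier have smaller rank, so this write does not touch them.
          have hlt := rank_lt_rank hu hj'
          rw [setEntry_of_ne (a' := 4) (by norm_num)]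
          refine ⟨fun i' hi' => ?_, (h6 j' hj' hu).2⟩
          simp only [setEntry, h5]
          rw [if_neg (by omega)]
          exact (h6 j' hj' hu).1 i' hi'
        · intro i' hi'
          simp only [setEntry, h5, h0, h1, h2.2.2.1, and_true, true_and]
          split_ifs with hc
          · rw [hc]
          · exact h8 i' (by omega))
        (by simp only [NExpr.cost, RExpr.cost]; norm_num) fun _ _ h => h)
    refine (Triple.seq hD (Triple.seq hD (Triple.nset _ _) (Triple.rset _ _ _ _))
      (hloop.conseq (fun _ _ h => h) le_rfl fun f A h => ?_)).conseq (fun _ _ h => h) ?_ fun _ _ h => h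
    · obtain ⟨h1, ⟨h2, h3, h4, h5, h6⟩, h7, h8⟩ := h
      simp only [NExpr.eval, RExpr.eval]
      refine ⟨?_, ?_, (h2.setEntry (by norm_num) _ _ _).update (by norm_num) _, ?_, ?_, ?_, ?_⟩
      · rw [Function.update_of_ne (by norm_num)]; exact h1
      · rw [Function.update_of_ne (by norm_num)]; exact h2.2.1
      · rw [Function.update_of_ne (by norm_num)]; exact h3
      · rw [setEntry_of_ne (by norm_num)]; exact h4
      · rw [Function.update_self, h5, rank_succ_of_uncolored h7]
      · intro j' hj' hu
        rw [setEntry_of_ne (by norm_num)]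
        rcases Nat.lt_succ_iff_lt_or_eq.1 hj' with hc | rfl
        · have hlt := rank_lt_rank hu hc
          refine ⟨(h6 j' hc hu).1, ?_⟩
          simp only [setEntry, h5]
          rw [if_neg (by omega)]
          exact (h6 j' hc hu).2
        · refine ⟨h8, ?_⟩
          simp [setEntry, h5, h1, h4]
    · simp only [NExpr.cost, RExpr.cost]
      norm_num
      rw [add_assoc]
      gcongr <;> norm_num
  have hmain := Triple.for (D := D) (T := T) (B := B) hD (v := 3) (w := 1) (by norm_num)
      (Pre := fun f A => HasInput m n π V f A ∧ f 2 = R ∧ A 2 0 = X ∧ f 5 = 0) I (K := n) (by omega)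
      (fun f A h => ⟨h.1.2.1, h.1, h.2.1, h.2.2.1, by rw [h.2.2.2, rank_zero],
        fun j' hj' => absurd hj' (by omega)⟩)
      (fun j f A x h => by
        obtain ⟨h2, h3, h4, h5, h6⟩ := h
        refine ⟨h2.update (by norm_num) x, ?_, h4, ?_, h6⟩ <;>
          rw [Function.update_of_ne (by norm_num)] <;> assumption)
      (fun j hj => Triple.ite (hcol j hj) (triple_skip (fun f A h => by
        obtain ⟨⟨h0, h0', h2, h3, h4, h5, h6⟩, h7⟩ := h
        rw [uncoloredTest_eval h4, h0] at h7
        refine ⟨?_, ?_, h2.update (by norm_num) _, ?_, h4, ?_, fun j' hj' hu => ?_⟩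
        · rw [Function.update_of_ne (by norm_num)]; exact h0
        · rw [Function.update_of_ne (by norm_num)]; exact h0'
        · rw [Function.update_of_ne (by norm_num)]; exact h3
        · rw [Function.update_of_ne (by norm_num), h5, rank_succ_of_colored h7]
        · rcases Nat.lt_succ_iff_lt_or_eq.1 hj' with hc | rfl
          · exact h6 j' hc hu
          · exact absurd hu h7) (by
            calc (2 : ℝ≥0) ≤ 30 := by norm_num
              _ ≤ _ := le_add_self)))
  refine (Triple.seq hD hmain ((Triple.nset 5 (.const 0)).conseq (fun f A h => ?_) le_rfl
    fun _ _ h => h)).conseq (fun _ _ h => h) ?_ fun f A h => ⟨h.1, h.2.1, h.2.2.1, h.2.2.2.2⟩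
  · refine ⟨h.1.update (by norm_num) _, ?_, h.2.2, ?_⟩
    · rw [Function.update_of_ne (by norm_num)]; exact h.2.1
    · rw [Function.update_self]; rfl
  · simp only [NExpr.cost, RExpr.cost, uncoloredTest, Test.cost]
    push_cast
    rw [← NNReal.coe_le_coe]
    push_cast
    nlinarith [Nat.cast_nonneg (α := ℝ) n, Nat.cast_nonneg (α := ℝ) m]

end Verification

/-! ### Verification of the score, the rejection test and the update -/

section Verification

variable {D : Sampler} {T : ℕ → ℕ → ℝ≥0} {B m n R c : ℕ} {π : ℝ} {V M : ℕ → ℕ → ℝ}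
  {X x₀ Z : ℕ → ℝ}

/-- A summand of `score`. -/
noncomputable def scoreTerm (c R : ℕ) (π y : ℝ) : ℝ :=
  if y * y ≤ 0 then 0 else Real.exp (Real.log (y * y * π / ((c : ℝ) * c * R)) / (π + π))

/-- The memory while a sample is being processed. -/
def HasSample (m n R : ℕ) (π : ℝ) (V M : ℕ → ℕ → ℝ) (X x₀ Z : ℕ → ℝ) : Assertion := fun f A =>
  HasInput m n π V f A ∧ f 2 = R ∧ A 2 0 = X ∧ A 3 = M ∧ A 4 0 = x₀ ∧ A 5 0 = Z

theorem HasSample.update {f : ℕ → ℕ} {A : ℕ → ℕ → ℕ → ℝ} (h : HasSample m n R π V M X x₀ Z f A)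
    {v : ℕ} (hv : 3 ≤ v) (x : ℕ) :
    HasSample m n R π V M X x₀ Z (Function.update f v x) A := by
  refine ⟨h.1.update (by omega) x, ?_, h.2.2⟩
  rw [Function.update_of_ne (by omega)]
  exact h.2.1

theorem HasSample.setEntry {f : ℕ → ℕ} {A : ℕ → ℕ → ℕ → ℝ} (h : HasSample m n R π V M X x₀ Z f A)
    {a : ℕ} (ha : 6 ≤ a) (i j : ℕ) (r : ℝ) :
    HasSample m n R π V M X x₀ Z f (setEntry A a i j r) := by
  refine ⟨h.1.setEntry (by omega) _ _ _, h.2.1, ?_⟩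
  rw [setEntry_of_ne (a' := 2) (by omega), setEntry_of_ne (a' := 3) (by omega),
    setEntry_of_ne (a' := 4) (by omega), setEntry_of_ne (a' := 5) (by omega)]
  exact h.2.2

/-- The entry `i` of the image of the sample. -/
noncomputable def rowSum (R : ℕ) (M : ℕ → ℕ → ℝ) (x₀ Z : ℕ → ℝ) (i : ℕ) : ℝ :=
  ∑ k ∈ Finset.range R, M i k * (Z k - x₀ k)

theorem triple_computeScore (hD : ∀ m n, IsMarkovKernel (D m n)) (hB : m + R + 2 ≤ B) :
    Triple D T B (HasSample m n R π V M X x₀ Z) (computeScore c) (m * (R * 28 + 130) + 20)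
      (fun f A => HasSample m n R π V M X x₀ Z f A ∧
        A 6 0 1 = ∑ i ∈ Finset.range m, scoreTerm c R π (rowSum R M x₀ Z i)) := by
  -- Entry `(0, 1)` of array `6` accumulates the score, and entry `(0, 0)` holds the current row
  -- sum.
  set I : ℕ → Assertion := fun i f A => HasSample m n R π V M X x₀ Z f A ∧
    A 6 0 1 = ∑ i ∈ Finset.range i, scoreTerm c R π (rowSum R M x₀ Z i) with hI
  have hrow : ∀ i < m, Triple D T B (fun f A => f 4 = i ∧ f 0 = m ∧ I i f A)
      (.seq (.rset 6 (.const 0) (.const 0) (.ofNat (.const 0)))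
      (.seq (forLoop 5 2 (.rset 6 (.const 0) (.const 0) (.add rowEntry
          (.mul (.get 3 (.var 4) (.var 5))
            (.sub (.get 5 (.const 0) (.var 5)) (.get 4 (.const 0) (.var 5)))))))
        (.ite (.rle (.mul rowEntry rowEntry) (.ofNat (.const 0))) skip
          (.rset 6 (.const 0) (.const 1) (.add (.get 6 (.const 0) (.const 1)) (scoreExpr c))))))
      (R * 28 + 120) (fun f A => f 4 = i ∧ f 0 = m ∧ I (i + 1) f A) := by
    intro i hi
    have hsum := Triple.for (D := D) (T := T) (B := B) (c := 18) hD (v := 5) (w := 2) (by norm_num)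
      (Pre := fun f A => f 4 = i ∧ I i f A ∧ A 6 0 0 = 0)
      (P := .rset 6 (.const 0) (.const 0) (.add rowEntry
          (.mul (.get 3 (.var 4) (.var 5))
            (.sub (.get 5 (.const 0) (.var 5)) (.get 4 (.const 0) (.var 5))))))
      (fun k f A => f 4 = i ∧ I i f A ∧ A 6 0 0 = ∑ k ∈ Finset.range k, M i k * (Z k - x₀ k))
      (K := R) (by omega)
      (fun f A h => ⟨h.2.1.1.2.1, h.1, h.2.1, by rw [h.2.2, Finset.sum_range_zero]⟩)
      (fun k f A x h => by
        refine ⟨?_, ⟨h.2.1.1.update (by norm_num) x, h.2.1.2⟩, h.2.2⟩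
        rw [Function.update_of_ne (by norm_num)]; exact h.1)
      (fun k hk => (Triple.rset _ _ _ _).conseq (fun f A h => by
        obtain ⟨h0, h0', h1, ⟨h2, h3⟩, h4⟩ := h
        simp only [NExpr.eval, RExpr.eval, rowEntry]
        refine ⟨h0, h0', h1, ⟨h2.setEntry (by norm_num) _ _ _, ?_⟩, ?_⟩
        · simp only [setEntry]
          rw [if_neg (by omega)]
          exact h3
        · rw [Finset.sum_range_succ, ← h4]
          obtain ⟨-, -, -, e3, e4, e5⟩ := h2
          simp [setEntry, h0, h1, e3, e4, e5])
        (by simp only [NExpr.cost, RExpr.cost, rowEntry]; norm_num) fun _ _ h => h)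
    have hadd : Triple D T B
        (fun f A => f 4 = i ∧ I i f A ∧ A 6 0 0 = rowSum R M x₀ Z i)
        (.ite (.rle (.mul rowEntry rowEntry) (.ofNat (.const 0))) skip
          (.rset 6 (.const 0) (.const 1) (.add (.get 6 (.const 0) (.const 1)) (scoreExpr c)))) 80
        (fun f A => f 4 = i ∧ f 0 = m ∧ I (i + 1) f A) := by
      refine (Triple.ite (c := 60) (triple_skip (fun f A h => ?_) (by norm_num))
        ((Triple.rset _ _ _ _).conseq (fun f A h => ?_) ?_ fun _ _ h => h)).conseq
        (fun _ _ h => h) ?_ fun _ _ h => h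
      · obtain ⟨⟨h1, ⟨h2, h3⟩, h4⟩, h5⟩ := h
        simp only [Test.eval, RExpr.eval, NExpr.eval, rowEntry, h4, Nat.cast_zero] at h5
        refine ⟨?_, ?_, h2.update (by norm_num) _, ?_⟩
        · rw [Function.update_of_ne (by norm_num)]; exact h1
        · rw [Function.update_of_ne (by norm_num)]; exact h2.1.1
        · rw [Finset.sum_range_succ, h3, scoreTerm, if_pos h5, add_zero]
      · obtain ⟨⟨h1, ⟨h2, h3⟩, h4⟩, h5⟩ := h
        simp only [Test.eval, RExpr.eval, NExpr.eval, rowEntry, h4, Nat.cast_zero] at h5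
        refine ⟨h1, h2.1.1, h2.setEntry (by norm_num) _ _ _, ?_⟩
        simp only [RExpr.eval, NExpr.eval, rowEntry, scoreExpr, setEntry, and_true,
          if_true, h4, h3, h2.1.2.2.2, h2.2.1]
        rw [Finset.sum_range_succ, scoreTerm, if_neg h5]
      · simp only [NExpr.cost, RExpr.cost, rowEntry, scoreExpr]
        push_cast
        norm_num
      · simp only [NExpr.cost, RExpr.cost, Test.cost, rowEntry]
        push_cast
        norm_num
    refine (Triple.seq hD (Triple.seq hD hadd hsum) ((Triple.rset _ _ _ _).conseq (fun f A h => ?_)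
      le_rfl fun _ _ h => h)).conseq (fun _ _ h => h) ?_ fun _ _ h => h
    · obtain ⟨h1, h1', h2, h3⟩ := h
      simp only [NExpr.eval, RExpr.eval, Nat.cast_zero]
      refine ⟨h1, ⟨h2.setEntry (by norm_num) _ _ _, ?_⟩, ?_⟩
      · simp only [setEntry]
        rw [if_neg (by omega)]
        exact h3
      · simp [setEntry]
    · simp only [NExpr.cost, RExpr.cost]
      rw [← NNReal.coe_le_coe]
      push_cast
      linarith
  refine (Triple.seq hD (Triple.for (D := D) (T := T) (B := B) hD (v := 4) (w := 0) (by norm_num)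
      (Pre := I 0) I (K := m) (by omega) (fun f A h => ⟨h.1.1.1, h⟩)
      (fun i f A x h => ⟨h.1.update (by norm_num) x, h.2⟩) hrow)
      ((Triple.rset _ _ _ _).conseq (fun f A h => ?_) le_rfl fun _ _ h => h)).conseq
      (fun _ _ h => h) ?_ fun _ _ h => h
  · refine ⟨h.setEntry (by norm_num) _ _ _, ?_⟩
    simp [setEntry, RExpr.eval, NExpr.eval]
  · simp only [NExpr.cost, RExpr.cost]
    rw [← NNReal.coe_le_coe]
    push_cast
    linarith

open Classical in
/-- The point `X` with its uncolored coordinates before `n` replaced by the entries of `Z`. -/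
noncomputable def moved (X Z : ℕ → ℝ) (n : ℕ) : ℕ → ℝ := fun j =>
  if j < n ∧ Uncolored X j then Z (rank X j) else X j

theorem moved_succ_of_ne {j j' : ℕ} (h : j' ≠ j) : moved X Z (j + 1) j' = moved X Z j j' := by
  classical
  exact if_congr ⟨fun ⟨a, b⟩ => ⟨by omega, b⟩, fun ⟨a, b⟩ => ⟨by omega, b⟩⟩ rfl rfl

theorem moved_succ_self {j : ℕ} (h : Uncolored X j) : moved X Z (j + 1) j = Z (rank X j) :=
  if_pos ⟨j.lt_succ_self, h⟩

theorem triple_moveTo (hD : ∀ m n, IsMarkovKernel (D m n)) (hB : n + 1 ≤ B) :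
    Triple D T B (fun f A => HasInput m n π V f A ∧ A 2 0 = X ∧ A 5 0 = Z) moveTo (n * 50 + 20)
      (fun f A => HasInput m n π V f A ∧ A 2 0 = moved X Z n) := by
  set I : ℕ → Assertion := fun j f A => HasInput m n π V f A ∧ A 2 0 = moved X Z j ∧ A 5 0 = Z ∧
    f 5 = rank X j with hI
  -- The test runs on the partly updated point, but coordinate `j` has not yet been overwritten.
  have hun : ∀ j, Uncolored (moved X Z j) j ↔ Uncolored X j := fun j => by
    simp [Uncolored, moved]
  have hstep : ∀ j < n, Triple D T B (fun f A => f 3 = j ∧ f 1 = n ∧ I j f A)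
      (.ite uncoloredTest (.seq (.rset 2 (.const 0) (.var 3) (.get 5 (.const 0) (.var 5)))
      (.nset 5 (.add (.var 5) (.const 1)))) skip) 40
      (fun f A => f 3 = j ∧ f 1 = n ∧ I (j + 1) f A) := by
    intro j hj
    refine (Triple.ite (c := 20) ((Triple.seq hD (Triple.nset _ _) (Triple.rset _ _ _ _)).conseq
      (fun f A h => ?_) ?_ fun _ _ h => h) (triple_skip (fun f A h => ?_) (by norm_num))).conseq
      (fun _ _ h => h) ?_ fun _ _ h => h
    · obtain ⟨⟨h1, h1', h2, h3, h4, h5⟩, h6⟩ := h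
      rw [uncoloredTest_eval h3, h1, hun] at h6
      simp only [NExpr.eval, RExpr.eval]
      refine ⟨?_, ?_, (h2.setEntry (by norm_num) _ _ _).update (by norm_num) _, ?_, ?_, ?_⟩
      · rw [Function.update_of_ne (by norm_num)]; exact h1
      · rw [Function.update_of_ne (by norm_num)]; exact h1'
      · funext j'
        simp only [setEntry, h3, h1, h4, h5, true_and]
        by_cases hj' : j' = j
        · rw [if_pos hj', hj', moved_succ_self h6]
        · rw [if_neg hj', moved_succ_of_ne hj']
      · rw [setEntry_of_ne (by norm_num)]; exact h4
      · rw [Function.update_self, h5, rank_succ_of_uncolored h6]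
    · simp only [NExpr.cost, RExpr.cost]
      norm_num
    · obtain ⟨⟨h1, h1', h2, h3, h4, h5⟩, h6⟩ := h
      rw [uncoloredTest_eval h3, h1, hun] at h6
      refine ⟨?_, ?_, h2.update (by norm_num) _, ?_, h4, ?_⟩
      · rw [Function.update_of_ne (by norm_num)]; exact h1
      · rw [Function.update_of_ne (by norm_num)]; exact h1'
      · rw [h3]
        funext j'
        by_cases hj' : j' = j
        · simp [hj', moved, h6]
        · rw [moved_succ_of_ne hj']
      · rw [Function.update_of_ne (by norm_num), h5, rank_succ_of_colored h6]
    · simp only [NExpr.cost, RExpr.cost, Test.cost, uncoloredTest]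
      norm_num
  refine (Triple.seq hD (Triple.for (D := D) (T := T) (B := B) hD (v := 3) (w := 1) (by norm_num)
      (Pre := I 0) I (K := n) (by omega) (fun f A h => ⟨h.1.2.1, h⟩)
      (fun j f A x h => ⟨h.1.update (by norm_num) x, h.2.1, h.2.2.1, by
        rw [Function.update_of_ne (by norm_num)]; exact h.2.2.2⟩) hstep)
      ((Triple.nset _ _).conseq (fun f A h => ?_) le_rfl fun _ _ h => h)).conseq
      (fun _ _ h => h) ?_ fun _ _ h => ⟨h.1, h.2.1⟩
  · refine ⟨h.1.update (by norm_num) _, ?_, h.2.2, ?_⟩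
    · rw [h.2.1]; funext j; simp [moved]
    · rw [Function.update_self, rank_zero]; rfl
  · simp only [NExpr.cost]
    rw [← NNReal.coe_le_coe]
    push_cast
    linarith

theorem triple_recount (hD : ∀ m n, IsMarkovKernel (D m n)) (hB : n + 1 ≤ B) :
    Triple D T B (fun f A => HasInput m n π V f A ∧ A 2 0 = X) recount (n * 40 + 20)
      (fun f A => HasInput m n π V f A ∧ A 2 0 = X ∧ f 2 = rank X n) := by
  set I : ℕ → Assertion := fun j f A => HasInput m n π V f A ∧ A 2 0 = X ∧ f 2 = rank X j with hI
  have hstep : ∀ j < n, Triple D T B (fun f A => f 3 = j ∧ f 1 = n ∧ I j f A)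
      (.ite uncoloredTest (.nset 2 (.add (.var 2) (.const 1))) skip) 30
      (fun f A => f 3 = j ∧ f 1 = n ∧ I (j + 1) f A) := by
    intro j hj
    refine (Triple.ite (c := 10) ((Triple.nset _ _).conseq
      (fun f A h => ?_) ?_ fun _ _ h => h) (triple_skip (fun f A h => ?_) (by norm_num))).conseq
      (fun _ _ h => h) ?_ fun _ _ h => h
    · obtain ⟨⟨h1, h1', h2, h3, h4⟩, h6⟩ := h
      rw [uncoloredTest_eval h3, h1] at h6
      simp only [NExpr.eval]
      refine ⟨?_, ?_, h2.update (by norm_num) _, h3, ?_⟩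
      · rw [Function.update_of_ne (by norm_num)]; exact h1
      · rw [Function.update_of_ne (by norm_num)]; exact h1'
      · rw [Function.update_self, h4, rank_succ_of_uncolored h6]
    · simp only [NExpr.cost]
      norm_num
    · obtain ⟨⟨h1, h1', h2, h3, h4⟩, h6⟩ := h
      rw [uncoloredTest_eval h3, h1] at h6
      refine ⟨?_, ?_, h2.update (by norm_num) _, h3, ?_⟩
      · rw [Function.update_of_ne (by norm_num)]; exact h1
      · rw [Function.update_of_ne (by norm_num)]; exact h1'
      · rw [Function.update_of_ne (by norm_num), h4, rank_succ_of_colored h6]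
    · simp only [NExpr.cost, RExpr.cost, Test.cost, uncoloredTest]
      norm_num
  refine (Triple.seq hD (Triple.for (D := D) (T := T) (B := B) hD (v := 3) (w := 1) (by norm_num)
      (Pre := I 0) I (K := n) (by omega) (fun f A h => ⟨h.1.2.1, h⟩)
      (fun j f A x h => ⟨h.1.update (by norm_num) x, h.2.1, by
        rw [Function.update_of_ne (by norm_num)]; exact h.2.2⟩) hstep)
      ((Triple.nset _ _).conseq (fun f A h => ?_) le_rfl fun _ _ h => h)).conseq
      (fun _ _ h => h) ?_ fun _ _ h => h
  · refine ⟨h.1.update (by norm_num) _, h.2, ?_⟩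
    rw [Function.update_self, rank_zero]; rfl
  · simp only [NExpr.cost]
    rw [← NNReal.coe_le_coe]
    push_cast
    linarith

theorem score_eq_sum_scoreTerm (c n : ℕ) (π : ℝ) (m : ℕ) (y : ℕ → ℝ) :
    score c n π (fun i : Fin m => y i) = ∑ i ∈ Finset.range m, scoreTerm c n π (y i) := by
  rw [Finset.sum_range]
  rfl

open Classical in
theorem triple_process (hD : ∀ m n, IsMarkovKernel (D m n)) (hB : m + n + R + 2 ≤ B) :
    Triple D T B (HasSample m n R π V M X x₀ Z) (process c)
      (m * (R * 28 + 130) + n * 90 + 100)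
      (fun f A => HasInput m n π V f A ∧
        A 2 0 = (if Rejected c m R π (fun i : Fin m => rowSum R M x₀ Z i) then X else moved X Z n) ∧
        f 2 = rank (if Rejected c m R π (fun i : Fin m => rowSum R M x₀ Z i) then X
          else moved X Z n) n) := by
  set Y := if Rejected c m R π (fun i : Fin m => rowSum R M x₀ Z i) then X else moved X Z n with hY
  have hev : ∀ f A, HasSample m n R π V M X x₀ Z f A →
      A 6 0 1 = ∑ i ∈ Finset.range m, scoreTerm c R π (rowSum R M x₀ Z i) →
      (rejectTest.eval (f, A, 0) ↔ Rejected c m R π (fun i : Fin m => rowSum R M x₀ Z i)) := by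
    intro f A h hs
    unfold Rejected
    rw [score_eq_sum_scoreTerm c R π m (rowSum R M x₀ Z)]
    simp only [rejectTest, Test.eval, RExpr.eval, NExpr.eval, hs, h.1.2.2.2, h.1.1, h.2.1,
      logRatio, Nat.cast_one]
    push_cast
    rw [two_mul]
  have hite : Triple D T B (fun f A => HasSample m n R π V M X x₀ Z f A ∧
        A 6 0 1 = ∑ i ∈ Finset.range m, scoreTerm c R π (rowSum R M x₀ Z i))
      (.ite rejectTest skip moveTo) (n * 50 + 50)
      (fun f A => HasInput m n π V f A ∧ A 2 0 = Y) := by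
    refine (Triple.ite (triple_skip (c := n * 50 + 20) (fun f A h => ?_) ?_)
      (?_ : Triple D T B _ moveTo _ _)).conseq (fun _ _ h => h) ?_ fun _ _ h => h
    · obtain ⟨⟨h1, h2⟩, h3⟩ := h
      rw [hev f A h1 h2] at h3
      rw [hY, if_pos h3]
      exact ⟨h1.1.update (by norm_num) _, h1.2.2.1⟩
    · exact le_trans (by norm_num) (le_add_self : (20 : ℝ≥0) ≤ n * 50 + 20)
    -- If the sample is rejected, the precondition of this branch is contradictory.
    · by_cases hr : Rejected c m R π (fun i : Fin m => rowSum R M x₀ Z i)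
      · intro s hs
        exact absurd ((hev _ _ hs.1.1 hs.1.2).2 hr) hs.2
      · rw [hY, if_neg hr]
        exact (triple_moveTo hD (by omega)).conseq
          (fun f A h => ⟨h.1.1.1, h.1.1.2.2.1, h.1.1.2.2.2.2.2⟩) le_rfl fun _ _ h => h
    · simp only [NExpr.cost, RExpr.cost, Test.cost, rejectTest]
      rw [← NNReal.coe_le_coe]
      push_cast
      linarith
  refine (Triple.seq hD (Triple.seq hD (triple_recount hD (by omega)) hite)
    (triple_computeScore hD (by omega))).conseq (fun _ _ h => h) ?_ fun _ _ h => h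
  rw [← NNReal.coe_le_coe]
  push_cast
  linarith

end Verification

/-! ### One round of the algorithm -/

section Main

variable {m n R c : ℕ} {π : ℝ} {V M : ℕ → ℕ → ℝ} {X x₀ Z : ℕ → ℝ}

theorem eq_one_or_eq_neg_one {x : ℝ} (hx : x ∈ Icc (-1 : ℝ) 1) (h : 1 ≤ x * x) :
    x = 1 ∨ x = -1 := by
  have h1 : x * x = 1 := le_antisymm (by nlinarith [hx.1, hx.2]) h
  exact mul_self_eq_one_iff.1 h1

theorem uncolored_moved_iff {j : ℕ} (hj : j < n) :
    Uncolored (moved X Z n) j ↔ Uncolored X j ∧ Uncolored Z (rank X j) := by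
  by_cases h : Uncolored X j
  · have : moved X Z n j = Z (rank X j) := if_pos ⟨hj, h⟩
    simp only [Uncolored] at h ⊢
    rw [this]
    tauto
  · have : moved X Z n j = X j := if_neg fun h' => h h'.2
    simp only [Uncolored] at h ⊢
    rw [this]
    tauto

theorem rank_moved (X Z : ℕ → ℝ) (n : ℕ) : rank (moved X Z n) n = rank Z (rank X n) := by
  classical
  rw [rank_eq_sum, rank_eq_sum, sum_range_rank]
  refine Finset.sum_congr rfl fun j hj => ?_
  rw [← ite_and]
  exact if_congr (uncolored_moved_iff (Finset.mem_range.1 hj)) rfl rfl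

/-- The change of the linear combination is the compressed matrix applied to the displacement of the
sample, the vector that the partial coloring law controls. -/
theorem sum_moved (X Z : ℕ → ℝ) (n : ℕ) (a M x₀ : ℕ → ℝ)
    (hM : ∀ j < n, Uncolored X j → M (rank X j) = a j ∧ x₀ (rank X j) = X j) :
    ∑ j ∈ Finset.range n, moved X Z n j * a j = ∑ j ∈ Finset.range n, X j * a j
      + ∑ k ∈ Finset.range (rank X n), M k * (Z k - x₀ k) := by
  classical
  rw [sum_range_rank, ← Finset.sum_add_distrib]
  refine Finset.sum_congr rfl fun j hj => ?_
  have hj' := Finset.mem_range.1 hj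
  by_cases h : Uncolored X j
  · have : moved X Z n j = Z (rank X j) := if_pos ⟨hj', h⟩
    rw [this, if_pos h, (hM j hj' h).1, (hM j hj' h).2]
    ring
  · have : moved X Z n j = X j := if_neg fun h' => h h'.2
    rw [this, if_neg h, add_zero]

theorem two_mul_rank_le {z : Fin R → ℝ} (hz : ∀ k, z k ∈ Icc (-1 : ℝ) 1)
    (hhalf : (R : ℝ) / 2 ≤ (({k | z k = 1 ∨ z k = -1} : Set (Fin R)).ncard : ℝ))
    (hZ : ∀ k : Fin R, Z k = z k) : 2 * rank Z R ≤ R := by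
  classical
  have h1 : rank Z R = (Finset.univ.filter fun k : Fin R => ¬ (z k = 1 ∨ z k = -1)).card := by
    rw [rank_eq_sum, Finset.sum_range, Finset.card_filter]
    refine Finset.sum_congr rfl fun k _ => if_congr ?_ rfl rfl
    unfold Uncolored
    rw [hZ]
    refine not_congr ⟨eq_one_or_eq_neg_one (hz k), ?_⟩
    rintro (h | h) <;> rw [h] <;> norm_num
  have h2 : ({k | z k = 1 ∨ z k = -1} : Set (Fin R)).ncard
      = (Finset.univ.filter fun k : Fin R => z k = 1 ∨ z k = -1).card := by
    rw [← Set.ncard_coe_finset]; simp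
  have h3 := Finset.card_filter_add_card_filter_not (s := (Finset.univ : Finset (Fin R)))
    (fun k => z k = 1 ∨ z k = -1)
  rw [Finset.card_univ, Fintype.card_fin] at h3
  rw [h2, div_le_iff₀ (by norm_num)] at hhalf
  have h4 : R ≤ (Finset.univ.filter fun k : Fin R => z k = 1 ∨ z k = -1).card * 2 := by
    exact_mod_cast hhalf
  omega

/-- The current linear combination. -/
noncomputable def combination (m n : ℕ) (V : ℕ → ℕ → ℝ) (X : ℕ → ℝ) : Fin m → ℝ := fun i =>
  ∑ j ∈ Finset.range n, X j * V i j

/-- The invariant of the main loop. -/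
def Invariant (c m n : ℕ) (p q : ℝ≥0∞) (V : ℕ → ℕ → ℝ) (s : State) : Prop :=
  HasInput m n (p⁻¹).toReal V s.1 s.2.1 ∧ s.1 2 = rank (s.2.1 2 0) n ∧
    (∀ j < n, s.2.1 2 0 j ∈ Icc (-1 : ℝ) 1) ∧
    vecNorm q (combination m n V (s.2.1 2 0))
      ≤ 3 * c * (totalBound (1 / 2) m n p q - totalBound (1 / 2) m (s.1 2) p q)

/-- Given the sample, a round is deterministic, and `bad` is rejection. A rejected sample leaves the
point alone; an accepted one adds at most `3c · stepBound` to the norm, covered by the drop of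
`totalBound` at rate `1/2`. -/
theorem halvingStep {D : Sampler} {T : ℕ → ℕ → ℝ≥0} {C₁ C₂ K : ℝ} {p q : ℝ≥0∞}
    (hDLM : D.IsLovettMeka C₁ C₂ K) (hT : IsTimeBound T) (hC₂ : 0 < C₂) (hK : 0 < K)
    (hc1 : 1 ≤ c) (hcK : 4 * K ≤ c) (hcC : 3 / C₂ + 1 ≤ C₁ * (c : ℝ) ^ 2)
    (hnm : n ≤ m) (hp : 2 ≤ p) (hpq : p ≤ q) (hpq' : ¬ (p = 2 ∧ q = ⊤))
    (hV : ∀ j < n, (fun i : Fin m => V i j) ∈ lpBall p m) {N : ℕ} (hN : m + 2 * n + 2 ≤ N)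
    {s : State} (hs : Invariant c m n p q V s) (hR : 1 ≤ s.1 2) (d : ℝ≥0) :
    HalvingStep (Invariant c m n p q V) (fun s => s.1 2) (d + 400 * (m * n) + 300 + T m n) s
      (run D T N (roundProg c) (tick d s)) := by
  have hD := hDLM.markov
  obtain ⟨hin, hrank, hcube, hnorm⟩ := hs
  set X := s.2.1 2 0 with hX
  set R := s.1 2 with hRdef
  have hRn : R ≤ n := hrank ▸ rank_le X n
  obtain ⟨t, ht, htime, htin, htR, htX, htC⟩ := triple_compress (D := D) (T := T)
    (B := m + 2 * n + 2) (R := R) (X := X) (π := (p⁻¹).toReal) (m := m) (n := n) (V := V) hD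
    (by omega) (tick d s) ⟨hin, rfl, rfl⟩
  obtain ⟨f, A, τ⟩ := t
  simp only at htime htin htR htX htC
  set M := A 3 with hM
  set x₀ := A 4 0 with hx₀
  set B : Fin m → Fin R → ℝ := fun i k => M i k with hB
  set w₀ : Fin R → ℝ := fun k => x₀ k with hw₀
  have hcol : ∀ k : Fin R, (fun i => B i k) ∈ lpBall p m ∧ w₀ k ∈ Icc (-1 : ℝ) 1 := by
    intro k
    obtain ⟨j, hj, hu, hjk⟩ := exists_rank_eq (lt_of_lt_of_eq k.2 hrank)
    have h1 := htC j hj hu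
    rw [hjk] at h1
    refine ⟨?_, ?_⟩
    · have : (fun i => B i k) = fun i : Fin m => V i j := funext fun i => h1.1 i i.2
      rw [this]; exact hV j hj
    · change A 4 0 k ∈ _
      rw [h1.2]; exact hcube j hj
  have hlaw := hDLM.spec m R B w₀ (fun k => (hcol k).2)
  set μ := D m R (B, w₀) with hμ
  have hμp : IsProbabilityMeasure μ := (hD m R).isProbabilityMeasure _
  have hRm : R ≤ m := hRn.trans hnm
  set y : (Fin R → ℝ) → Fin m → ℝ := fun z i => ∑ k, B i k * (z k - w₀ k) with hy
  set bad : Set (Fin R → ℝ) := {z | Rejected c m R (p⁻¹).toReal (y z)} with hbad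
  set g : (Fin R → ℝ) → State := fun z => tick (1 + 1 + 1 + T m R) (setRow 5 z (f, A, τ)) with hg
  have hgm : Measurable g :=
    (measurable_tick _).comp ((measurable_setRow 5).comp measurable_prodMk_left)
  have hprocm := measurable_run D hD T N (process c)
  refine ⟨R, μ, fun z => run D T N (process c) (g z), hμp, hprocm.comp hgm, ?_, bad, ?_, ?_, ?_⟩
  · have hsample : run D T N (.sample (.var 0) (.var 2) 3 4 5) (f, A, τ) = μ.map g := by
      have e0 : f 0 = m := htin.1
      have e2 : f 2 = R := htR
      simp only [run, NExpr.eval, NExpr.cost]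
      rw [hμ, hg]
      -- The type of the sample depends on the values of the two variables, so these equalities are
      -- substituted rather than rewritten.
      clear_value R
      subst e0 e2
      simp only [Nat.cast_one]
      rfl
    have e1 : run D T N (roundProg c) (tick d s)
        = (run D T N compress (tick d s)).bind
          (run D T N (.seq (.sample (.var 0) (.var 2) 3 4 5) (process c))) := rfl
    have e2 : run D T N (.seq (.sample (.var 0) (.var 2) 3 4 5) (process c)) (f, A, τ)
        = (run D T N (.sample (.var 0) (.var 2) 3 4 5) (f, A, τ)).bind
          (run D T N (process c)) := rfl
    rw [e1, ht N hN, Measure.dirac_bind (measurable_run D hD T N _), e2, hsample, Measure.bind,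
      Measure.map_map hprocm hgm]
    rfl
  · have hym : Measurable y := by fun_prop
    exact hym (measurableSet_rejected c m R _)
  · exact hlaw.rejected_le hK hc1 hcK hp hR (fun k => (hcol k).2) fun k => (hcol k).1
  · filter_upwards [hlaw.mem_cube, hlaw.half_colored,
      hlaw.coord_le hC₂ hcC hp hR hRm fun k => (hcol k).1] with z hz1 hz2 hz3
    set Z : ℕ → ℝ := (g z).2.1 5 0 with hZ
    have hZz : ∀ k : Fin R, Z k = z k := fun k => by
      simp [hZ, hg, tick, setRow, k.2]
    have hsamp : HasSample m n R (p⁻¹).toReal V M X x₀ Z (g z).1 (g z).2.1 := by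
      refine ⟨⟨htin.1, htin.2.1, ?_, ?_⟩, htR, ?_, ?_, ?_, rfl⟩
      · rw [← htin.2.2.1]; funext i j; simp [hg, tick, setRow]
      · rw [← htin.2.2.2]; simp [hg, tick, setRow]
      · rw [← htX]; funext j; simp [hg, tick, setRow]
      · funext i j; simp [hg, tick, setRow, hM]
      · funext j; simp [hg, tick, setRow, hx₀]
    obtain ⟨u, hu, hutime, huin, huX, huR⟩ := triple_process (D := D) (T := T) (c := c)
      (B := m + 2 * n + 2) hD (by omega) (g z) hsamp
    have hrow : (fun i : Fin m => rowSum R M x₀ Z i) = y z := by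
      funext i
      simp only [rowSum, hy, hB, hw₀]
      rw [Finset.sum_range]
      exact Finset.sum_congr rfl fun k _ => by rw [hZz]
    rw [hrow] at huX huR
    refine ⟨u, hu N hN, ?_⟩
    have htime' : u.2.2 ≤ s.2.2 + (d + 400 * (m * n) + 300 + T m n) := by
      have e1 : (g z).2.2 = τ + (1 + 1 + 1 + T m R) := rfl
      have e2 : T m R ≤ T m n := hT.mono _ _ _ _ le_rfl hRn
      have e3 : (tick d s).2.2 = s.2.2 + d := rfl
      rw [e3] at htime
      rw [e1] at hutime
      have hR' : (1 : ℝ) ≤ R := by exact_mod_cast hR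
      have hRn' : (R : ℝ) ≤ n := by exact_mod_cast hRn
      have hRm' : (R : ℝ) ≤ m := by exact_mod_cast hRm
      rw [← NNReal.coe_le_coe] at htime hutime e2 ⊢
      push_cast at htime hutime e2 ⊢
      have h1 : (m : ℝ) ≤ m * n := by nlinarith
      have h2 : (n : ℝ) ≤ m * n := by nlinarith
      have h3 : (m : ℝ) * R ≤ m * n := by nlinarith
      nlinarith
    by_cases hr : Rejected c m R (p⁻¹).toReal (y z)
    · rw [if_pos hr] at huX huR
      have huR' : u.1 2 = R := by rw [huR, hrank]
      refine ⟨⟨huin, ?_, ?_, ?_⟩, htime', huR'.le, fun h => absurd hr h⟩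
      · rw [huX]; exact huR
      · rw [huX]; exact hcube
      · rw [huX, huR']; exact hnorm
    · rw [if_neg hr] at huX huR
      rw [rank_moved, ← hrank] at huR
      have hhalf := two_mul_rank_le hz1 hz2 hZz
      rw [← huR] at hhalf
      refine ⟨⟨huin, ?_, ?_, ?_⟩, htime', by change u.1 2 ≤ R; omega, fun _ => hhalf⟩
      · rw [huX, huR, rank_moved, ← hrank]
      · rw [huX]
        intro j hj
        by_cases hun : Uncolored X j
        · have e1 : moved X Z n j = Z (rank X j) := if_pos ⟨hj, hun⟩
          have e2 : rank X j < R := by rw [hrank]; exact rank_lt_rank hun hj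
          rw [e1, hZz ⟨rank X j, e2⟩]
          exact hz1 _
        · have e1 : moved X Z n j = X j := if_neg fun h' => hun h'.2
          rw [e1]
          exact hcube j hj
      · rw [huX]
        have hcomb : combination m n V (moved X Z n) = combination m n V X + y z := by
          rw [← hrow]
          funext i
          simp only [combination, Pi.add_apply, rowSum]
          rw [hrank]
          exact sum_moved X Z n (fun j => V i j) (fun k => M i k) x₀ fun j hj hun =>
            ⟨(htC j hj hun).1 i i.2, (htC j hj hun).2⟩
        have hyn := vecNorm_le_of_not_rejected hc1 hp hpq hR hRm hz3 hr
        have hstep := stepBound_add_totalBound_le (m := m) (n := R) (n' := u.1 2) (c := 1 / 2)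
          hp hpq hpq' hR hRm (by norm_num) (by norm_num) (by
            have : (2 : ℝ) * (u.1 2 : ℕ) ≤ R := by exact_mod_cast hhalf
            linarith)
        have hc0 : (0 : ℝ) ≤ 3 * c := by positivity
        rw [hcomb]
        refine (vecNorm_add_le (hp.trans hpq) _ _).trans ((add_le_add hnorm hyn).trans ?_)
        rw [← mul_add]
        exact mul_le_mul_of_nonneg_left (by linarith) hc0

end Main

/-! ### Output, termination and total running time -/

theorem size_le_log {n : ℕ} (hn : 1 ≤ n) : (n.size : ℝ) ≤ 2 * (1 + Real.log n) := by
  have hn' : (0 : ℝ) < n := by exact_mod_cast hn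
  have h1 : n.size - 1 < n.size := by have := Nat.size_pos.2 hn; omega
  have h2 : (2 : ℝ) ^ (n.size - 1) ≤ n := by exact_mod_cast Nat.lt_size.1 h1
  have h3 := Real.log_le_log (by positivity) h2
  rw [Real.log_pow, Nat.cast_sub (by omega)] at h3
  have := Real.log_two_gt_d9
  have h4 : (1 : ℝ) ≤ n.size := by exact_mod_cast (by omega : 1 ≤ n.size)
  push_cast at h3
  nlinarith

/-- The output states with a balanced sum. -/
def Balanced {m n : ℕ} (q : ℝ≥0∞) (v : Fin n → Fin m → ℝ) (b : ℝ) (s : State) : Prop :=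
  ∃ x : Fin n → ℤˣ, Outputs s x ∧ vecNorm q (signedSum x v) ≤ b

theorem measurableSet_balanced {m n : ℕ} (q : ℝ≥0∞) (v : Fin n → Fin m → ℝ) (b : ℝ) :
    MeasurableSet {s | Balanced q v b s} := by
  have : {s | Balanced q v b s} = ⋃ x : Fin n → ℤˣ,
      ({s : State | Outputs s x} ∩ {_s | vecNorm q (signedSum x v) ≤ b}) := by
    ext s; simp [Balanced]
  rw [this]
  refine MeasurableSet.iUnion fun x => MeasurableSet.inter ?_ (MeasurableSet.const _)
  have : {s : State | Outputs s x} = ⋂ j : Fin n, {s : State | s.2.1 2 0 j = ((x j : ℤ) : ℝ)} := by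
    ext s; simp [Outputs]
  rw [this]
  exact MeasurableSet.iInter fun j => measurableSet_eq_fun (by fun_prop) measurable_const

theorem balanced_of_invariant {m n c : ℕ} {p q : ℝ≥0∞} (hp : 2 ≤ p) (hpq : p ≤ q)
    (hpq' : ¬ (p = 2 ∧ q = ⊤)) {v : Fin n → Fin m → ℝ} {V : ℕ → ℕ → ℝ}
    (hV : ∀ (i : Fin m) (j : Fin n), V i j = v j i) {s : State} (hs : Invariant c m n p q V s)
    (h0 : s.1 2 = 0) : Balanced q v (3 * c * totalBound (1 / 2) m n p q) s := by
  obtain ⟨-, hrank, hcube, hnorm⟩ := hs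
  rw [h0, totalBound_zero hp hpq hpq', sub_zero] at hnorm
  rw [h0] at hrank
  set X := s.2.1 2 0 with hX
  have hcol : ∀ j : Fin n, X j = 1 ∨ X j = -1 := by
    intro j
    refine eq_one_or_eq_neg_one (hcube j j.2) ?_
    -- An uncolored coordinate would make the rank positive.
    by_contra hu
    have := rank_lt_rank (X := X) (i := j) (j := n) hu j.2
    omega
  refine ⟨fun j => if X j = 1 then 1 else -1, ?_, ?_⟩
  · intro j
    change X j = (((if X j = 1 then 1 else -1 : ℤˣ) : ℤ) : ℝ)
    rcases hcol j with h | h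
    · simp [h]
    · rw [h, if_neg (by norm_num)]; simp
  · convert hnorm using 2
    funext i
    rw [signedSum_apply, combination, Finset.sum_range]
    refine Finset.sum_congr rfl fun j _ => ?_
    rw [hV, mul_comm]
    congr 1
    rcases hcol j with h | h
    · simp [h]
    · rw [h, if_neg (by norm_num)]; simp

section Main

variable {m n c : ℕ} {D : Sampler} {T : ℕ → ℕ → ℝ≥0} {C₁ C₂ K : ℝ} {p q : ℝ≥0∞}

/-- The state in which the main loop starts. -/
noncomputable def startState {m n : ℕ} (p q : ℝ≥0∞) (v : Fin n → Fin m → ℝ) : State :=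
  tick (((NExpr.var 1).cost : ℝ≥0) + 1) (setInt 2 ((NExpr.var 1).eval (input p q v)) (input p q v))

theorem invariant_startState (hp : 2 ≤ p) (hpq : p ≤ q) (v : Fin n → Fin m → ℝ) :
    Invariant c m n p q ((input p q v).2.1 0) (startState p q v) := by
  have hrow : (startState p q v).2.1 2 0 = fun _ => 0 := by
    funext j; simp [startState, tick, setInt, input]
  have hvar : (startState p q v).1 2 = n := by simp [startState, tick, setInt, input, NExpr.eval]
  have hrank : rank (fun _ => (0 : ℝ)) n = n := by
    rw [rank_eq_sum]
    simp [Uncolored]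
  refine ⟨⟨?_, ?_, rfl, ?_⟩, ?_, ?_, ?_⟩
  · simp [startState, tick, setInt, input]
  · simp [startState, tick, setInt, input]
  · simp [startState, tick, setInt, input]
  · rw [hrow, hvar, hrank]
  · rw [hrow]; intro j _; norm_num
  · rw [hrow, hvar, sub_self, mul_zero]
    have : combination m n ((input p q v).2.1 0) (fun _ => (0 : ℝ)) = 0 := by
      funext i; simp [combination]
    rw [this, vecNorm_zero (hp.trans hpq)]

theorem run_coloringProg (hD : ∀ m n, IsMarkovKernel (D m n)) (N : ℕ) (v : Fin n → Fin m → ℝ) :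
    run D T N (coloringProg c) (input p q v)
      = runLoop (.nle (.const 1) (.var 2)) 4 (run D T N (roundProg c)) N (startState p q v) := by
  have h := Measure.dirac_bind (measurable_run D hD T N
    (.loop (.nle (.const 1) (.var 2)) (roundProg c))) (startState p q v)
  refine h.trans ?_
  simp only [run, Test.cost, NExpr.cost]
  norm_num

theorem coloringProg_spec (hDLM : D.IsLovettMeka C₁ C₂ K) (hT : IsTimeBound T) (hC₂ : 0 < C₂)
    (hK : 0 < K) (hc1 : 1 ≤ c) (hcK : 4 * K ≤ c) (hcC : 3 / C₂ + 1 ≤ C₁ * (c : ℝ) ^ 2)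
    (hn : 1 ≤ n) (hnm : n ≤ m) (hp : 2 ≤ p) (hpq : p ≤ q) (hpq' : ¬ (p = 2 ∧ q = ⊤))
    {v : Fin n → Fin m → ℝ} (hv : ∀ j, v j ∈ lpBall p m) {b : ℝ}
    (hb : 3 * c * totalBound (1 / 2) m n p q ≤ b) :
    prob D T (coloringProg c) (input p q v) (Balanced q v b) = 1 ∧
    expectedTime D T (coloringProg c) (input p q v)
      ≤ ENNReal.ofReal (3000 * (1 + Real.log n) * T m n) := by
  have hD := hDLM.markov
  set V := (input p q v).2.1 0 with hVdef
  have hVv : ∀ (i : Fin m) (j : Fin n), V i j = v j i := by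
    intro i j; simp [hVdef, input]
  have hV : ∀ j < n, (fun i : Fin m => V i j) ∈ lpBall p m := by
    intro j hj
    have : (fun i : Fin m => V i j) = v ⟨j, hj⟩ := funext fun i => hVv i ⟨j, hj⟩
    rw [this]; exact hv _
  set κ : ℝ≥0 := 4 + 400 * (m * n) + 300 + T m n with hκ
  have hstart := invariant_startState (c := c) hp hpq v
  have hsize : (startState p q v).1 2 = n := by simp [startState, tick, setInt, input, NExpr.eval]
  have htest : ∀ s, Invariant c m n p q V s →
      ((Test.nle (.const 1) (.var 2)).eval s ↔ 1 ≤ s.1 2) := fun s _ => Iff.rfl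
  have hstep : ∀ N, m + 2 * n + 2 ≤ N → ∀ s, Invariant c m n p q V s → 1 ≤ s.1 2 →
      HalvingStep (Invariant c m n p q V) (fun s => s.1 2) κ s
        (run D T N (roundProg c) (tick 4 s)) := fun N hN s hs hR =>
    halvingStep hDLM hT hC₂ hK hc1 hcK hcC hnm hp hpq hpq' hV hN hs hR 4
  constructor
  · refine le_antisymm (iSup_le fun N => ?_) ?_
    · exact (measure_mono (subset_univ _)).trans (run_univ_le_one D hD T N _ _)
    -- From this `N` on the inner loops are never cut off; the error term then tends to `0`.
    · have hlow : ∀ N, m + 2 * n + 2 ≤ N → 1 ≤ prob D T (coloringProg c) (input p q v) (Balanced q v b)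
          + (3 / 4) ^ N * 2 ^ n.size := by
        intro N hN
        have h1 := one_le_runLoop_add (measurable_run D hD T N (roundProg c)) htest (hstep N hN)
          (measurableSet_balanced q v b) (fun s hs h0 => by
            obtain ⟨x, hx1, hx2⟩ := balanced_of_invariant hp hpq hpq' hVv hs h0
            exact ⟨x, hx1, hx2.trans hb⟩) N _ hstart
        simp only [hsize] at h1
        refine h1.trans ?_
        rw [← run_coloringProg hD]
        gcongr
        exact le_iSup (fun N => run D T N (coloringProg c) (input p q v) {t | Balanced q v b t}) N
      have hlim : Filter.Tendsto (fun N : ℕ => prob D T (coloringProg c) (input p q v)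
          (Balanced q v b) + (3 / 4 : ℝ≥0∞) ^ N * 2 ^ n.size) Filter.atTop
          (nhds (prob D T (coloringProg c) (input p q v) (Balanced q v b) + 0 * 2 ^ n.size)) := by
        refine Filter.Tendsto.add tendsto_const_nhds (ENNReal.Tendsto.mul_const ?_ ?_)
        · refine ENNReal.tendsto_pow_atTop_nhds_zero_of_lt_one ?_
          rw [ENNReal.div_lt_iff (by norm_num) (by norm_num)]
          norm_num
        · right; finiteness
      rw [zero_mul, add_zero] at hlim
      exact ge_of_tendsto hlim (Filter.eventually_atTop.2 ⟨_, hlow⟩)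
  · refine iSup_le fun N => ?_
    set N' := max N (m + 2 * n + 2)
    refine (lintegral_mono' (run_mono D hD T (le_max_left N (m + 2 * n + 2)) _ _) le_rfl).trans ?_
    rw [run_coloringProg hD]
    refine (lintegral_time_runLoop_le (measurable_run D hD T N' (roundProg c)) htest
      (hstep N' (le_max_right _ _)) N' _ hstart).trans ?_
    simp only [hsize]
    have h0 : (startState p q v).2.2 = 2 := by
      simp [startState, tick, setInt, input, NExpr.cost]; norm_num
    rw [h0]
    have hreal : (2 + 4 + 2 * (κ : ℝ) * n.size) ≤ 3000 * (1 + Real.log n) * T m n := by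
      have h1 := size_le_log hn
      have h2 : (m : ℝ) * n ≤ T m n := by exact_mod_cast hT.input_length m n
      have h3 : (1 : ℝ) ≤ m * n := by exact_mod_cast Nat.mul_pos (hn.trans hnm) hn
      have h4 : 0 ≤ Real.log n := Real.log_nonneg (by exact_mod_cast hn)
      -- `705 = 304 + 400 + 1`, using `1 ≤ mn ≤ T m n`.
      have h5 : (κ : ℝ) ≤ 705 * T m n := by rw [hκ]; push_cast; linarith
      have h6 : (κ : ℝ) * n.size ≤ 705 * T m n * (2 * (1 + Real.log n)) := by gcongr
      nlinarith
    rw [← ENNReal.ofReal_coe_nnreal, ← ENNReal.ofReal_coe_nnreal, ← ENNReal.ofReal_coe_nnreal,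
      ← ENNReal.ofReal_natCast, show (2 : ℝ≥0∞) = ENNReal.ofReal 2 by simp,
      ← ENNReal.ofReal_mul (by norm_num), ← ENNReal.ofReal_mul (by positivity),
      ← ENNReal.ofReal_add (by norm_num) (by norm_num),
      ← ENNReal.ofReal_add (by norm_num) (by positivity)]
    exact ENNReal.ofReal_le_ofReal (by push_cast; exact hreal)

end Main

end RealRAM

/-! ### Choice of the constants -/

theorem theorem2 :
    (∃ C : ℝ, 0 < C ∧ ∀ (m n : ℕ) (p q : ℝ≥0∞), 1 ≤ n → n ≤ m → 2 ≤ p → p ≤ q →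
      ¬ (p = 2 ∧ q = ⊤) →
      vb n (lpBall p m) (lpBall q m) ≤ ENNReal.ofReal (C * balBound m n p q)) ∧
    (∀ C₁ C₂ K : ℝ, 0 < C₁ → 0 < C₂ → 0 < K →
      ∃ (C : ℝ) (P : RealRAM.Prog), 0 < C ∧
        ∀ (D : Sampler) (T : ℕ → ℕ → ℝ≥0), D.IsLovettMeka C₁ C₂ K → IsTimeBound T →
          ∀ (m n : ℕ) (p q : ℝ≥0∞), 1 ≤ n → n ≤ m → 2 ≤ p → p ≤ q → ¬ (p = 2 ∧ q = ⊤) →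
            ∀ v : Fin n → Fin m → ℝ, (∀ i, v i ∈ lpBall p m) →
              RealRAM.prob D T P (RealRAM.input p q v) (fun s => ∃ x : Fin n → ℤˣ,
                RealRAM.Outputs s x ∧ vecNorm q (signedSum x v) ≤ C * balBound m n p q) = 1 ∧
              RealRAM.expectedTime D T P (RealRAM.input p q v) ≤
                ENNReal.ofReal (C * (1 + Real.log n) * T m n)) := by
  -- `38400 = 600 · 8 / (1/8)`: step constant times the geometric series at rate `1/8`.
  refine ⟨⟨38400, by norm_num, fun m n p q hn hnm hp hpq h => vb_lpBall_le hn hnm hp hpq h⟩,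
    fun C₁ C₂ K hC₁ hC₂ hK => ?_⟩
  -- The term `4K` is for the rejection probability and the last one for the discrepancy condition;
  -- `c ≥ 1` gives `c ≤ c²` there. A natural number can be a constant of the program.
  obtain ⟨c, hc⟩ := exists_nat_ge (max 1 (max (4 * K) ((3 / C₂ + 1) / C₁)))
  simp only [max_le_iff] at hc
  obtain ⟨hc1, hcK, hcC⟩ := hc
  have hcC' : 3 / C₂ + 1 ≤ C₁ * (c : ℝ) ^ 2 := by
    rw [div_le_iff₀ hC₁] at hcC
    have : (c : ℝ) ≤ (c : ℝ) ^ 2 := by nlinarith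
    nlinarith
  -- `48c = 3c · 8 / (1/2)` serves the norm and `3000` the time.
  refine ⟨48 * c + 3000, RealRAM.coloringProg c, by positivity,
    fun D T hD hT m n p q hn hnm hp hpq h v hv => ?_⟩
  have hbal : 0 ≤ balBound m n p q := by
    rw [balBound_eq]
    have := one_div_le_stepBound hp hpq h hn hnm
    have := balExponent_pos hp hpq h
    positivity
  have hbound : 3 * c * totalBound (1 / 2) m n p q ≤ (48 * c + 3000) * balBound m n p q := by
    have h1 := totalBound_le hp hpq h hn hnm (c := 1 / 2) (by norm_num)
    calc 3 * c * totalBound (1 / 2) m n p q ≤ 3 * c * (8 / (1 / 2) * balBound m n p q) := by gcongr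
      _ ≤ _ := by nlinarith
  obtain ⟨h1, h2⟩ := RealRAM.coloringProg_spec hD hT hC₂ hK (by exact_mod_cast hc1) hcK hcC' hn hnm
    hp hpq h hv hbound
  refine ⟨h1, h2.trans (ENNReal.ofReal_le_ofReal ?_)⟩
  have hlog : 0 ≤ Real.log n := Real.log_nonneg (by exact_mod_cast hn)
  gcongr
  linarith
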